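/- **Construction.** Let $l_1=m^2$ be a square number and let $\mathcal C_1$ be a set of $N_1=2^{m}$ words of length $l_1$ over $\{0,1\}$. Let $b$ be a further symbol (the spacer). Given a finite set $\mathcal C_j$ of words, of cardinality $N_j$, list it in an arbitrary order as $u^{(j)}_1,\dots,u^{(j)}_{N_j}$, and let $\mathcal C_{j+1}$ be the set of all words $$u_1^{(j)} u_2^{(j)} u_3^{(j)}\, b\, u_{\pi(4)}^{(j)} u_5^{(j)} \cdots u_8^{(j)}\, b\, u_{\pi(9)}^{(j)} u_{10}^{(j)} \cdots u_{N_j}^{(j)},$$ where $\pi$ runs over the permutations of $\{i^2 : 1<i\le \sqrt{N_j}\}$; that is, the words at the square positions $i^2$, $i>1$, are permuted among themselves and each is preceded by a spacer, and the other words stay fixed. Let $X\subset\{0,1,b\}^{\mathbb Z}$ be the set of all bi-infinite sequences each finite subword of which is a subword of a word in some $\mathcal C_j$, and let $\sigma$ be the left shift on $X$. **Terminology.** For a family $(F(\beta))_{\beta>0}$ of values in $[0,\infty]$, a number $c\ge 0$ is the *critical value* if $F(\beta)=0$ for all $\beta>c$ and $F(\beta)=\infty$ for all $0<\beta<c$ (when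 $F(\beta)$ is written as a limit, the existence of the limit for $\beta\neq c$, $\beta>0$, is included). For a finite open cover $\mathcal U$ of $X$ let $\mathcal N(\mathcal U)$ be the smallest cardinality of a subcover, and let $\overline D(\sigma,\mathcal U)$, respectively $\underline D(\sigma,\mathcal U)$, be the critical value in $[0,\infty]$ of the $\limsup_{n\to\infty}$, respectively $\liminf_{n\to\infty}$, of $n^{-\alpha}\log\mathcal N\bigl(\bigvee_{i=0}^{n-1}\sigma^{-i}\mathcal U\bigr)$ as a function of $\alpha>0$. The system has *topological entropy dimension* $d$ if $\sup_{\mathcal U}\overline D(\sigma,\mathcal U)=\sup_{\mathcal U}\underline D(\sigma,\mathcal U)=d$. *Strictly ergodic* means minimal and uniquely ergodic. *Topologically weakly mixing* means that $\sigma\times\sigma$ is topologically transitive. *Metrically weakly mixing* for an invariant probability measure $\mu$ means that $\sigma$ is ergodic and that, if $f:X\to\mathbb C$ is measurable, not a.e. zero, and $f\circ\sigma=\lambda f$ a.e. for some $\lambda\in\mathbb C$, then $\lambda=1$. *Metrically rigid* means that there are $n_1<n_2<\cdots$ such that $\mu(\sigma^{-n_k}A\,\triangle\,A)\to0$ for every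 measurable set $A$. For $x\in X$ put $P_n(x)=\{y\in X: y_i=x_i,\ 0\le i<n\}$ and $R_n(x)=\inf\{k>0: x_{[k,k+n)}=x_{[0,n)}\}$. **Theorem.** For all sufficiently large squares $l_1$, every such set $\mathcal C_1$ and every choice of the orderings, $(X,\sigma)$ is strictly ergodic, has topological entropy dimension $1/2$, and is topologically weakly mixing; with respect to its unique invariant probability measure $\mu$ it is metrically weakly mixing and metrically rigid. If moreover every word of $\mathcal C_1$ begins with $001$ and contains $00$ only as its prefix, then: 1. For $\mu$-a.e. $x\in X$, $\limsup_{n\to\infty}-\frac1{n^\beta}\log\mu(P_n(x))$ has the critical value $1/2$. 2. There is a set $\hat X\subset X$ of full measure such that for every $\tau\in[0,1/2]$ there is an increasing sequence $(n_j)$ such that for each $x\in\hat X$, $\lim_{j\to\infty}-\frac1{n_j^\beta}\log\mu(P_{n_j}(x))$ has the critical value $\tau$. 3. For $\mu$-a.e. $x\in X$, $\limsup_{n\to\infty}\frac1{n^\beta}\log R_n(x)$ has the critical value $1/2$. 4. There is a set $\hat X\subset X$ of full measure such that for every $\tau\in[0,1/2]$ there is an increasing sequence $(n_j)$ such that for each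 $x\in\hat X$, $\lim_{j\to\infty}\frac1{n_j^\beta}\log R_{n_j}(x)$ has the critical value $\tau$. -/

import Mathlib

open Set Filter Topology MeasureTheory
open scoped ENNReal

noncomputable section

namespace SpacerSubshift

/-! ### Critical values -/

/-- `c` is the critical value of `F`: `F β = 0` for `β > c` and `F β = ∞` for `β < c`,
where the exponent `β` ranges over the positive reals. -/
def IsCriticalValue (F : ℝ → EReal) (c : ℝ) : Prop :=
  ∀ β : ℝ, 0 < β → (c < β → F β = 0) ∧ (β < c → F β = ⊤)

/-- The limit `lim_j a β j` has the critical value `c`: it exists and equals `0` for `β > c`, and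
exists and equals `∞` for `0 < β < c`. -/
def LimHasCriticalValue (a : ℝ → ℕ → EReal) (c : ℝ) : Prop :=
  ∀ β : ℝ, 0 < β →
    (c < β → Tendsto (a β) atTop (𝓝 0)) ∧ (β < c → Tendsto (a β) atTop (𝓝 ⊤))

/-! ### Topological dynamics -/

section Topological

variable {X : Type*} [TopologicalSpace X]

/-- Minimality: the space is non-empty and has no proper non-empty closed invariant subset. -/
def IsMinimalSystem (T : X → X) : Prop :=
  Nonempty X ∧ ∀ K : Set X, IsClosed K → MapsTo T K K → K = ∅ ∨ K = univ

/-- Topological weak mixing: `T × T` is topologically transitive. -/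
def IsTopWeakMixing (T : X → X) : Prop :=
  ∀ U V : Set (X × X), IsOpen U → IsOpen V → U.Nonempty → V.Nonempty →
    ∃ n : ℕ, (U ∩ (Prod.map T T)^[n] ⁻¹' V).Nonempty

/-- `𝒰` is a finite open cover of `X`. -/
def IsFiniteOpenCover (𝒰 : Set (Set X)) : Prop :=
  𝒰.Finite ∧ (∀ A ∈ 𝒰, IsOpen A) ∧ ⋃₀ 𝒰 = univ

/-- The join `⋁_{i < n} T⁻ⁱ 𝒰`. -/
def iterJoin {X : Type*} (T : X → X) (𝒰 : Set (Set X)) (n : ℕ) : Set (Set X) :=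
  {A | ∃ f : Fin n → Set X, (∀ i, f i ∈ 𝒰) ∧ A = ⋂ i : Fin n, T^[i] ⁻¹' f i}

/-- The cardinality of a smallest subcover of a (finite) cover `𝒰`. -/
def minSubcoverCard {X : Type*} (𝒰 : Set (Set X)) : ℕ :=
  sInf {k | ∃ V : Finset (Set X), (V : Set (Set X)) ⊆ 𝒰 ∧ ⋃₀ (V : Set (Set X)) = univ ∧
    V.card = k}

/-- The quotient `log 𝒩(⋁_{i < n} T⁻ⁱ 𝒰) / n ^ α`. -/
def coverGrowth {X : Type*} (T : X → X) (𝒰 : Set (Set X)) (α : ℝ) (n : ℕ) : EReal :=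
  ((Real.log (minSubcoverCard (iterJoin T 𝒰 n)) / (n : ℝ) ^ α : ℝ) : EReal)

/-- The upper entropy dimension of `T` relative to `𝒰`: the critical value, in `[0, ∞]`, of
`α ↦ limsup_n log 𝒩(⋁_{i < n} T⁻ⁱ 𝒰) / n ^ α`, `α > 0`. -/
def upperEntropyDimCover {X : Type*} (T : X → X) (𝒰 : Set (Set X)) : EReal :=
  sInf {a : EReal | ∃ α : ℝ, 0 < α ∧ a = (α : EReal) ∧ limsup (coverGrowth T 𝒰 α) atTop = 0}

/-- The lower entropy dimension of `T` relative to `𝒰`, defined with `liminf`. -/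
def lowerEntropyDimCover {X : Type*} (T : X → X) (𝒰 : Set (Set X)) : EReal :=
  sInf {a : EReal | ∃ α : ℝ, 0 < α ∧ a = (α : EReal) ∧ liminf (coverGrowth T 𝒰 α) atTop = 0}

/-- The topological upper entropy dimension: supremum over all finite open covers. -/
def upperEntropyDim (T : X → X) : EReal :=
  sSup {d | ∃ 𝒰 : Set (Set X), IsFiniteOpenCover 𝒰 ∧ d = upperEntropyDimCover T 𝒰}

/-- The topological lower entropy dimension: supremum over all finite open covers. -/
def lowerEntropyDim (T : X → X) : EReal :=
  sSup {d | ∃ 𝒰 : Set (Set X), IsFiniteOpenCover 𝒰 ∧ d = lowerEntropyDimCover T 𝒰}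

/-- `T` has topological entropy dimension `d`: the upper and lower dimensions both equal `d`. -/
def HasEntropyDim (T : X → X) (d : ℝ) : Prop :=
  upperEntropyDim T = (d : EReal) ∧ lowerEntropyDim T = (d : EReal)

end Topological

/-! ### Measurable dynamics -/

section Measurable

variable {X : Type*} [MeasurableSpace X]

/-- There is exactly one invariant probability measure. -/
def IsUniquelyErgodic (T : X → X) : Prop :=
  ∃! μ : Measure X, IsProbabilityMeasure μ ∧ MeasurePreserving T μ μ

/-- Strict ergodicity: minimality together with unique ergodicity (for the Borel σ-algebra). -/
def IsStrictlyErgodic [TopologicalSpace X] [BorelSpace X] (T : X → X) : Prop :=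
  IsMinimalSystem T ∧ IsUniquelyErgodic T

/-- Metric weak mixing: `T` is ergodic and has no measurable eigenvalue other than `1`. -/
def IsMetricWeakMixing (T : X → X) (μ : Measure X) : Prop :=
  Ergodic T μ ∧ ∀ (f : X → ℂ) (z : ℂ), Measurable f → ¬ f =ᵐ[μ] 0 →
    (∀ᵐ x ∂μ, f (T x) = z * f x) → z = 1

/-- Metric rigidity: along some increasing sequence of times, `T^(n_k)` converges to the identity
on every measurable set. -/
def IsMetricRigid (T : X → X) (μ : Measure X) : Prop :=
  ∃ n : ℕ → ℕ, StrictMono n ∧ ∀ A : Set X, MeasurableSet A →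
    Tendsto (fun k => μ (symmDiff (T^[n k] ⁻¹' A) A)) atTop (𝓝 0)

end Measurable

/-! ### The construction -/

/-- The alphabet: the binary digits `0`, `1` and the spacer `2`. -/
abbrev Letter : Type := Fin 3

/-- The spacer symbol `b`. -/
def spacer : Letter := 2

/-- The `0`-based position `k` is permuted: `k + 1 = i ^ 2` for some `i > 1`. -/
def IsPermuted (k : ℕ) : Prop := IsSquare (k + 1) ∧ k ≠ 0

instance (k : ℕ) : Decidable (IsPermuted k) := inferInstanceAs (Decidable (_ ∧ _))

/-- Concatenation of `v 0, v 1, …` with a spacer inserted in front of every word standing at a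
permuted position: `v₁ v₂ v₃ b v₄ v₅ ⋯ v₈ b v₉ v₁₀ ⋯` in `1`-based notation. -/
def spacedConcat {N : ℕ} (v : Fin N → List Letter) : List Letter :=
  (List.ofFn fun k : Fin N => if IsPermuted k then spacer :: v k else v k).flatten

/-- The words obtained from an ordered word set `u` by permuting, in the spaced concatenation of
all the words of `u`, those at the permuted positions and leaving the others fixed. -/
def nextWords {N : ℕ} (u : Fin N → List Letter) : Set (List Letter) :=
  {w | ∃ π : Equiv.Perm (Fin N), (∀ k : Fin N, ¬ IsPermuted k → π k = k) ∧
    w = spacedConcat (u ∘ π)}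

/-- All the choices made in a run of the construction. The stages are numbered from `0`; the words
of stage `j` are listed without repetition, in an arbitrary order, as `word j 0, word j 1, …`. -/
structure Construction where
  /-- The square root of the length of the initial words. -/
  side : ℕ
  /-- The number of words of each stage. -/
  card : ℕ → ℕ
  /-- The ordered set of words of each stage. -/
  word : (j : ℕ) → Fin (card j) → List Letter
  word_injective : ∀ j, Function.Injective (word j)
  card_zero : card 0 = 2 ^ side
  length_zero : ∀ k, (word 0 k).length = side ^ 2
  binary_zero : ∀ k, ∀ a ∈ word 0 k, a ≠ spacer
  range_succ : ∀ j, range (word (j + 1)) = nextWords (word j)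

namespace Construction

/-- The initial words begin with the marker `001`, and `00` occurs in them only as a prefix. -/
def HasMarkers (S : Construction) : Prop :=
  ∀ k, ([0, 0, 1] : List Letter) <+: S.word 0 k ∧
    ¬ ([0, 0] : List Letter) <:+: (S.word 0 k).tail

/-- The word `x_i x_{i+1} ⋯ x_{i+n-1}`. -/
def subword (x : ℤ → Letter) (i : ℤ) (n : ℕ) : List Letter :=
  List.ofFn fun k : Fin n => x (i + (k : ℕ))

/-- The bi-infinite sequences each word of which is a subword of a word of some stage. -/
def space (S : Construction) : Set (ℤ → Letter) :=
  {x | ∀ (i : ℤ) (n : ℕ), ∃ (j : ℕ) (k : Fin (S.card j)), subword x i n <:+: S.word j k}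

/-- The left shift on the subshift. -/
def shift (S : Construction) (x : S.space) : S.space :=
  ⟨fun i => x.1 (i + 1), fun i n => by
    obtain ⟨j, k, h⟩ := x.2 (i + 1) n
    refine ⟨j, k, ?_⟩
    have e : subword (fun i => x.1 (i + 1)) i n = subword x.1 (i + 1) n := by
      unfold subword
      congr 1
      funext m
      exact congrArg x.1 (by ring)
    rw [e]
    exact h⟩

/-- The `n`-cylinder `P_n(x) = {y : y_i = x_i for 0 ≤ i < n}`. -/
def cylinder (S : Construction) (n : ℕ) (x : S.space) : Set S.space :=
  {y | ∀ i : ℕ, i < n → y.1 (i : ℤ) = x.1 (i : ℤ)}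

/-- The first return time `R_n(x) = inf {k > 0 : x_{[k, k+n)} = x_{[0, n)}}`. -/
def returnTime (S : Construction) (n : ℕ) (x : S.space) : ℕ∞ :=
  ⨅ (k : ℕ) (_ : 0 < k ∧ ∀ i : ℕ, i < n → x.1 ((k : ℤ) + (i : ℤ)) = x.1 (i : ℤ)), (k : ℕ∞)

/-- `- n ^ (-β) * log μ(P_n(x))`. -/
def atomRate (S : Construction) (μ : Measure S.space) (x : S.space) (β : ℝ) (n : ℕ) : EReal :=
  -ENNReal.log (μ (S.cylinder n x)) / (((n : ℝ) ^ β : ℝ) : EReal)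

/-- `n ^ (-β) * log R_n(x)`. -/
def returnRate (S : Construction) (x : S.space) (β : ℝ) (n : ℕ) : EReal :=
  ENNReal.log ((S.returnTime n x : ℕ∞) : ℝ≥0∞) / (((n : ℝ) ^ β : ℝ) : EReal)

end Construction

/-- The regularity of a family of rates `r x β n` claimed both for sizes of atoms and for return
times: almost surely `limsup_n r x β n` has the critical value `1/2`; and there is a set of full
measure such that every `τ ∈ [0, 1/2]` is, along an increasing sequence that depends on `τ` only,
the critical value of the limit at every point of the set. -/
def HasRegularRates {X : Type*} [MeasurableSpace X] (μ : Measure X) (r : X → ℝ → ℕ → EReal) :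
    Prop :=
  (∀ᵐ x ∂μ, IsCriticalValue (fun β => limsup (r x β) atTop) (1 / 2)) ∧
  ∃ X' : Set X, μ X'ᶜ = 0 ∧ ∀ τ ∈ Icc (0 : ℝ) (1 / 2), ∃ n : ℕ → ℕ, StrictMono n ∧
    ∀ x ∈ X', LimHasCriticalValue (fun β j => r x β (n j)) τ

end SpacerSubshift

end

/-! Write N and l for the number and the length of the words of stage j, N' and l' for those of
stage j + 1, and √ for the integer square root where positions are concerned. A word of stage j + 1
contains every word of stage j exactly once, and all but √N - 1 of them at fixed places. The k-th
one starts at k·l + √(k + 1) - 1, so spacers are counted by a square root. Hence N' = (√N - 1)! and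
l' ≈ N·l. It follows that log N ≤ √l at every stage, while the quotient √l / log N grows by at most
a constant factor per stage. Since log l grows at least like 2^j, this gives log N = l^(1/2 + o(1))
(`logCard_le_sqrt_len`, `sqrt_len_le_mul_logCard`), and N exceeds every power of l.

Dynamics. Every word of stage j + 1 sees the same collection of words of stage j, so frequencies are
determined up to boundary effects: this gives unique ergodicity, hence ergodicity, and minimality.
Two words t places apart are at distance t·l plus the number of squares passed. That number depends
on where one starts; any prescribed difference can be produced (`exists_gap`), which gives
topological weak mixing. Any two words of the same stage agree at their non-permuted subwords, hence
almost everywhere. So a shift by the distance of two words almost fixes a local set wherever that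
distance occurs. Neighbouring words usually have no spacer between them: rigidity along `len`. For
words about √N places apart, zero and one spacer both occur with positive frequency, so an
eigenvalue z has z^t and z^(t + 1) close to 1, and z = 1.

Entropy dimension. A window of length n meets about √(n / l) permuted places of stage j, each with
at most N choices, so the logarithm of the complexity is O(√n). Conversely these places can be
filled freely at the beginning of a word, which gives the exponent 1/2 from below.

Local rates. With markers, words occur only at their expected places, so a non-permuted word of
stage j recurs only after l' steps. Almost every point eventually sees, at every stage j, a run of
about N^(1/4) words without permuted ones. On the range 2l ≤ n ≤ N^(1/4)·l both -log μ(P_n) and log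
R_n are then comparable to log N ≈ √l. Taking n ≈ l^(1/(2τ)) in this range gives the critical value
τ, and its right end gives 0. The general upper bound O(√n) comes from complexity and
Borel–Cantelli. Both quantities are treated at once by `IsRecurrenceGauge`. -/

namespace SpacerSubshift

/-! ### Positions in a spaced concatenation -/

/-- The start of the `k`-th word in a spaced concatenation of words of length `l`. -/
def pos (l k : ℕ) : ℕ := k * l + (Nat.sqrt (k + 1) - 1)

/-- The length of a spaced concatenation of `N` words of length `l`. -/
def concatLength (l N : ℕ) : ℕ := N * l + (Nat.sqrt N - 1)

lemma sqrt_succ_of_isSquare {k : ℕ} (h : IsSquare (k + 1)) :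
    Nat.sqrt (k + 1) = Nat.sqrt k + 1 := by
  obtain ⟨r, hr⟩ := h
  have h1 : Nat.sqrt (k + 1) = r := by rw [hr, Nat.sqrt_eq]
  have hr0 : 0 < r := by
    rcases Nat.eq_zero_or_pos r with h | h
    · subst h; omega
    · exact h
  obtain ⟨q, rfl⟩ : ∃ q, r = q + 1 := ⟨r - 1, by omega⟩
  have h2 : Nat.sqrt k = q := by
    symm
    rw [Nat.eq_sqrt]
    constructor <;> nlinarith
  omega

lemma sqrt_succ_of_not_isSquare {k : ℕ} (h : ¬ IsSquare (k + 1)) :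
    Nat.sqrt (k + 1) = Nat.sqrt k := by
  have h1 := Nat.sqrt_le (k + 1)
  rw [Nat.eq_sqrt]
  have h3 : Nat.sqrt (k + 1) * Nat.sqrt (k + 1) ≠ k + 1 := fun e => h ⟨_, e.symm⟩
  have h4 := Nat.lt_succ_sqrt (k + 1)
  constructor
  · omega
  · simp only [Nat.succ_eq_add_one] at h4
    omega

lemma one_le_sqrt_succ (k : ℕ) : 1 ≤ Nat.sqrt (k + 1) := Nat.sqrt_pos.2 (by omega)

lemma pos_of_isPermuted {l k : ℕ} (h : IsPermuted k) : pos l k = concatLength l k + 1 := by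
  unfold pos concatLength
  rw [sqrt_succ_of_isSquare h.1]
  have : 1 ≤ Nat.sqrt k := Nat.sqrt_pos.2 (by have := h.2; omega)
  omega

lemma pos_of_not_isPermuted {l k : ℕ} (h : ¬ IsPermuted k) : pos l k = concatLength l k := by
  unfold pos concatLength
  by_cases h0 : k = 0
  · subst h0; simp
  · have : ¬ IsSquare (k + 1) := fun e => h ⟨e, h0⟩
    rw [sqrt_succ_of_not_isSquare this]

lemma concatLength_succ (l k : ℕ) : concatLength l (k + 1) = pos l k + l := by
  unfold pos concatLength
  rw [Nat.add_mul]
  omega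

@[simp] lemma pos_zero (l : ℕ) : pos l 0 = 0 := by simp [pos]

lemma pos_one (l : ℕ) : pos l 1 = l := by
  have : Nat.sqrt (1 + 1) = 1 := by rw [eq_comm, Nat.eq_sqrt]; omega
  simp [pos, this]

lemma concatLength_le_pos (l k : ℕ) : concatLength l k ≤ pos l k := by
  by_cases h : IsPermuted k
  · rw [pos_of_isPermuted h]; omega
  · rw [pos_of_not_isPermuted h]

lemma pos_add_le_pos (l : ℕ) {k k' : ℕ} (h : k < k') : pos l k + l ≤ pos l k' := by
  have h1 : Nat.sqrt (k + 1) ≤ Nat.sqrt (k' + 1) := Nat.sqrt_le_sqrt (by omega)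
  have h2 : (k + 1) * l ≤ k' * l := Nat.mul_le_mul_right _ h
  unfold pos
  rw [Nat.add_mul] at h2
  omega

lemma pos_mono (l : ℕ) : Monotone (pos l) := by
  intro a b h
  rcases h.eq_or_lt with rfl | h
  · rfl
  · have := pos_add_le_pos l h; omega

lemma pos_add_le_concatLength (l : ℕ) {k N : ℕ} (h : k < N) : pos l k + l ≤ concatLength l N := by
  obtain ⟨M, rfl⟩ : ∃ M, N = M + 1 := ⟨N - 1, by omega⟩
  rw [concatLength_succ]
  have := pos_mono l (show k ≤ M by omega)
  omega

lemma exists_index_of_lt_concatLength {l N i : ℕ} (h : i < concatLength l N) :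
    ∃ k, k < N ∧ ((pos l k ≤ i ∧ i < pos l k + l) ∨ (IsPermuted k ∧ i + 1 = pos l k)) := by
  induction N with
  | zero => simp [concatLength] at h
  | succ N ih =>
    by_cases h1 : i < concatLength l N
    · obtain ⟨k, hk, h2⟩ := ih h1
      exact ⟨k, by omega, h2⟩
    · rw [concatLength_succ] at h
      refine ⟨N, by omega, ?_⟩
      by_cases hp : IsPermuted N
      · have := pos_of_isPermuted (l := l) hp
        by_cases h3 : pos l N ≤ i
        · left; omega
        · right; exact ⟨hp, by omega⟩
      · have := pos_of_not_isPermuted (l := l) hp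
        left; omega

lemma spacedConcat_succ {N : ℕ} (v : Fin (N + 1) → List Letter) :
    spacedConcat v = spacedConcat (fun k : Fin N => v k.castSucc) ++
      (if IsPermuted N then spacer :: v (Fin.last N) else v (Fin.last N)) := by
  unfold spacedConcat
  rw [List.ofFn_succ']
  simp

lemma length_spacedConcat {N l : ℕ} (v : Fin N → List Letter) (h : ∀ k, (v k).length = l) :
    (spacedConcat v).length = concatLength l N := by
  induction N with
  | zero => simp [spacedConcat, concatLength]
  | succ N ih =>
    rw [spacedConcat_succ, List.length_append, ih _ (fun k => h _), concatLength_succ]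
    split_ifs with hp
    · rw [pos_of_isPermuted hp, List.length_cons, h]; omega
    · rw [pos_of_not_isPermuted hp, h]

lemma getD_spacedConcat {N l : ℕ} (v : Fin N → List Letter) (h : ∀ k, (v k).length = l)
    (k : Fin N) {i : ℕ} (hi : i < l) :
    (spacedConcat v).getD (pos l k + i) 0 = (v k).getD i 0 := by
  induction N with
  | zero => exact k.elim0
  | succ N ih =>
    rw [spacedConcat_succ]
    have hlen := length_spacedConcat (fun k : Fin N => v k.castSucc) (fun k => h _)
    refine Fin.lastCases ?_ (fun k => ?_) k
    · rw [Fin.val_last]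
      split_ifs with hp
      · rw [List.getD_append_right _ _ _ _ (by rw [hlen, pos_of_isPermuted hp]; omega), hlen,
          pos_of_isPermuted hp,
          show concatLength l N + 1 + i - concatLength l N = i + 1 by omega, List.getD_cons_succ]
      · rw [List.getD_append_right _ _ _ _ (by rw [hlen, pos_of_not_isPermuted hp]; omega), hlen,
          pos_of_not_isPermuted hp, Nat.add_sub_cancel_left]
    · rw [List.getD_append, ← ih _ (fun k => h _)]
      · rfl
      · have := pos_add_le_concatLength l k.2
        rw [hlen, Fin.val_castSucc]
        omega

lemma getD_spacedConcat_of_isPermuted {N l : ℕ} (v : Fin N → List Letter)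
    (h : ∀ k, (v k).length = l) (k : Fin N) (hk : IsPermuted k) :
    (spacedConcat v).getD (pos l k - 1) 0 = spacer := by
  induction N with
  | zero => exact k.elim0
  | succ N ih =>
    rw [spacedConcat_succ]
    have hlen := length_spacedConcat (fun k : Fin N => v k.castSucc) (fun k => h _)
    induction k using Fin.lastCases with
    | last =>
      rw [Fin.val_last] at hk ⊢
      rw [if_pos hk, List.getD_append_right _ _ _ _ (by rw [hlen, pos_of_isPermuted hk]; omega),
        hlen, pos_of_isPermuted hk]
      simp
    | cast k =>
      rw [List.getD_append, ← ih (fun k => v k.castSucc) (fun k => h _) k hk]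
      · rfl
      · have := pos_add_le_concatLength l k.2
        have := pos_of_isPermuted (l := l) hk
        rw [hlen, Fin.val_castSucc]
        simp only [Fin.val_castSucc] at *
        omega

namespace Construction

variable (S : Construction)

/-! ### Words of a construction -/

/-- The length of the words of stage `j`. -/
def len : ℕ → ℕ
  | 0 => S.side ^ 2
  | j + 1 => concatLength (len j) (S.card j)

/-- The `i`-th letter of the `k`-th word of stage `j`. -/
def letter (j : ℕ) (k : Fin (S.card j)) (i : ℕ) : Letter := (S.word j k).getD i 0

lemma exists_perm (j : ℕ) (K : Fin (S.card (j + 1))) :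
    ∃ π : Equiv.Perm (Fin (S.card j)), (∀ k : Fin (S.card j), ¬ IsPermuted k → π k = k) ∧
      S.word (j + 1) K = spacedConcat (S.word j ∘ π) := by
  have h : S.word (j + 1) K ∈ nextWords (S.word j) := by
    rw [← S.range_succ]; exact mem_range_self K
  exact h

/-- The permutation defining the `K`-th word of stage `j + 1`. -/
noncomputable def perm (j : ℕ) (K : Fin (S.card (j + 1))) : Equiv.Perm (Fin (S.card j)) :=
  (S.exists_perm j K).choose

lemma perm_apply {j : ℕ} (K : Fin (S.card (j + 1))) {k : Fin (S.card j)} (h : ¬ IsPermuted k) :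
    S.perm j K k = k := (S.exists_perm j K).choose_spec.1 k h

lemma word_succ (j : ℕ) (K : Fin (S.card (j + 1))) :
    S.word (j + 1) K = spacedConcat (S.word j ∘ S.perm j K) :=
  (S.exists_perm j K).choose_spec.2

lemma length_word (j : ℕ) (k : Fin (S.card j)) : (S.word j k).length = S.len j := by
  induction j with
  | zero => exact S.length_zero k
  | succ j ih => rw [word_succ, length_spacedConcat (S.word j ∘ S.perm j k) (fun _ => ih _)]; rfl

lemma letter_succ (j : ℕ) (K : Fin (S.card (j + 1))) (k : Fin (S.card j)) {i : ℕ}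
    (hi : i < S.len j) :
    S.letter (j + 1) K (pos (S.len j) k + i) = S.letter j (S.perm j K k) i := by
  unfold letter
  rw [word_succ, getD_spacedConcat (S.word j ∘ S.perm j K) (fun _ => S.length_word j _) k hi]
  rfl

lemma letter_succ_spacer (j : ℕ) (K : Fin (S.card (j + 1))) (k : Fin (S.card j))
    (hk : IsPermuted k) : S.letter (j + 1) K (pos (S.len j) k - 1) = spacer := by
  unfold letter
  rw [word_succ, getD_spacedConcat_of_isPermuted (S.word j ∘ S.perm j K) (fun _ => S.length_word j _) k hk]

lemma eq_of_letter_eq {j : ℕ} {k k' : Fin (S.card j)}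
    (h : ∀ i < S.len j, S.letter j k i = S.letter j k' i) : k = k' := by
  apply S.word_injective j
  apply List.ext_getElem
  · rw [length_word, length_word]
  · intro i h1 h2
    have := h i (by rwa [length_word] at h1)
    unfold letter at this
    rwa [List.getD_eq_getElem _ _ h1, List.getD_eq_getElem _ _ h2] at this

/-- The permutation selected by `perm` can only be `π`: a word of stage `j + 1` displays its
subwords at known positions, and the words of stage `j` are listed without repetition. -/
lemma exists_perm_eq (j : ℕ) (π : Equiv.Perm (Fin (S.card j)))
    (hπ : ∀ k : Fin (S.card j), ¬ IsPermuted k → π k = k) : ∃ K, S.perm j K = π := by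
  have h : spacedConcat (S.word j ∘ π) ∈ range (S.word (j + 1)) := by
    rw [S.range_succ]; exact ⟨π, hπ, rfl⟩
  obtain ⟨K, hK⟩ := h
  refine ⟨K, ?_⟩
  ext1 k
  apply S.eq_of_letter_eq
  intro i hi
  rw [← S.letter_succ j K k hi]
  unfold letter
  rw [hK, getD_spacedConcat (S.word j ∘ π) (fun _ => S.length_word j _) k hi]
  rfl

lemma perm_injective (j : ℕ) : Function.Injective (S.perm j) := by
  intro K K' h
  apply S.word_injective
  rw [word_succ, word_succ, h]

/-- The `k`-th word of stage `j` is read in `x` from the position `s` on. -/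
def At (x : ℤ → Letter) (j : ℕ) (k : Fin (S.card j)) (s : ℤ) : Prop :=
  ∀ i : ℕ, i < S.len j → x (s + i) = S.letter j k i

variable {S}

lemma At.child {x : ℤ → Letter} {j : ℕ} {K : Fin (S.card (j + 1))} {s : ℤ} (h : S.At x (j + 1) K s)
    (k : Fin (S.card j)) : S.At x j (S.perm j K k) (s + pos (S.len j) k) := by
  intro i hi
  rw [← S.letter_succ j K k hi, ← h]
  · push_cast; ring_nf
  · have := pos_add_le_concatLength (S.len j) k.2
    change _ < concatLength _ _
    omega

lemma At.spacer {x : ℤ → Letter} {j : ℕ} {K : Fin (S.card (j + 1))} {s : ℤ}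
    (h : S.At x (j + 1) K s) (k : Fin (S.card j)) (hk : IsPermuted k) :
    x (s + pos (S.len j) k - 1) = spacer := by
  have h1 : 1 ≤ pos (S.len j) k := by rw [pos_of_isPermuted hk]; omega
  rw [← S.letter_succ_spacer j K k hk, ← h]
  · push_cast [h1]; ring_nf
  · have := pos_add_le_concatLength (S.len j) k.2
    change _ < concatLength _ _
    omega

lemma At.congr {x y : ℤ → Letter} {j : ℕ} {k : Fin (S.card j)} {s t : ℤ} (h : S.At x j k s)
    (hxy : ∀ i : ℕ, i < S.len j → y (t + i) = x (s + i)) : S.At y j k t :=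
  fun i hi => (hxy i hi).trans (h i hi)

lemma At.eq {x : ℤ → Letter} {j : ℕ} {k k' : Fin (S.card j)} {s : ℤ} (h : S.At x j k s)
    (h' : S.At x j k' s) : k = k' :=
  S.eq_of_letter_eq fun i hi => (h i hi).symm.trans (h' i hi)

end Construction

/-! ### Growth -/

lemma count_isPermuted (N : ℕ) : Nat.count IsPermuted N = Nat.sqrt N - 1 := by
  induction N with
  | zero => simp
  | succ N ih =>
    rw [Nat.count_succ, ih]
    by_cases h0 : N = 0
    · subst h0; simp [IsPermuted]
    · have : 1 ≤ Nat.sqrt N := Nat.sqrt_pos.2 (by omega)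
      by_cases hs : IsSquare (N + 1)
      · rw [sqrt_succ_of_isSquare hs, if_pos ⟨hs, h0⟩]; omega
      · rw [sqrt_succ_of_not_isSquare hs, if_neg (fun h => hs h.1)]; omega

lemma card_isPermuted (M N : ℕ) (h : M ≤ N) :
    Fintype.card {k : Fin N // IsPermuted k ∧ (k : ℕ) < M} = Nat.sqrt M - 1 := by
  rw [← count_isPermuted, Nat.count_eq_card_fintype]
  exact @Fintype.card_congr _ _ _ (Nat.CountSet.fintype IsPermuted M)
    ⟨fun k => ⟨k.1.1, k.2.2, k.2.1⟩, fun k => ⟨⟨k.1, k.2.1.trans_le h⟩, k.2.2, k.2.1⟩,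
      fun _ => rfl, fun _ => rfl⟩

lemma succ_pow_four_le_two_pow {s : ℕ} (h : 100 ≤ s) : (s + 1) ^ 4 ≤ 2 ^ (s - 2) := by
  induction s, h using Nat.le_induction with
  | base => norm_num
  | succ s hs ih =>
    have h1 : (s + 1 + 1) ^ 4 ≤ 2 * (s + 1) ^ 4 := by
      -- The fourth power grows by a factor at most 1.1 ^ 4 < 2 from one step to the next.
      have h2 : (10 : ℕ) * (s + 1 + 1) ≤ 11 * (s + 1) := by omega
      have h3 := Nat.pow_le_pow_left h2 4
      rw [mul_pow, mul_pow] at h3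
      omega
    rw [show s + 1 - 2 = s - 2 + 1 by omega, pow_succ (2 : ℕ)]
    omega

lemma two_pow_le_factorial (n : ℕ) : 2 ^ (n - 1) ≤ n.factorial := by
  induction n with
  | zero => simp
  | succ n ih =>
    rcases Nat.eq_zero_or_pos n with rfl | hn
    · simp
    · rw [Nat.factorial_succ, show n + 1 - 1 = n - 1 + 1 by omega, pow_succ, mul_comm]
      exact Nat.mul_le_mul (by omega) ih

namespace Construction

variable {S : Construction}

/-- The words of stage `j + 1` correspond bijectively to the permutations supported on the permuted
positions, of which there are √N - 1. -/
lemma card_succ (S : Construction) (j : ℕ) :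
    S.card (j + 1) = (Nat.sqrt (S.card j) - 1).factorial := by
  have e : Fin (S.card (j + 1)) ≃ {π : Equiv.Perm (Fin (S.card j)) //
      ∀ k : Fin (S.card j), ¬ IsPermuted k → π k = k} := by
    refine Equiv.ofBijective (fun K => ⟨S.perm j K, fun k hk => S.perm_apply K hk⟩) ⟨?_, ?_⟩
    · intro K K' h
      exact S.perm_injective j (congrArg Subtype.val h)
    · rintro ⟨π, hπ⟩
      obtain ⟨K, hK⟩ := S.exists_perm_eq j π hπ
      exact ⟨K, Subtype.ext hK⟩
  have e2 := (Equiv.Perm.subtypeEquivSubtypePerm (fun k : Fin (S.card j) => IsPermuted k))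
  have := Fintype.card_congr (e.trans e2.symm)
  rw [Fintype.card_fin, Fintype.card_perm] at this
  rw [this]
  congr 1
  rw [← card_isPermuted _ _ le_rfl]
  exact Fintype.card_congr (Equiv.subtypeEquivRight fun k => by simp)

/-- The construction starts with sufficiently many words. -/
def IsLarge (S : Construction) : Prop := 100 ≤ S.side

lemma two_pow_le_card (hS : S.IsLarge) (j : ℕ) :
    2 ^ 100 ≤ S.card j ∧ S.card j ^ 2 ≤ S.card (j + 1) := by
  -- With s = √N the chain is N ^ 2 ≤ (s + 1) ^ 4 ≤ 2 ^ (s - 2) ≤ (s - 1)!.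
  have key : ∀ N : ℕ, 2 ^ 100 ≤ N → N ^ 2 ≤ (Nat.sqrt N - 1).factorial := by
    intro N hN
    have h1 : 2 ^ 50 ≤ Nat.sqrt N := by
      rw [Nat.le_sqrt]; calc _ = 2 ^ 100 := by norm_num
        _ ≤ N := hN
    have h2 : N < (Nat.sqrt N + 1) * (Nat.sqrt N + 1) := Nat.lt_succ_sqrt N
    calc N ^ 2 ≤ ((Nat.sqrt N + 1) * (Nat.sqrt N + 1)) ^ 2 := Nat.pow_le_pow_left h2.le 2
      _ = (Nat.sqrt N + 1) ^ 4 := by ring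
      _ ≤ 2 ^ (Nat.sqrt N - 2) := succ_pow_four_le_two_pow (le_trans (by norm_num) h1)
      _ = 2 ^ (Nat.sqrt N - 1 - 1) := by rw [Nat.sub_sub]
      _ ≤ _ := two_pow_le_factorial _
  induction j with
  | zero =>
    have h : 2 ^ 100 ≤ S.card 0 := by
      rw [S.card_zero]; exact Nat.pow_le_pow_right (by norm_num) hS
    exact ⟨h, by rw [card_succ]; exact key _ h⟩
  | succ j ih =>
    have h : 2 ^ 100 ≤ S.card (j + 1) := ih.1.trans ((Nat.le_self_pow (by norm_num) _).trans ih.2)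
    exact ⟨h, by rw [card_succ S (j + 1)]; exact key _ h⟩

lemma large_card (hS : S.IsLarge) (j : ℕ) : 1000000 ≤ S.card j :=
  le_trans (by norm_num) (two_pow_le_card hS j).1

lemma len_pos (hS : S.IsLarge) (j : ℕ) : 10000 ≤ S.len j := by
  induction j with
  | zero =>
    change 10000 ≤ S.side ^ 2
    have : 100 ^ 2 ≤ S.side ^ 2 := Nat.pow_le_pow_left hS 2
    omega
  | succ j ih =>
    have := large_card hS j
    change _ ≤ concatLength _ _
    unfold concatLength
    nlinarith

lemma len_succ (S : Construction) (j : ℕ) :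
    S.len (j + 1) = S.card j * S.len j + (Nat.sqrt (S.card j) - 1) := rfl

lemma len_strictMono (hS : S.IsLarge) : StrictMono S.len := by
  refine strictMono_nat_of_lt_succ fun j => ?_
  have := large_card hS j
  have := len_pos hS j
  rw [len_succ]
  nlinarith

lemma card_mul_len_le (S : Construction) (j : ℕ) : S.card j * S.len j ≤ S.len (j + 1) := by
  rw [len_succ]; omega

lemma len_succ_add_one_le (hS : S.IsLarge) (j : ℕ) :
    S.len (j + 1) + 1 ≤ S.card j * (S.len j + 1) := by
  have := large_card hS j
  have h1 : Nat.sqrt (S.card j) ≤ S.card j := Nat.sqrt_le_self _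
  have h2 : 1 ≤ Nat.sqrt (S.card j) := Nat.sqrt_pos.2 (by omega)
  rw [len_succ, Nat.mul_add, mul_one]
  omega

lemma len_succ_le (hS : S.IsLarge) (j : ℕ) : S.len (j + 1) ≤ 2 * (S.card j * S.len j) := by
  have := large_card hS j
  have := len_pos hS j
  have h1 : Nat.sqrt (S.card j) ≤ S.card j := Nat.sqrt_le_self _
  have h2 : S.card j ≤ S.card j * S.len j := Nat.le_mul_of_pos_right _ (by omega)
  rw [len_succ]
  omega

lemma le_len (hS : S.IsLarge) (j : ℕ) : j + 1 ≤ S.len j := by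
  induction j with
  | zero => have := len_pos hS 0; omega
  | succ j ih => have := len_strictMono hS (Nat.lt_succ_self j); simp only [Nat.succ_eq_add_one] at this; omega

/-- The logarithm of the number of words of stage `j`. -/
noncomputable def logCard (S : Construction) (j : ℕ) : ℝ := Real.log (S.card j)

lemma two_mul_logCard_le (hS : S.IsLarge) (j : ℕ) : 2 * S.logCard j ≤ S.logCard (j + 1) := by
  have h := (two_pow_le_card hS j).2
  have h0 := large_card hS j
  unfold logCard
  rw [show (2 : ℝ) * Real.log (S.card j) = Real.log ((S.card j : ℝ) ^ 2) by
    rw [Real.log_pow]; norm_num]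
  apply Real.log_le_log
  · have : (0 : ℝ) < S.card j := by exact_mod_cast (by omega)
    positivity
  · exact_mod_cast h

lemma sixty_le_logCard (hS : S.IsLarge) (j : ℕ) : 60 ≤ S.logCard j := by
  have h := (two_pow_le_card hS j).1
  have h2 : Real.log ((2 : ℝ) ^ 100) ≤ S.logCard j := by
    apply Real.log_le_log (by positivity)
    exact_mod_cast h
  rw [Real.log_pow] at h2
  have := Real.log_two_gt_d9
  push_cast at h2
  linarith

lemma two_pow_le_logCard (hS : S.IsLarge) (j : ℕ) : 2 ^ j ≤ S.logCard j := by
  induction j with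
  | zero => have := sixty_le_logCard hS 0; norm_num; linarith
  | succ j ih => have := two_mul_logCard_le hS j; rw [pow_succ]; linarith

/-- Induction through log K! ≤ K log K with K ≤ √N and log K ≤ log N ≤ √l, so that log K! ≤ √(N l),
and N l is at most the next length. The initial values m ^ 2 and 2 ^ m are what makes the base case
hold. -/
lemma logCard_le_sqrt_len (hS : S.IsLarge) (j : ℕ) : S.logCard j ≤ √(S.len j) := by
  induction j with
  | zero =>
    have h1 : S.logCard 0 = S.side * Real.log 2 := by
      unfold logCard; rw [S.card_zero]; push_cast; rw [Real.log_pow]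
    have h2 : √(S.len 0 : ℝ) = S.side := by
      change √((S.side ^ 2 : ℕ) : ℝ) = _
      push_cast
      exact Real.sqrt_sq (by positivity)
    rw [h1, h2]
    have := Real.log_two_lt_d9
    have : (0 : ℝ) ≤ S.side := by positivity
    nlinarith
  | succ j ih =>
    have h0 := large_card hS j
    have hN : (0 : ℝ) < S.card j := by exact_mod_cast (by omega)
    set K := Nat.sqrt (S.card j) - 1 with hK
    have hK1 : (K : ℝ) ≤ √(S.card j) :=
      le_trans (by exact_mod_cast Nat.sub_le _ _) Real.nat_sqrt_le_real_sqrt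
    have hs : 1000 ≤ Nat.sqrt (S.card j) := by rw [Nat.le_sqrt]; omega
    have hK0 : (0 : ℝ) < K := by exact_mod_cast (by omega)
    have h1 : S.logCard (j + 1) ≤ K * Real.log K := by
      unfold logCard
      rw [card_succ, ← Real.log_pow]
      apply Real.log_le_log
      · exact_mod_cast Nat.factorial_pos _
      · exact_mod_cast Nat.factorial_le_pow K
    have h2 : Real.log K ≤ S.logCard j := by
      unfold logCard
      apply Real.log_le_log hK0
      exact_mod_cast (Nat.sub_le _ _).trans (Nat.sqrt_le_self _)
    calc S.logCard (j + 1) ≤ K * Real.log K := h1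
      _ ≤ √(S.card j) * √(S.len j) := by
        apply mul_le_mul hK1 (h2.trans ih) _ (by positivity)
        apply Real.log_nonneg
        exact_mod_cast (by omega)
      _ = √((S.card j * S.len j : ℕ) : ℝ) := by
        push_cast; rw [Real.sqrt_mul hN.le]
      _ ≤ √(S.len (j + 1)) := by
        apply Real.sqrt_le_sqrt
        exact_mod_cast card_mul_len_le S j

/-- The converse of `logCard_le_sqrt_len` up to a factor 32 = 2 · 16 per stage: the 2 comes from the
next length being at most 2 N l, the 16 from bounding a factorial below by half of its factors. -/
lemma sqrt_len_le_mul_logCard (hS : S.IsLarge) (j : ℕ) :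
    √(S.len j) ≤ 32 ^ (j + 1) * S.logCard j := by
  induction j with
  | zero =>
    have h1 : S.logCard 0 = S.side * Real.log 2 := by
      unfold logCard; rw [S.card_zero]; push_cast; rw [Real.log_pow]
    have h2 : √(S.len 0 : ℝ) = S.side := by
      change √((S.side ^ 2 : ℕ) : ℝ) = _
      push_cast
      exact Real.sqrt_sq (by positivity)
    rw [h1, h2]
    have := Real.log_two_gt_d9
    have : (0 : ℝ) ≤ S.side := by positivity
    norm_num
    nlinarith
  | succ j ih =>
    have h0 := large_card hS j
    have hN : (0 : ℝ) < S.card j := by exact_mod_cast (by omega)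
    have ha := sixty_le_logCard hS j
    set K := Nat.sqrt (S.card j) - 1 with hK
    have hs : 1000 ≤ Nat.sqrt (S.card j) := by rw [Nat.le_sqrt]; omega
    have hs2 : √(S.card j : ℝ) ≤ 4 * (K / 2 : ℕ) := by
      have h1 : √(S.card j : ℝ) < Nat.sqrt (S.card j) + 1 := Real.real_sqrt_lt_nat_sqrt_succ
      have h2 : Nat.sqrt (S.card j) + 1 ≤ 4 * (K / 2) := by omega
      have h3 : ((Nat.sqrt (S.card j) : ℝ) + 1) ≤ 4 * (K / 2 : ℕ) := by exact_mod_cast h2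
      linarith
    have h1 : ((K / 2 : ℕ) : ℝ) * Real.log (K / 2 : ℕ) ≤ S.logCard (j + 1) := by
      unfold logCard
      rw [card_succ, ← Real.log_pow]
      apply Real.log_le_log
      · have : 0 < K / 2 := by omega
        positivity
      -- The largest K / 2 factors of K! are all at least K / 2.
      · have h1 := Nat.pow_sub_le_descFactorial K (K / 2)
        have h2 : (K / 2) ^ (K / 2) ≤ (K + 1 - K / 2) ^ (K / 2) :=
          Nat.pow_le_pow_left (by omega) _
        have h3 : K.descFactorial (K / 2) ≤ K.factorial := by
          rw [← Nat.factorial_mul_descFactorial (show K / 2 ≤ K by omega)]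
          exact Nat.le_mul_of_pos_left _ (Nat.factorial_pos _)
        exact_mod_cast h2.trans (h1.trans h3)
    have h2 : S.logCard j / 4 ≤ Real.log (K / 2 : ℕ) := by
      have h3 : Real.log (√(S.card j : ℝ) / 4) ≤ Real.log (K / 2 : ℕ) := by
        apply Real.log_le_log (by positivity); linarith
      rw [Real.log_div (by positivity) (by norm_num), Real.log_sqrt hN.le] at h3
      have h4 : Real.log 4 ≤ 4 := by
        have := Real.log_le_sub_one_of_pos (show (0 : ℝ) < 4 by norm_num); linarith
      change S.logCard j / 2 - Real.log 4 ≤ _ at h3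
      linarith
    have h5 : √(S.card j) * S.logCard j ≤ 16 * S.logCard (j + 1) := by
      have : (√(S.card j : ℝ) / 4) * (S.logCard j / 4) ≤ (K / 2 : ℕ) * Real.log (K / 2 : ℕ) := by
        apply mul_le_mul (by linarith) h2 (by linarith) (by positivity)
      linarith
    have h6 : √(S.len (j + 1) : ℝ) ≤ 2 * (√(S.card j) * √(S.len j)) := by
      rw [← Real.sqrt_mul hN.le]
      apply Real.sqrt_le_iff.2
      constructor
      · positivity
      · rw [mul_pow, Real.sq_sqrt (by positivity)]
        have := len_succ_le hS j
        have h7 : (S.len (j + 1) : ℝ) ≤ 2 * (S.card j * S.len j) := by exact_mod_cast this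
        have : (0 : ℝ) ≤ S.card j * S.len j := by positivity
        linarith
    have h8 : (0 : ℝ) < 32 ^ (j + 1) := by positivity
    calc √(S.len (j + 1) : ℝ) ≤ 2 * (√(S.card j) * √(S.len j)) := h6
      _ ≤ 2 * (√(S.card j) * (32 ^ (j + 1) * S.logCard j)) := by gcongr
      _ = 2 * 32 ^ (j + 1) * (√(S.card j) * S.logCard j) := by ring
      _ ≤ 2 * 32 ^ (j + 1) * (16 * S.logCard (j + 1)) := by gcongr
      _ = 32 ^ (j + 1 + 1) * S.logCard (j + 1) := by ring

lemma tendsto_len (hS : S.IsLarge) : Tendsto S.len atTop atTop := (len_strictMono hS).tendsto_atTop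

lemma tendsto_len_real (hS : S.IsLarge) : Tendsto (fun j => (S.len j : ℝ)) atTop atTop :=
  tendsto_natCast_atTop_atTop.comp (tendsto_len hS)

lemma one_le_len_real (hS : S.IsLarge) (j : ℕ) : (10000 : ℝ) ≤ S.len j := by
  exact_mod_cast len_pos hS j

lemma card_pos_real (hS : S.IsLarge) (j : ℕ) : (1000000 : ℝ) ≤ S.card j := by
  exact_mod_cast large_card hS j

lemma two_pow_le_log_len (hS : S.IsLarge) (j : ℕ) : 2 ^ j / 2 ≤ Real.log (S.len j) := by
  cases j with
  | zero =>
    have h1 := one_le_len_real hS 0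
    have h2 : Real.log (Real.exp 1) ≤ Real.log (S.len 0) :=
      Real.log_le_log (Real.exp_pos _) (by have := Real.exp_one_lt_d9; linarith)
    rw [Real.log_exp] at h2
    norm_num; linarith
  | succ j =>
    have h1 := two_pow_le_logCard hS j
    have h2 : S.logCard j ≤ Real.log (S.len (j + 1)) := by
      apply Real.log_le_log
      · have := card_pos_real hS j; linarith
      · have h3 := card_mul_len_le S j
        have h4 := Nat.le_mul_of_pos_right (S.card j) (show 0 < S.len j by
          have := len_pos hS j; omega)
        exact_mod_cast h4.trans h3
    rw [pow_succ]; linarith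

/-- The logarithm of the left side is linear in j, that of the length at least 2 ^ j / 2: the loss
in `sqrt_len_le_mul_logCard` is smaller than any power of the length. -/
lemma eventually_pow_le_len_rpow (hS : S.IsLarge) {ε : ℝ} (hε : 0 < ε) :
    ∀ᶠ j in atTop, (32 : ℝ) ^ (j + 1) ≤ (S.len j : ℝ) ^ ε := by
  have h1 : Tendsto (fun j : ℕ => ((j : ℝ) ^ 1 / 2 ^ j + 1 / 2 ^ j) * Real.log 32) atTop
      (𝓝 ((0 + 0) * Real.log 32)) := by
    refine (Tendsto.add ?_ ?_).mul_const _
    · exact tendsto_pow_const_div_const_pow_of_one_lt 1 one_lt_two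
    · have := tendsto_pow_const_div_const_pow_of_one_lt 0 (one_lt_two (α := ℝ))
      simpa using this
  rw [add_zero, zero_mul] at h1
  filter_upwards [h1.eventually (gt_mem_nhds (half_pos hε))] with j hj
  have hl := one_le_len_real hS j
  have h2 := two_pow_le_log_len hS j
  have h3 : ((j : ℝ) + 1) * Real.log 32 ≤ ε * (2 ^ j / 2) := by
    have : (0 : ℝ) < 2 ^ j := by positivity
    have e : ((j : ℝ) ^ 1 / 2 ^ j + 1 / 2 ^ j) * Real.log 32 =
        ((j : ℝ) + 1) * Real.log 32 / 2 ^ j := by field_simp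
    rw [e, div_lt_iff₀ this] at hj
    linarith
  rw [Real.rpow_def_of_pos (by linarith), ← Real.exp_log (show (0 : ℝ) < 32 by norm_num),
    ← Real.exp_nat_mul]
  apply Real.exp_le_exp.2
  push_cast
  nlinarith

lemma eventually_len_rpow_le_logCard (hS : S.IsLarge) {δ : ℝ} (hδ : δ < 1 / 2) :
    ∀ᶠ j in atTop, (S.len j : ℝ) ^ δ ≤ S.logCard j := by
  filter_upwards [eventually_pow_le_len_rpow hS (sub_pos.2 hδ)] with j hj
  have hl := one_le_len_real hS j
  have h1 := sqrt_len_le_mul_logCard hS j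
  have h2 := sixty_le_logCard hS j
  have h3 : √(S.len j : ℝ) = (S.len j : ℝ) ^ (1 / 2 - δ) * (S.len j : ℝ) ^ δ := by
    rw [← Real.rpow_add (by linarith), Real.sqrt_eq_rpow]; congr 1; ring
  have h4 : (S.len j : ℝ) ^ (1 / 2 - δ) * (S.len j : ℝ) ^ δ ≤
      (S.len j : ℝ) ^ (1 / 2 - δ) * S.logCard j := by
    rw [← h3]
    exact h1.trans (mul_le_mul_of_nonneg_right hj (by linarith))
  exact le_of_mul_le_mul_left h4 (Real.rpow_pos_of_pos (by linarith) _)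

lemma eventually_mul_log_len_le_logCard (hS : S.IsLarge) (C : ℝ) :
    ∀ᶠ j in atTop, C * Real.log (S.len j) ≤ S.logCard j := by
  have h1 := (isLittleO_log_rpow_atTop (show (0 : ℝ) < 1 / 4 by norm_num)).def
    (show (0 : ℝ) < (|C| + 1)⁻¹ by positivity)
  filter_upwards [(tendsto_len_real hS).eventually h1,
    eventually_len_rpow_le_logCard hS (show (1 / 4 : ℝ) < 1 / 2 by norm_num)] with j h2 h3
  have hl := one_le_len_real hS j
  have h4 : 0 ≤ Real.log (S.len j) := Real.log_nonneg (by linarith)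
  rw [Real.norm_of_nonneg h4, Real.norm_of_nonneg (by positivity), ← div_eq_inv_mul,
    le_div_iff₀ (by positivity)] at h2
  have := le_abs_self C
  nlinarith

/-- The logarithm of the cardinality is eventually at least the fourth root of the length, hence
larger than any multiple of the logarithm of the length. -/
lemma eventually_mul_pow_le_card (hS : S.IsLarge) (C d : ℕ) :
    ∀ᶠ j in atTop, C * S.len j ^ d ≤ S.card j := by
  filter_upwards [eventually_mul_log_len_le_logCard hS (d + 1),
    (tendsto_len hS).eventually_ge_atTop C] with j h1 h2
  have hl := one_le_len_real hS j
  have hc := card_pos_real hS j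
  have h3 : ((S.len j ^ (d + 1) : ℕ) : ℝ) ≤ S.card j := by
    push_cast
    rw [← Real.log_le_log_iff (by positivity) (by linarith), Real.log_pow]
    push_cast
    exact h1
  calc C * S.len j ^ d ≤ S.len j * S.len j ^ d := Nat.mul_le_mul_right _ h2
    _ = S.len j ^ (d + 1) := by ring
    _ ≤ S.card j := by exact_mod_cast h3

/-! ### Words of lower stages inside a word -/

/-- The positions at which the words of stage `J` start inside a word of stage `J + e`. -/
def starts (S : Construction) (J : ℕ) : ℕ → Set ℕ
  | 0 => {0}
  | e + 1 => {n | ∃ k < S.card (J + e), ∃ d ∈ starts S J e, n = pos (S.len (J + e)) k + d}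

lemma At.of_mem_starts {x : ℤ → Letter} {J e : ℕ} {K : Fin (S.card (J + e))} {p : ℤ}
    (h : S.At x (J + e) K p) {d : ℕ} (hd : d ∈ S.starts J e) : ∃ k, S.At x J k (p + d) := by
  induction e generalizing p d with
  | zero =>
    obtain rfl : d = 0 := hd
    exact ⟨K, by simpa using h⟩
  | succ e ih =>
    obtain ⟨k, hk, d, hd, rfl⟩ := hd
    obtain ⟨k', h'⟩ := ih (h.child ⟨k, hk⟩) hd
    refine ⟨k', ?_⟩
    push_cast
    rw [← add_assoc]
    exact h'

lemma add_len_le_of_mem_starts {J e d : ℕ} (hd : d ∈ S.starts J e) :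
    d + S.len J ≤ S.len (J + e) := by
  induction e generalizing d with
  | zero =>
    obtain rfl : d = 0 := hd
    simp
  | succ e ih =>
    obtain ⟨k, hk, d, hd, rfl⟩ := hd
    have h1 := ih hd
    have h2 := pos_add_le_concatLength (S.len (J + e)) hk
    rw [show S.len (J + (e + 1)) = concatLength (S.len (J + e)) (S.card (J + e)) from rfl]
    omega

lemma zero_mem_starts (hS : S.IsLarge) (J e : ℕ) : 0 ∈ S.starts J e := by
  induction e with
  | zero => rfl
  | succ e ih =>
    have := large_card hS (J + e)
    exact ⟨0, by omega, 0, ih, by simp⟩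

/-- Spacers never stand next to each other, since the first subword of a word is never permuted; so
a position outside all words of stage `J` is a spacer directly followed by such a word. -/
lemma exists_mem_starts (hS : S.IsLarge) {J e i : ℕ} (hi : i < S.len (J + e)) :
    ∃ d ∈ S.starts J e, (d ≤ i ∧ i < d + S.len J) ∨
      (d = i + 1 ∧ ∀ x K p, S.At x (J + e) K p → x (p + i) = spacer) := by
  induction e generalizing i with
  | zero => exact ⟨0, rfl, Or.inl ⟨by omega, by simpa using hi⟩⟩
  | succ e ih =>
    obtain ⟨k, hk, h⟩ :=
      exists_index_of_lt_concatLength (l := S.len (J + e)) (N := S.card (J + e)) hi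
    rcases h with ⟨h1, h2⟩ | ⟨h1, h2⟩
    · obtain ⟨i', rfl⟩ := Nat.exists_eq_add_of_le h1
      obtain ⟨d, hd, h⟩ := ih (i := i') (by omega)
      refine ⟨pos (S.len (J + e)) k + d, ⟨k, hk, d, hd, rfl⟩, ?_⟩
      rcases h with h | ⟨h, h'⟩
      · left; omega
      · right
        refine ⟨by omega, fun x K p hx => ?_⟩
        rw [← h' x _ _ (At.child (j := J + e) hx ⟨k, hk⟩)]
        push_cast; ring_nf
    -- The spacer precedes a word of stage `J + e`, whose first subword of stage `J` starts at the
    -- same place as that word.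
    · refine ⟨pos (S.len (J + e)) k + 0, ⟨k, hk, 0, zero_mem_starts hS J e, rfl⟩, Or.inr
        ⟨by omega, fun x K p hx => ?_⟩⟩
      rw [← At.spacer (j := J + e) hx ⟨k, hk⟩ h1]
      have : ((i : ℤ) + 1) = pos (S.len (J + e)) k := by exact_mod_cast h2
      congr 1
      simp only
      omega

lemma add_len_le_of_lt_of_mem_starts {J e d d' : ℕ} (hd : d ∈ S.starts J e)
    (hd' : d' ∈ S.starts J e) (h : d < d') : d + S.len J ≤ d' := by
  induction e generalizing d d' with
  | zero =>
    obtain rfl : d = 0 := hd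
    obtain rfl : d' = 0 := hd'
    omega
  | succ e ih =>
    obtain ⟨k, hk, d, hd, rfl⟩ := hd
    obtain ⟨k', hk', d', hd', rfl⟩ := hd'
    have h1 := add_len_le_of_mem_starts hd
    have h2 := add_len_le_of_mem_starts hd'
    rcases lt_trichotomy k k' with h3 | rfl | h3
    · have := pos_add_le_pos (S.len (J + e)) h3
      omega
    · have := ih hd hd' (by omega)
      omega
    · have := pos_add_le_pos (S.len (J + e)) h3
      omega

/-- The position following a word of stage `J` lies in another such word, which must start there
because distinct words do not overlap, or is a spacer. -/
lemma next_mem_starts (hS : S.IsLarge) {J e d : ℕ} (hd : d ∈ S.starts J e)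
    (h : d + S.len J < S.len (J + e)) :
    d + S.len J ∈ S.starts J e ∨ (d + S.len J + 1 ∈ S.starts J e ∧
      ∀ x K p, S.At x (J + e) K p → x (p + (d + S.len J : ℕ)) = spacer) := by
  have hl := len_pos hS J
  obtain ⟨d', hd', h1⟩ := exists_mem_starts hS h
  rcases h1 with h1 | ⟨rfl, h1⟩
  · left
    have := add_len_le_of_lt_of_mem_starts hd hd' (by omega)
    rwa [show d + S.len J = d' by omega]
  · exact Or.inr ⟨hd', h1⟩

/-- The recursion in `starts` removes the top stage; arguments that pass from stage `J` to `J + 1`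
need to remove the bottom one. -/
lemma mem_starts_succ_left {J e d : ℕ} (hd : d ∈ S.starts J (e + 1)) :
    ∃ d₁ ∈ S.starts (J + 1) e, ∃ k < S.card J, d = d₁ + pos (S.len J) k := by
  induction e generalizing d with
  | zero =>
    obtain ⟨k, hk, d, hd, rfl⟩ := hd
    obtain rfl : d = 0 := hd
    exact ⟨0, rfl, k, hk, by simp⟩
  | succ e ih =>
    obtain ⟨k, hk, d, hd, rfl⟩ := hd
    obtain ⟨d₁, hd₁, k', hk', rfl⟩ := ih hd
    rw [show J + (e + 1) = J + 1 + e by omega] at hk ⊢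
    exact ⟨pos (S.len (J + 1 + e)) k + d₁, ⟨k, hk, d₁, hd₁, rfl⟩, k', hk', by ring⟩

/-! ### Points of the subshift -/

/-- The sequence that reads the `k`-th word of stage `j` from the position `p` on. -/
def ofWord (S : Construction) (j : ℕ) (k : Fin (S.card j)) (p : ℤ) : ℤ → Letter :=
  fun i => S.letter j k (i - p).toNat

lemma at_ofWord (j : ℕ) (k : Fin (S.card j)) (p : ℤ) : S.At (S.ofWord j k p) j k p := by
  intro i _
  unfold ofWord
  simp

lemma subword_infix {x : ℤ → Letter} {j : ℕ} {k : Fin (S.card j)} {p a : ℤ} {n : ℕ} (h1 : p ≤ a)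
    (h2 : a + n ≤ p + S.len j)
    (h : ∀ i : ℕ, i < n → x (a + i) = S.letter j k (a + i - p).toNat) :
    subword x a n <:+: S.word j k := by
  obtain ⟨q, hq⟩ := Int.eq_ofNat_of_zero_le (sub_nonneg.2 h1)
  have hlen := S.length_word j k
  have e : subword x a n = ((S.word j k).drop q).take n := by
    apply List.ext_getElem
    · simp [subword, hlen]; omega
    · intro i hi hi'
      have hi0 : i < n := by simpa [subword] using hi
      simp only [subword, List.getElem_ofFn, List.getElem_take, List.getElem_drop]
      rw [h i hi0]
      unfold letter
      rw [show (a + i - p).toNat = q + i by omega, List.getD_eq_getElem]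
  rw [e]
  exact (List.take_prefix _ _).isInfix.trans (List.drop_suffix _ _).isInfix

/-- The defining property of the space provides a word containing the window, but `x` need not read
that whole word around it; the auxiliary `y` does, and agrees with `x` on the window only. The stage
can be raised because every word occurs in every word of the next stage. -/
lemma exists_window (hS : S.IsLarge) {x : ℤ → Letter} (hx : x ∈ S.space) (a : ℤ) (n J : ℕ) :
    ∃ (e : ℕ) (K : Fin (S.card (J + e))) (p : ℤ) (y : ℤ → Letter),
      (∀ i, a ≤ i → i < a + n → y i = x i) ∧ S.At y (J + e) K p ∧ p ≤ a ∧
        a + n ≤ p + S.len (J + e) := by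
  have base : ∃ (j : ℕ) (K : Fin (S.card j)) (p : ℤ) (y : ℤ → Letter),
      (∀ i, a ≤ i → i < a + n → y i = x i) ∧ S.At y j K p ∧ p ≤ a ∧ a + n ≤ p + S.len j := by
    obtain ⟨j, k, s, t, h⟩ := hx a n
    have hlen := congrArg List.length h
    have hsub : (subword x a n).length = n := by simp [subword]
    rw [List.length_append, List.length_append, hsub, S.length_word] at hlen
    refine ⟨j, k, a - s.length, S.ofWord j k (a - s.length), fun i h1 h2 => ?_, at_ofWord _ _ _,
      by omega, by omega⟩
    obtain ⟨q, hq⟩ := Int.eq_ofNat_of_zero_le (sub_nonneg.2 h1)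
    unfold ofWord letter
    rw [show (i - (a - s.length)).toNat = s.length + q by omega, ← h, List.append_assoc,
      List.getD_append_right _ _ _ _ (by omega), Nat.add_sub_cancel_left,
      List.getD_append _ _ _ _ (by omega), List.getD_eq_getElem _ _ (by omega)]
    simp only [subword, List.getElem_ofFn]
    congr 1; omega
  obtain ⟨j, K, p, y, h1, h2, h3, h4⟩ := base
  have up : ∀ d, ∃ (K : Fin (S.card (j + d))) (p : ℤ) (y : ℤ → Letter),
      (∀ i, a ≤ i → i < a + n → y i = x i) ∧ S.At y (j + d) K p ∧ p ≤ a ∧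
        a + n ≤ p + S.len (j + d) := by
    intro d
    induction d with
    | zero => exact ⟨K, p, y, h1, h2, h3, h4⟩
    | succ d ih =>
      obtain ⟨K, p, y, h1, h2, h3, h4⟩ := ih
      have hc := large_card hS (j + d + 1)
      let K' : Fin (S.card (j + d + 1)) := ⟨0, by omega⟩
      let m := (S.perm (j + d) K').symm K
      have hm := pos_add_le_concatLength (S.len (j + d)) m.2
      let p' : ℤ := p - pos (S.len (j + d)) m
      refine ⟨K', p', S.ofWord (j + d + 1) K' p', fun i hi1 hi2 => ?_, at_ofWord _ _ _,
        by simp only [p']; omega, ?_⟩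
      · rw [← h1 i hi1 hi2]
        obtain ⟨q, hq⟩ := Int.eq_ofNat_of_zero_le (show 0 ≤ i - p by omega)
        have e1 := (at_ofWord (j + d + 1) K' p').child m q (by omega)
        have e2 := h2 q (by omega)
        rw [show p + (q : ℤ) = i by omega] at e2
        rw [show p' + pos (S.len (j + d)) m + (q : ℤ) = i by simp only [p']; omega] at e1
        rw [e1, e2]
        simp [m]
      · rw [show S.len (j + (d + 1)) = concatLength (S.len (j + d)) (S.card (j + d)) from rfl]
        simp only [p']
        omega
  -- Transport along `j + J = J + j`, on which the type of `K` depends.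
  have : ∀ m, m = J + j → (∃ (K : Fin (S.card m)) (p : ℤ) (y : ℤ → Letter),
      (∀ i, a ≤ i → i < a + n → y i = x i) ∧ S.At y m K p ∧ p ≤ a ∧
        a + n ≤ p + S.len m) → ∃ (K : Fin (S.card (J + j))) (p : ℤ) (y : ℤ → Letter),
      (∀ i, a ≤ i → i < a + n → y i = x i) ∧ S.At y (J + j) K p ∧ p ≤ a ∧
        a + n ≤ p + S.len (J + j) := by
    rintro m rfl h; exact h
  exact ⟨j, this _ (add_comm j J) (up J)⟩

/-- Every long window of a point is covered by successive words of stage `J`. -/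
lemma exists_chain (hS : S.IsLarge) {x : ℤ → Letter} (hx : x ∈ S.space) (J : ℕ) (a : ℤ) {n : ℕ}
    (hn : S.len J < n) :
    ∃ D : Set ℤ, (∃ d ∈ D, a ≤ d ∧ d ≤ a + S.len J + 1) ∧
      ∀ d ∈ D, d + S.len J < a + n → (∃ k, S.At x J k d) ∧
        (d + S.len J ∈ D ∨ (x (d + S.len J) = spacer ∧ d + S.len J + 1 ∈ D)) := by
  obtain ⟨e, K, p, y, hxy, hy, hp, hpn⟩ := exists_window hS hx a n J
  refine ⟨{d | a ≤ d ∧ ∃ c ∈ S.starts J e, d = p + c}, ?_, ?_⟩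
  -- The word containing `a` starts at `a` or earlier; if earlier, the next word is taken, which
  -- starts at most `len J + 1` after `a`.
  · obtain ⟨q, hq⟩ := Int.eq_ofNat_of_zero_le (sub_nonneg.2 hp)
    obtain ⟨d, hd, h⟩ := exists_mem_starts hS (show q < S.len (J + e) by omega)
    rcases h with ⟨h1, h2⟩ | ⟨h1, -⟩
    · rcases h1.eq_or_lt with rfl | h1
      · exact ⟨p + d, ⟨by omega, d, hd, rfl⟩, by omega, by omega⟩
      · rcases next_mem_starts hS hd (by omega) with h | ⟨h, -⟩
        · exact ⟨p + (d + S.len J : ℕ), ⟨by omega, _, h, rfl⟩, by omega, by omega⟩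
        · exact ⟨p + (d + S.len J + 1 : ℕ), ⟨by omega, _, h, rfl⟩, by omega, by omega⟩
    · exact ⟨p + d, ⟨by omega, d, hd, rfl⟩, by omega, by omega⟩
  · rintro _ ⟨h1, c, hc, rfl⟩ h2
    constructor
    · obtain ⟨k, hk⟩ := hy.of_mem_starts hc
      exact ⟨k, hk.congr fun i hi => (hxy _ (by omega) (by omega)).symm⟩
    · rcases next_mem_starts hS hc (by omega) with h | ⟨h, h'⟩
      · exact Or.inl ⟨by omega, _, h, by push_cast; ring⟩
      · refine Or.inr ⟨?_, by omega, _, h, by push_cast; ring⟩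
        rw [← h' y K p hy, hxy _ (by push_cast; omega) (by push_cast; omega)]
        congr 1; push_cast; ring

/-- Two successive words of stage `J`, the first of which starts last among those that do not
start to the right of `a`. -/
lemma exists_two_words (hS : S.IsLarge) {x : ℤ → Letter} (hx : x ∈ S.space) (J : ℕ) (a : ℤ) :
    ∃ s s' : ℤ, s ≤ a ∧ a < s' ∧
      (s' = s + S.len J ∨ (x (s + S.len J) = spacer ∧ s' = s + S.len J + 1)) ∧
      (∃ k, S.At x J k s) ∧ ∃ k, S.At x J k s' := by
  -- Starting the window `len J + 1` to the left of `a` forces a member of the chain at or before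
  -- `a`; the length leaves room for two further words.
  obtain ⟨D, ⟨d, hd, h1, h2⟩, hD⟩ := exists_chain hS hx J (a - S.len J - 1)
    (n := 4 * (S.len J + 1)) (by omega)
  obtain ⟨s, ⟨hs, hsa⟩, hmax⟩ := Int.exists_greatest_of_bdd (P := fun z => z ∈ D ∧ z ≤ a)
    ⟨a, fun z hz => hz.2⟩ ⟨d, hd, by omega⟩
  have hds := hmax d ⟨hd, by omega⟩
  obtain ⟨hk, hnext⟩ := hD s hs (by omega)
  rcases hnext with h | ⟨h', h⟩
  · have : a < s + S.len J := by
      by_contra hc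
      have := hmax _ ⟨h, by omega⟩
      have := len_pos hS J
      omega
    exact ⟨s, s + S.len J, hsa, this, Or.inl rfl, hk, (hD _ h (by omega)).1⟩
  · have : a < s + S.len J + 1 := by
      by_contra hc
      have := hmax _ ⟨h, by omega⟩
      omega
    exact ⟨s, s + S.len J + 1, hsa, this, Or.inr ⟨h', rfl⟩, hk, (hD _ h (by omega)).1⟩

/-! ### Shifts -/

/-- The shift by an integer. -/
def shiftBy (S : Construction) (a : ℤ) (x : S.space) : S.space :=
  ⟨fun i => x.1 (i + a), fun i n => by
    obtain ⟨j, k, h⟩ := x.2 (i + a) n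
    refine ⟨j, k, ?_⟩
    have e : subword (fun i => x.1 (i + a)) i n = subword x.1 (i + a) n := by
      unfold subword
      congr 1
      funext m
      exact congrArg x.1 (by ring)
    rw [e]
    exact h⟩

@[simp] lemma shiftBy_apply (a : ℤ) (x : S.space) (i : ℤ) :
    (S.shiftBy a x).1 i = x.1 (i + a) := rfl

lemma iterate_shift (n : ℕ) (x : S.space) : S.shift^[n] x = S.shiftBy n x := by
  induction n with
  | zero => apply Subtype.ext; funext i; simp
  | succ n ih =>
    rw [Function.iterate_succ_apply', ih]
    apply Subtype.ext; funext i
    exact congrArg x.1 (show i + 1 + n = i + (n + 1 : ℕ) by push_cast; ring)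

@[simp] lemma iterate_shift_apply (n : ℕ) (x : S.space) (i : ℤ) :
    (S.shift^[n] x).1 i = x.1 (i + n) := by
  rw [iterate_shift]; rfl

lemma shiftBy_shiftBy (a b : ℤ) (x : S.space) :
    S.shiftBy a (S.shiftBy b x) = S.shiftBy (a + b) x := by
  apply Subtype.ext; funext i
  simp [add_assoc]

lemma at_shiftBy {x : S.space} {a : ℤ} {j : ℕ} {k : Fin (S.card j)} {s : ℤ} :
    S.At (S.shiftBy a x).1 j k s ↔ S.At x.1 j k (s + a) := by
  unfold At
  simp only [shiftBy_apply]
  refine forall₂_congr fun i _ => ?_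
  rw [add_right_comm]

/-! ### Existence of points -/

/-- The position, inside the word `1` of stage `j`, of the centre of the nested words `1`. -/
def centre (S : Construction) : ℕ → ℕ
  | 0 => 1
  | j + 1 => S.len j + centre S j

/-- The index 1 is not permuted, so the word 1 of each stage contains the word 1 of the previous
stage as its second subword. The common centre is at distance at least `j + 1` from both ends of the
word of stage `j`, hence these nested words exhaust ℤ. -/
lemma exists_point (hS : S.IsLarge) : Nonempty S.space := by
  have hone : ∀ j, 1 < S.card j := fun j => by have := large_card hS j; omega
  let one : ∀ j, Fin (S.card j) := fun j => ⟨1, hone j⟩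
  have hnot : ¬ IsPermuted 1 := by
    rintro ⟨⟨r, hr⟩, -⟩
    rcases r with _ | _ | r
    · omega
    · omega
    · nlinarith
  have hc : ∀ j, j + 1 ≤ S.centre j ∧ S.centre j + (j + 1) ≤ S.len j := by
    intro j
    induction j with
    | zero => have := len_pos hS 0; simp only [centre]; omega
    | succ j ih =>
      have h1 := len_pos hS j
      have h2 := card_mul_len_le S j
      have h3 : 3 * S.len j ≤ S.card j * S.len j :=
        Nat.mul_le_mul_right _ (by have := large_card hS j; omega)
      simp only [centre]
      omega
  have hstep : ∀ j i, i < S.len j →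
      S.letter (j + 1) (one (j + 1)) (S.len j + i) = S.letter j (one j) i := by
    intro j i hi
    have := S.letter_succ j (one (j + 1)) (one j) hi
    rw [S.perm_apply _ hnot] at this
    rwa [show ((one j : Fin (S.card j)) : ℕ) = 1 from rfl, pos_one] at this
  -- The letter at `i` is read at stage |i|, where the nested word already covers `i`; `hx` says
  -- that later stages give the same letter.
  let x : ℤ → Letter := fun i =>
    S.letter i.natAbs (one i.natAbs) (S.centre i.natAbs + i).toNat
  have hx : ∀ (i : ℤ) (d : ℕ), S.letter (i.natAbs + d) (one (i.natAbs + d))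
      (S.centre (i.natAbs + d) + i).toNat = x i := by
    intro i d
    induction d with
    | zero => rfl
    | succ d ih =>
      have h1 := hc (i.natAbs + d)
      rw [← ih]
      refine Eq.trans ?_ (hstep _ _ (by omega))
      have h2 : S.centre (i.natAbs + (d + 1)) = S.len (i.natAbs + d) + S.centre (i.natAbs + d) :=
        rfl
      exact congrArg (S.letter (i.natAbs + d + 1) (one (i.natAbs + d + 1))) (by omega)
  refine ⟨x, fun a n => ?_⟩
  set J := a.natAbs + n
  refine ⟨J, one J, subword_infix (p := -S.centre J) ?_ ?_ fun i hi => ?_⟩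
  · have := hc J; omega
  · have := hc J; omega
  · obtain ⟨d, hd⟩ := Nat.exists_eq_add_of_le (show (a + i).natAbs ≤ J by omega)
    rw [hd, ← hx _ d]
    congr 2; omega

/-- Every word of every stage occurs in every point, to the right of any given position. -/
lemma exists_at (hS : S.IsLarge) (x : S.space) (j : ℕ) (k : Fin (S.card j)) (a : ℤ) :
    ∃ s, a ≤ s ∧ S.At x.1 j k s := by
  obtain ⟨-, s, -, hs, -, -, K, h⟩ := exists_two_words hS x.2 (j + 1) a
  have := h.child ((S.perm j K).symm k)
  rw [Equiv.apply_symm_apply] at this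
  exact ⟨_, by omega, this⟩

lemma exists_at_zero (hS : S.IsLarge) (j : ℕ) (k : Fin (S.card j)) :
    ∃ x : S.space, S.At x.1 j k 0 := by
  obtain ⟨x⟩ := exists_point hS
  obtain ⟨s, -, hs⟩ := exists_at hS x j k 0
  exact ⟨S.shiftBy s x, at_shiftBy.2 (by simpa using hs)⟩

/-- From some stage on, a given window of a given point occurs in all the words of the stage at the
same position. -/
lemma exists_offset (hS : S.IsLarge) (x : S.space) (r : ℕ) :
    ∃ J₀, ∀ J ≥ J₀, ∃ A : ℕ, A ≤ S.len J ∧ ∀ (z : ℤ → Letter) (K : Fin (S.card J)) (s : ℤ),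
      S.At z J K s → ∀ i : ℤ, |i| ≤ r → z (s + A + i) = x.1 i := by
  obtain ⟨j, K, p, y, hxy, hy, hp, hpn⟩ : ∃ (j : ℕ) (K : Fin (S.card j)) (p : ℤ)
      (y : ℤ → Letter), (∀ i, -(r : ℤ) ≤ i → i < -r + (2 * r + 1 : ℕ) → y i = x.1 i) ∧
        S.At y j K p ∧ p ≤ -r ∧ -r + (2 * r + 1 : ℕ) ≤ p + S.len j :=
    let ⟨e, h⟩ := exists_window hS x.2 (-r) (2 * r + 1) 0
    ⟨0 + e, h⟩
  have hone : ∀ j, 0 < S.card j := fun j => by have := large_card hS j; omega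
  -- The word `K` containing the window is one of the subwords of the word 0 of stage `j + 1`.
  obtain ⟨A₀, hA₀, hA⟩ : ∃ A : ℕ, A ≤ S.len (j + 1) ∧ ∀ (z : ℤ → Letter) (s : ℤ),
      S.At z (j + 1) ⟨0, hone _⟩ s → ∀ i : ℤ, |i| ≤ r → z (s + A + i) = x.1 i := by
    let m := (S.perm j ⟨0, hone _⟩).symm K
    have hm := pos_add_le_concatLength (S.len j) m.2
    obtain ⟨q, hq⟩ := Int.eq_ofNat_of_zero_le (show 0 ≤ - p by omega)
    refine ⟨pos (S.len j) m + q, ?_, fun z s hz i hi => ?_⟩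
    · change _ ≤ concatLength _ _
      omega
    · have h1 := hz.child m
      rw [show S.perm j ⟨0, hone _⟩ m = K from Equiv.apply_symm_apply _ _] at h1
      rw [abs_le] at hi
      obtain ⟨q', hq'⟩ := Int.eq_ofNat_of_zero_le (show 0 ≤ q + i by omega)
      have h2 := h1 q' (by omega)
      have h3 := hy q' (by omega)
      rw [← hxy i (by omega) (by omega), show i = p + (q' : ℤ) by omega, h3, ← h2]
      congr 1
      push_cast
      omega
  -- The index 0 is not permuted, so every word of stage `j + 2` begins with the word 0 of stage `j
  -- + 1`, and the words of all later stages inherit this beginning.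
  refine ⟨j + 2, fun J hJ => ⟨A₀, hA₀.trans ((len_strictMono hS).monotone (by omega)), ?_⟩⟩
  induction J, hJ using Nat.le_induction with
  | base =>
    intro z K s hz
    have := hz.child ⟨0, hone _⟩
    rw [S.perm_apply _ (fun h => h.2 rfl)] at this
    exact hA z s (by simpa using this)
  | succ J hJ ih =>
    intro z K s hz
    have := hz.child ⟨0, hone _⟩
    rw [S.perm_apply _ (fun h => h.2 rfl)] at this
    exact ih z _ s (by simpa using this)

/-! ### Local sets -/

/-- Membership in `E` depends only on the coordinates in `[-r, r]`. -/
def IsLocal (S : Construction) (r : ℕ) (E : Set S.space) : Prop :=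
  ∀ x y : S.space, (∀ i : ℤ, |i| ≤ r → x.1 i = y.1 i) → x ∈ E → y ∈ E

/-- The restriction of a point to the coordinates in `[-r, r]`. -/
def window (S : Construction) (r : ℕ) (x : S.space) : Icc (-r : ℤ) r → Letter := fun i => x.1 i

lemma measurable_coord (i : ℤ) : Measurable fun x : S.space => x.1 i :=
  (measurable_pi_apply i).comp measurable_subtype_coe

lemma continuous_coord (i : ℤ) : Continuous fun x : S.space => x.1 i :=
  (continuous_apply i).comp continuous_subtype_val

lemma measurable_window (r : ℕ) : Measurable (S.window r) :=
  measurable_pi_lambda _ fun i => measurable_coord i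

lemma continuous_window (r : ℕ) : Continuous (S.window r) :=
  continuous_pi fun i => continuous_coord i

lemma IsLocal.preimage_image {r : ℕ} {E : Set S.space} (h : S.IsLocal r E) :
    S.window r ⁻¹' (S.window r '' E) = E := by
  apply Subset.antisymm _ (subset_preimage_image _ _)
  rintro y ⟨x, hx, hxy⟩
  refine h x y (fun i hi => ?_) hx
  exact congrFun hxy ⟨i, abs_le.1 hi⟩

lemma IsLocal.measurableSet {r : ℕ} {E : Set S.space} (h : S.IsLocal r E) : MeasurableSet E := by
  rw [← h.preimage_image]
  exact measurable_window r (Set.toFinite _).measurableSet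

lemma IsLocal.isClopen {r : ℕ} {E : Set S.space} (h : S.IsLocal r E) : IsClopen E := by
  rw [← h.preimage_image]
  exact (isClopen_discrete _).preimage (continuous_window r)

lemma IsLocal.mono {r r' : ℕ} {E : Set S.space} (h : S.IsLocal r E) (hr : r ≤ r') :
    S.IsLocal r' E :=
  fun x y hxy => h x y fun i hi => hxy i (hi.trans (by exact_mod_cast hr))

lemma IsLocal.compl {r : ℕ} {E : Set S.space} (h : S.IsLocal r E) : S.IsLocal r Eᶜ :=
  fun x y hxy hx hy => hx (h y x (fun i hi => (hxy i hi).symm) hy)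

lemma IsLocal.inter {r : ℕ} {E F : Set S.space} (h : S.IsLocal r E) (h' : S.IsLocal r F) :
    S.IsLocal r (E ∩ F) :=
  fun x y hxy hx => ⟨h x y hxy hx.1, h' x y hxy hx.2⟩

lemma IsLocal.union {r : ℕ} {E F : Set S.space} (h : S.IsLocal r E) (h' : S.IsLocal r F) :
    S.IsLocal r (E ∪ F) :=
  fun x y hxy hx => hx.imp (h x y hxy) (h' x y hxy)

/-- Together with `generateFrom_isLocal` this allows measures to be compared, and measurable sets
approximated, by means of local sets. -/
lemma isSetRing_isLocal (S : Construction) : IsSetRing {E | ∃ r, S.IsLocal r E} where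
  empty_mem := ⟨0, fun _ _ _ h => h⟩
  union_mem := by
    rintro E F ⟨r, h⟩ ⟨r', h'⟩
    exact ⟨max r r', (h.mono (le_max_left _ _)).union (h'.mono (le_max_right _ _))⟩
  sdiff_mem := by
    rintro E F ⟨r, h⟩ ⟨r', h'⟩
    exact ⟨max r r', (h.mono (le_max_left _ _)).inter (h'.mono (le_max_right _ _)).compl⟩

lemma generateFrom_isLocal (S : Construction) :
    (inferInstance : MeasurableSpace S.space) =
      MeasurableSpace.generateFrom {E | ∃ r, S.IsLocal r E} := by
  apply le_antisymm
  · have : @Measurable _ _ (MeasurableSpace.generateFrom {E | ∃ r, S.IsLocal r E})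
        MeasurableSpace.pi (Subtype.val : S.space → ℤ → Letter) := by
      refine @measurable_pi_lambda _ _ _ (_) _ _ fun a => ?_
      intro t _
      refine MeasurableSpace.measurableSet_generateFrom ⟨a.natAbs, fun x y hxy hx => ?_⟩
      have := hxy a (by rw [Int.abs_eq_natAbs])
      simpa [← this] using hx
    exact this.comap_le
  · apply MeasurableSpace.generateFrom_le
    rintro E ⟨r, h⟩
    exact h.measurableSet

lemma exists_isLocal_symmDiff_lt (μ : Measure S.space) [IsFiniteMeasure μ] {A : Set S.space}
    (hA : MeasurableSet A) {ε : ℝ≥0∞} (hε : 0 < ε) :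
    ∃ r B, S.IsLocal r B ∧ μ (symmDiff B A) < ε := by
  obtain ⟨B, ⟨r, hr⟩, hB⟩ := exists_measure_symmDiff_lt_of_generateFrom_isSetRing
    S.isSetRing_isLocal ⟨{univ}, countable_singleton _, by
      rintro _ rfl; exact ⟨0, fun _ _ _ _ => trivial⟩, by simp⟩ S.generateFrom_isLocal hA hε (μ := μ)
  exact ⟨r, B, hr, hB⟩

lemma ext_of_isLocal {μ ν : Measure S.space} [IsProbabilityMeasure μ] [IsProbabilityMeasure ν]
    (h : ∀ r E, S.IsLocal r E → μ E = ν E) : μ = ν := by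
  refine ext_of_generate_finite _ S.generateFrom_isLocal
    S.isSetRing_isLocal.isSetSemiring.isPiSystem ?_ (by simp)
  rintro E ⟨r, hE⟩
  exact h r E hE

lemma isClosed_space (S : Construction) : IsClosed S.space := by
  have : S.space = ⋂ (i : ℤ) (n : ℕ), (fun (x : ℤ → Letter) (k : Fin n) => x (i + (k : ℕ))) ⁻¹'
      {w | ∃ (j : ℕ) (k : Fin (S.card j)), List.ofFn w <:+: S.word j k} := by
    ext x
    simp only [mem_iInter]
    rfl
  rw [this]
  exact isClosed_iInter fun i => isClosed_iInter fun n =>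
    (isClosed_discrete _).preimage (continuous_pi fun k => continuous_apply _)

instance : CompactSpace S.space := isCompact_iff_compactSpace.1 S.isClosed_space.isCompact

lemma continuous_shiftBy (a : ℤ) : Continuous (S.shiftBy a) :=
  (continuous_pi fun i => continuous_coord (i + a)).subtype_mk _

lemma measurable_shiftBy (a : ℤ) : Measurable (S.shiftBy a) :=
  (continuous_shiftBy a).measurable

lemma continuous_shift : Continuous S.shift := continuous_shiftBy 1

/-- The open sets contain local neighbourhoods of their points. -/
lemma exists_window_subset {U : Set S.space} (hU : IsOpen U) {x : S.space} (hx : x ∈ U) :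
    ∃ r : ℕ, ∀ y : S.space, (∀ i : ℤ, |i| ≤ r → y.1 i = x.1 i) → y ∈ U := by
  obtain ⟨V, hV, rfl⟩ := isOpen_induced_iff.1 hU
  obtain ⟨I, u, hu, hV'⟩ := isOpen_pi_iff.1 hV x.1 hx
  refine ⟨I.sup Int.natAbs, fun y hy => hV' fun i hi => ?_⟩
  have : i.natAbs ≤ I.sup Int.natAbs := Finset.le_sup (f := Int.natAbs) hi
  rw [hy i (by rw [Int.abs_eq_natAbs]; exact_mod_cast this)]
  exact (hu i hi).2

/-! ### Minimality -/

/-- By `exists_offset` any window of `y` occurs in all words of some stage, and by `exists_at` such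
words occur to the right of 0 in every `x`; so every forward orbit is dense. -/
lemma isMinimalSystem (hS : S.IsLarge) : IsMinimalSystem S.shift := by
  refine ⟨exists_point hS, fun K hK hKs => ?_⟩
  rcases K.eq_empty_or_nonempty with h | ⟨x, hx⟩
  · exact Or.inl h
  · right
    rw [eq_univ_iff_forall]
    intro y
    rw [← hK.closure_eq, mem_closure_iff]
    intro U hU hy
    obtain ⟨r, hr⟩ := exists_window_subset hU hy
    obtain ⟨J, hJ⟩ := exists_offset hS y r
    obtain ⟨A, hA, h⟩ := hJ J le_rfl
    obtain ⟨s, hs, hxs⟩ := exists_at hS x J ⟨0, by have := large_card hS J; omega⟩ 0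
    obtain ⟨q, hq⟩ := Int.eq_ofNat_of_zero_le (show 0 ≤ s + A by omega)
    have hmem : S.shift^[q] x ∈ K := by
      clear hq
      induction q with
      | zero => exact hx
      | succ q ih => rw [Function.iterate_succ_apply']; exact hKs ih
    refine ⟨S.shift^[q] x, hr _ fun i hi => ?_, hmem⟩
    rw [iterate_shift_apply, ← h x.1 _ s hxs i hi]
    exact congrArg x.1 (show i + (q : ℤ) = s + A + i by
      change s + A = (q : ℤ) at hq; omega)

/-! ### Visits and frequencies -/

open scoped Classical in
/-- The number of visits to `E` of the orbit of `x` in the time interval `[s, s + n)`. -/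
noncomputable def visits (E : Set S.space) (x : S.space) (s : ℤ) (n : ℕ) : ℕ :=
  Nat.count (fun i : ℕ => S.shiftBy (s + i) x ∈ E) n

lemma visits_add (E : Set S.space) (x : S.space) (s : ℤ) (a b : ℕ) :
    visits E x s (a + b) = visits E x s a + visits E x (s + a) b := by
  unfold visits
  rw [Nat.count_add]
  congr 2
  ext i
  push_cast
  rw [add_assoc]

open scoped Classical in
lemma visits_mono (E : Set S.space) (x : S.space) (s : ℤ) {a b : ℕ} (h : a ≤ b) :
    visits E x s a ≤ visits E x s b := Nat.count_monotone _ h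

open scoped Classical in
lemma visits_add_visits_compl (E : Set S.space) (x : S.space) (s : ℤ) (n : ℕ) :
    visits E x s n + visits Eᶜ x s n = n := by
  unfold visits
  induction n with
  | zero => simp
  | succ n ih =>
    rw [Nat.count_succ, Nat.count_succ]
    by_cases h : S.shiftBy (s + n) x ∈ E
    · rw [if_pos h, if_neg (show ¬ _ ∈ Eᶜ from fun h' => h' h)]; omega
    · rw [if_neg h, if_pos (show _ ∈ Eᶜ from h)]; omega

open scoped Classical in
lemma visits_congr {E : Set S.space} {x y : S.space} {s t : ℤ} {n : ℕ}
    (h : ∀ i : ℕ, i < n → (S.shiftBy (s + i) x ∈ E ↔ S.shiftBy (t + i) y ∈ E)) :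
    visits E x s n = visits E y t n := by
  unfold visits
  induction n with
  | zero => simp
  | succ n ih =>
    rw [Nat.count_succ, Nat.count_succ, ih fun i hi => h i (by omega)]
    by_cases h' : S.shiftBy (t + n) y ∈ E
    · rw [if_pos h', if_pos ((h n (by omega)).2 h')]
    · rw [if_neg h', if_neg (fun h'' => h' ((h n (by omega)).1 h''))]

lemma sum_visits_le (E : Set S.space) (x : S.space) (s : ℤ) (l N : ℕ) :
    ∑ k : Fin N, visits E x (s + pos l k) l ≤ visits E x s (concatLength l N) := by
  induction N with
  | zero => simp
  | succ N ih =>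
    rw [Fin.sum_univ_castSucc, concatLength_succ, visits_add, Fin.val_last]
    exact Nat.add_le_add_right (ih.trans (visits_mono _ _ _ (concatLength_le_pos l N))) _

lemma visits_eq_of_forall_mem {E : Set S.space} {x : S.space} {s : ℤ} {n : ℕ}
    (h : ∀ i : ℕ, i < n → S.shiftBy (s + i) x ∈ E) : visits E x s n = n := by
  unfold visits
  induction n with
  | zero => simp
  | succ n ih =>
    rw [Nat.count_succ, ih fun i hi => h i (by omega), if_pos (h n (by omega))]

/-- Following the chain `D`, each word contributes `c` visits and uses at most `len J + 1` units of
time, one of them for a possible spacer. -/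
lemma mul_le_visits {E : Set S.space} {J c : ℕ} {x : S.space}
    (hE : ∀ k s, S.At x.1 J k s → c ≤ visits E x s (S.len J)) {D : Set ℤ} {b : ℤ}
    (hD : ∀ d ∈ D, d + S.len J < b → (∃ k, S.At x.1 J k d) ∧
        (d + S.len J ∈ D ∨ d + S.len J + 1 ∈ D)) (m : ℕ) (d : ℤ) (hd : d ∈ D)
    (hdb : d + m * (S.len J + 1) ≤ b) : c * m ≤ visits E x d (m * (S.len J + 1)) := by
  induction m generalizing d with
  | zero => simp
  | succ m ih =>
    push_cast at hdb
    have h0 : (0 : ℤ) ≤ m * (S.len J + 1) := by positivity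
    obtain ⟨⟨k, hk⟩, h⟩ := hD d hd (by linarith)
    have h1 := hE k d hk
    rcases h with h | h
    · have h2 := ih _ h (by linarith)
      have h3 := visits_mono E x d (show S.len J + m * (S.len J + 1) ≤ (m + 1) * (S.len J + 1) by
        rw [Nat.add_mul]; omega)
      rw [visits_add] at h3
      rw [Nat.mul_add]; omega
    · have h2 := ih _ h (by linarith)
      have h3 := visits_mono E x d (show S.len J + 1 + m * (S.len J + 1) ≤ (m + 1) * (S.len J + 1) by
        rw [Nat.add_mul]; omega)
      rw [visits_add, visits_add] at h3
      rw [Nat.mul_add]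
      push_cast at h3
      rw [← add_assoc d] at h3
      omega

/-- The two extra blocks pay for the time before the first word of the chain and for the right end
of the window. -/
lemma mul_le_visits_zero (hS : S.IsLarge) {E : Set S.space} {J c : ℕ} (x : S.space)
    (hE : ∀ k s, S.At x.1 J k s → c ≤ visits E x s (S.len J)) (m : ℕ) :
    c * m ≤ visits E x 0 ((m + 2) * (S.len J + 1)) := by
  obtain ⟨D, ⟨d, hd, h0, h1⟩, hD⟩ := exists_chain hS x.2 J 0
    (n := (m + 2) * (S.len J + 1)) (by nlinarith)
  have h2 := mul_le_visits (b := 0 + ((m + 2) * (S.len J + 1) : ℕ)) hE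
    (fun d hd h => ⟨(hD d hd h).1, (hD d hd h).2.imp id And.right⟩) m d hd
    (by push_cast; linarith)
  obtain ⟨q, rfl⟩ := Int.eq_ofNat_of_zero_le h0
  refine h2.trans ?_
  have h3 := visits_mono E x 0 (show q + m * (S.len J + 1) ≤ (m + 2) * (S.len J + 1) by
    rw [Nat.add_mul]; omega)
  rw [visits_add, zero_add] at h3
  omega

open scoped Classical in
lemma lintegral_visits {μ : Measure S.space} (hμ : MeasurePreserving S.shift μ μ)
    {E : Set S.space} (hE : MeasurableSet E) (n : ℕ) :
    ∫⁻ x, (visits E x 0 n : ℝ≥0∞) ∂μ = n * μ E := by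
  have h : ∀ x, (visits E x 0 n : ℝ≥0∞) =
      ∑ i ∈ Finset.range n, (S.shift^[i] ⁻¹' E).indicator 1 x := by
    intro x
    unfold visits
    rw [Nat.count_eq_card_filter_range, Finset.card_filter]
    push_cast
    refine Finset.sum_congr rfl fun i _ => ?_
    rw [indicator_apply]
    simp [iterate_shift]
  simp_rw [h]
  rw [lintegral_finsetSum]
  · rw [Finset.sum_congr rfl fun i _ => lintegral_indicator_one
      ((hμ.iterate i).measurable hE)]
    rw [Finset.sum_congr rfl fun i _ => (hμ.iterate i).measure_preimage hE.nullMeasurableSet]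
    simp
  · intro i _
    exact measurable_one.indicator ((hμ.iterate i).measurable hE)

/-- A set that is visited at least `c` times during every word of stage `J` has measure at least
`c / (len J + 1)`. -/
lemma le_measureReal_mul (hS : S.IsLarge) {μ : Measure S.space} [IsProbabilityMeasure μ]
    (hμ : MeasurePreserving S.shift μ μ) {E : Set S.space} (hE : MeasurableSet E) {J c : ℕ}
    (h : ∀ (x : S.space) k s, S.At x.1 J k s → c ≤ visits E x s (S.len J)) :
    (c : ℝ) ≤ μ.real E * (S.len J + 1) := by
  have key : ∀ m : ℕ, (c * m : ℝ) ≤ (m + 2) * (μ.real E * (S.len J + 1)) := by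
    intro m
    have h1 : ((c * m : ℕ) : ℝ≥0∞) ≤ ((m + 2) * (S.len J + 1) : ℕ) * μ E := by
      rw [← lintegral_visits hμ hE]
      calc ((c * m : ℕ) : ℝ≥0∞) = ∫⁻ _, ((c * m : ℕ) : ℝ≥0∞) ∂μ := by simp
        _ ≤ _ := lintegral_mono fun x => by
          exact Nat.cast_le.2 (mul_le_visits_zero hS x (h x) m)
    have h2 := ENNReal.toReal_mono (by finiteness) h1
    rw [ENNReal.toReal_mul, ENNReal.toReal_natCast, ENNReal.toReal_natCast] at h2
    push_cast at h2
    change _ ≤ _ * μ.real E at h2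
    linarith
  -- Dividing `key` by `m` removes the two boundary blocks in the limit.
  have hT : Tendsto (fun m : ℕ => (((m : ℝ) + 2) / m) * (μ.real E * (S.len J + 1))) atTop
      (𝓝 (1 * (μ.real E * (S.len J + 1)))) := by
    apply Tendsto.mul_const
    have : Tendsto (fun m : ℕ => 1 + (2 : ℝ) / m) atTop (𝓝 (1 + 0)) :=
      tendsto_const_nhds.add (tendsto_const_div_atTop_nhds_zero_nat 2)
    rw [add_zero] at this
    refine this.congr' ?_
    filter_upwards [eventually_gt_atTop 0] with m hm
    field_simp
  rw [one_mul] at hT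
  refine ge_of_tendsto hT ?_
  filter_upwards [eventually_gt_atTop 0] with m hm
  have hm' : (0 : ℝ) < m := by exact_mod_cast hm
  rw [div_mul_eq_mul_div, le_div_iff₀ hm']
  exact key m

/-! ### Unique ergodicity -/

lemma mem_iff_of_at {r : ℕ} {E : Set S.space} (hE : S.IsLocal r E) {j : ℕ} {k : Fin (S.card j)}
    {x y : S.space} {s t : ℤ} (hx : S.At x.1 j k s) (hy : S.At y.1 j k t) {i : ℕ} (h1 : r ≤ i)
    (h2 : i + r < S.len j) : S.shiftBy (s + i) x ∈ E ↔ S.shiftBy (t + i) y ∈ E := by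
  have key : ∀ a : ℤ, |a| ≤ r → (S.shiftBy (s + i) x).1 a = (S.shiftBy (t + i) y).1 a := by
    intro a ha
    rw [abs_le] at ha
    obtain ⟨q, hq⟩ := Int.eq_ofNat_of_zero_le (show 0 ≤ a + i by omega)
    have e1 := hx q (by omega)
    have e2 := hy q (by omega)
    rw [← e2] at e1
    rw [shiftBy_apply, shiftBy_apply, show a + (s + i) = s + q by omega,
      show a + (t + i) = t + q by omega, e1]
  exact ⟨hE _ _ key, hE _ _ fun a ha => (key a ha).symm⟩

lemma visits_inner_le (E : Set S.space) (x : S.space) (s : ℤ) {r l : ℕ} (h : 2 * r ≤ l) :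
    visits E x (s + r) (l - 2 * r) ≤ visits E x s l := by
  have := visits_mono E x s (show r + (l - 2 * r) ≤ l by omega)
  rw [visits_add] at this
  omega

/-- Each word of stage `J + 1` contains each word of stage `J` once, and away from margins of width
`r` the visits are determined by the word of stage `J`. The total is therefore a lower bound valid
for every word of stage `J + 1`. -/
lemma sum_le_measureReal_mul (hS : S.IsLarge) {μ : Measure S.space} [IsProbabilityMeasure μ]
    (hμ : MeasurePreserving S.shift μ μ) {r : ℕ} {E : Set S.space} (hE : S.IsLocal r E) {J : ℕ}
    (hr : 2 * r ≤ S.len J) {z : Fin (S.card J) → S.space} (hz : ∀ k, S.At (z k).1 J k 0) :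
    ((∑ k, visits E (z k) (0 + r) (S.len J - 2 * r) : ℕ) : ℝ) ≤
      μ.real E * (S.len (J + 1) + 1) := by
  refine le_measureReal_mul hS hμ hE.measurableSet fun x K s hx => ?_
  refine le_trans ?_ (sum_visits_le E x s (S.len J) (S.card J))
  -- Reindexing by the permutation removes the dependence on `K`.
  rw [← Equiv.sum_comp (S.perm J K)]
  refine Finset.sum_le_sum fun k _ => ?_
  refine le_trans (le_of_eq ?_) (visits_inner_le E x _ hr)
  refine visits_congr fun i hi => ?_
  have := mem_iff_of_at hE (hz (S.perm J K k)) (hx.child k) (i := r + i) (by omega) (by omega)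
  push_cast at this
  rwa [← add_assoc, ← add_assoc] at this

/-- The lower bounds for `E` and for its complement involve counts adding up to N (l - 2r), out of
at most N (l + 1). They confine the measure of `E` to an interval of length (2r + 1) / (l + 1) that
does not depend on the invariant measure. -/
lemma abs_measureReal_sub_le (hS : S.IsLarge) {μ ν : Measure S.space} [IsProbabilityMeasure μ]
    [IsProbabilityMeasure ν] (hμ : MeasurePreserving S.shift μ μ)
    (hν : MeasurePreserving S.shift ν ν) {r : ℕ} {E : Set S.space} (hE : S.IsLocal r E) {J : ℕ}
    (hr : 2 * r ≤ S.len J) : |μ.real E - ν.real E| ≤ (2 * r + 1) / (S.len J + 1) := by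
  choose z hz using exists_at_zero hS J
  have m1 := sum_le_measureReal_mul hS hμ hE hr hz
  have m2 := sum_le_measureReal_mul hS hμ hE.compl hr hz
  have n1 := sum_le_measureReal_mul hS hν hE hr hz
  have n2 := sum_le_measureReal_mul hS hν hE.compl hr hz
  rw [probReal_compl_eq_one_sub hE.measurableSet] at m2 n2
  set a := ∑ k, visits E (z k) (0 + r) (S.len J - 2 * r)
  set b := ∑ k, visits Eᶜ (z k) (0 + r) (S.len J - 2 * r)
  have hab : a + b = S.card J * (S.len J - 2 * r) := by
    simp only [a, b]
    rw [← Finset.sum_add_distrib, Finset.sum_congr rfl fun k _ => visits_add_visits_compl _ _ _ _]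
    simp
  have hab' : (a : ℝ) + b = S.card J * (S.len J - 2 * r) := by
    have : ((a + b : ℕ) : ℝ) = ((S.card J * (S.len J - 2 * r) : ℕ) : ℝ) := by rw [hab]
    push_cast [hr] at this
    exact this
  have hL : (S.len (J + 1) : ℝ) + 1 ≤ S.card J * (S.len J + 1) := by
    exact_mod_cast len_succ_add_one_le hS J
  have hl : (0 : ℝ) < S.len J + 1 := by positivity
  have hL0 : (0 : ℝ) < S.len (J + 1) + 1 := by positivity
  have hmain : ∀ m n : ℝ, (a : ℝ) ≤ m * (S.len (J + 1) + 1) →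
      (b : ℝ) ≤ (1 - n) * (S.len (J + 1) + 1) → n - m ≤ (2 * r + 1) / (S.len J + 1) := by
    intro m n h1 h2
    rw [le_div_iff₀ hl]
    have h3 : (n - m) * (S.len (J + 1) + 1) ≤
        (S.len (J + 1) + 1) - S.card J * (S.len J - 2 * r) := by linarith
    have h4 : (S.card J : ℝ) * (S.len J - 2 * r) * (S.len J + 1) ≥
        (S.len (J + 1) + 1) * (S.len J - 2 * r) := by
      have : (0 : ℝ) ≤ S.len J - 2 * r := by
        have : ((2 * r : ℕ) : ℝ) ≤ S.len J := by exact_mod_cast hr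
        push_cast at this; linarith
      nlinarith
    have h5 := mul_le_mul_of_nonneg_right h3 hl.le
    have h6 : (S.len (J + 1) + 1) * ((n - m) * (S.len J + 1)) ≤
        ((S.len (J + 1) : ℝ) + 1) * (2 * r + 1) := by nlinarith
    exact le_of_mul_le_mul_left h6 hL0
  rw [abs_le]
  constructor
  · have := hmain _ _ m1 n2; linarith
  · have := hmain _ _ n1 m2; linarith

lemma invariant_unique (hS : S.IsLarge) {μ ν : Measure S.space} [IsProbabilityMeasure μ]
    [IsProbabilityMeasure ν] (hμ : MeasurePreserving S.shift μ μ)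
    (hν : MeasurePreserving S.shift ν ν) : μ = ν := by
  refine ext_of_isLocal fun r E hE => ?_
  have h0 : |μ.real E - ν.real E| ≤ 0 := by
    have ht : Tendsto (fun J => (2 * r + 1 : ℝ) / (S.len J + 1)) atTop (𝓝 0) :=
      tendsto_const_nhds.div_atTop (tendsto_atTop_add_const_right _ _
        (tendsto_natCast_atTop_atTop.comp (tendsto_len hS)))
    refine ge_of_tendsto ht ?_
    filter_upwards [(tendsto_len hS).eventually_ge_atTop (2 * r)] with J hJ
    exact abs_measureReal_sub_le hS hμ hν hE hJ
  have h1 : μ.real E = ν.real E := by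
    have := abs_nonpos_iff.1 h0; linarith
  rwa [measureReal_eq_measureReal_iff] at h1

/-- The Krylov–Bogolyubov argument: an ultrafilter limit of the empirical measures along an orbit,
which exists because the probability measures on a compact space form a compact space. Local sets
are clopen, so their indicators are admissible test functions. -/
lemma exists_invariant (hS : S.IsLarge) :
    ∃ μ : Measure S.space, IsProbabilityMeasure μ ∧ MeasurePreserving S.shift μ μ := by
  obtain ⟨x₀⟩ := exists_point hS
  let m : ℕ → Measure S.space := fun n =>
    ((n : ℝ≥0∞) + 1)⁻¹ • ∑ i ∈ Finset.range (n + 1), Measure.dirac (S.shift^[i] x₀)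
  have hm : ∀ n, IsProbabilityMeasure (m n) := fun n => ⟨by
    simp only [m, Measure.smul_apply, Measure.finsetSum_apply, measure_univ, Finset.sum_const,
      Finset.card_range, smul_eq_mul, nsmul_eq_mul, mul_one]
    push_cast
    exact ENNReal.inv_mul_cancel (by simp) (by finiteness)⟩
  let P : ℕ → ProbabilityMeasure S.space := fun n => ⟨m n, hm n⟩
  have : Nonempty (ProbabilityMeasure S.space) := ⟨P 0⟩
  let F : Ultrafilter (ProbabilityMeasure S.space) := (hyperfilter ℕ).map P
  have hF : Tendsto P (hyperfilter ℕ) (𝓝 F.lim) := F.le_nhds_lim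
  set μ := F.lim
  have hint : ∀ (n : ℕ) (f : C(S.space, ℝ)), ∫ x, f x ∂(m n) =
      ((n : ℝ) + 1)⁻¹ * ∑ i ∈ Finset.range (n + 1), f (S.shift^[i] x₀) := by
    intro n f
    simp only [m]
    rw [integral_smul_measure, integral_finsetSum_measure]
    · simp only [integral_dirac, smul_eq_mul]
      congr 1
      rw [ENNReal.toReal_inv, ENNReal.toReal_add (by finiteness) (by finiteness)]
      simp
    · intro i _
      exact f.continuous.integrable_of_hasCompactSupport (HasCompactSupport.of_compactSpace _)
  refine ⟨μ, inferInstance, measurable_shiftBy 1, ?_⟩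
  have : IsProbabilityMeasure ((μ : Measure S.space).map S.shift) :=
    Measure.isProbabilityMeasure_map (measurable_shiftBy 1).aemeasurable
  refine ext_of_isLocal fun r E hE => ?_
  let f : C(S.space, ℝ) := ⟨E.indicator 1, (continuous_one).indicator fun a ha => by
    rw [hE.isClopen.frontier_eq] at ha; exact ha.elim⟩
  let g : C(S.space, ℝ) := f.comp ⟨S.shift, continuous_shift⟩
  have hlim : ∀ h : C(S.space, ℝ), Tendsto (fun n => ∫ x, h x ∂(m n)) (hyperfilter ℕ)
      (𝓝 (∫ x, h x ∂(μ : Measure S.space))) := fun h =>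
    ProbabilityMeasure.tendsto_iff_forall_integral_tendsto.1 hF
      (BoundedContinuousFunction.mkOfCompact h)
  have hz : Tendsto (fun n => ∫ x, g x ∂(m n) - ∫ x, f x ∂(m n)) (hyperfilter ℕ) (𝓝 0) := by
    have hb : ∀ x, 0 ≤ f x ∧ f x ≤ 1 := fun x => by
      change 0 ≤ E.indicator 1 x ∧ E.indicator 1 x ≤ 1
      by_cases h : x ∈ E <;> simp [h]
    have ht : Tendsto (fun n : ℕ => ((n : ℝ) + 1)⁻¹) atTop (𝓝 0) := by
      simpa using tendsto_one_div_add_atTop_nhds_zero_nat (𝕜 := ℝ)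
    refine squeeze_zero_norm (fun n => ?_) (ht.mono_left Nat.hyperfilter_le_atTop)
    rw [hint, hint, ← mul_sub, norm_mul, Real.norm_of_nonneg (by positivity)]
    -- The difference of the two orbit sums telescopes to two boundary terms.
    have e : ∑ i ∈ Finset.range (n + 1), g (S.shift^[i] x₀) -
        ∑ i ∈ Finset.range (n + 1), f (S.shift^[i] x₀) = f (S.shift^[n + 1] x₀) - f x₀ := by
      rw [← Finset.sum_sub_distrib]
      refine Eq.trans ?_ (Finset.sum_range_sub (fun i => f (S.shift^[i] x₀)) (n + 1))
      refine Finset.sum_congr rfl fun i _ => ?_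
      change f (S.shift _) - _ = _
      rw [Function.iterate_succ_apply']
    rw [e]
    refine mul_le_of_le_one_right (by positivity) ?_
    rw [Real.norm_eq_abs, abs_le]
    constructor <;> linarith [hb (S.shift^[n + 1] x₀), hb x₀]
  have heq : ∫ x, g x ∂(μ : Measure S.space) = ∫ x, f x ∂(μ : Measure S.space) := by
    have := tendsto_nhds_unique hz ((hlim g).sub (hlim f))
    linarith
  have e1 : ∫ x, f x ∂(μ : Measure S.space) = (μ : Measure S.space).real E :=
    integral_indicator_one hE.measurableSet
  have e2 : ∫ x, g x ∂(μ : Measure S.space) = (μ : Measure S.space).real (S.shift ⁻¹' E) :=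
    integral_indicator_one (hE.measurableSet.preimage (measurable_shiftBy 1))
  rw [Measure.map_apply (f := S.shift) (measurable_shiftBy 1) hE.measurableSet]
  rw [e1, e2] at heq
  rwa [measureReal_eq_measureReal_iff] at heq

lemma isStrictlyErgodic (hS : S.IsLarge) : IsStrictlyErgodic S.shift := by
  refine ⟨isMinimalSystem hS, ?_⟩
  obtain ⟨μ, h1, h2⟩ := exists_invariant hS
  refine ⟨μ, ⟨h1, h2⟩, ?_⟩
  rintro ν ⟨h3, h4⟩
  exact invariant_unique hS h4 h2

/-- If an invariant set has positive measure, conditioning on it gives an invariant probability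
measure, which by uniqueness is `μ`; so the set has full measure. -/
lemma ergodic (hS : S.IsLarge) {μ : Measure S.space} [IsProbabilityMeasure μ]
    (hμ : MeasurePreserving S.shift μ μ) : Ergodic S.shift μ := by
  refine ⟨hμ, ⟨fun A hA hinv => ?_⟩⟩
  rw [eventuallyConst_set']
  by_cases h0 : μ A = 0
  · exact Or.inl (ae_eq_empty.2 h0)
  · right
    have := ProbabilityTheory.cond_isProbabilityMeasure (μ := μ) (s := A) h0
    have hp : MeasurePreserving S.shift (ProbabilityTheory.cond μ A)
        (ProbabilityTheory.cond μ A) := by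
      have := (hμ.restrict_preimage hA).smul_measure (μ A)⁻¹
      rwa [hinv] at this
    have := invariant_unique hS hp hμ
    rw [ae_eq_univ, ← this, ProbabilityTheory.cond_apply hA]
    simp

/-! ### Topological weak mixing -/

lemma sqrt_sq_add {c e : ℕ} {m : ℕ} (h1 : (c + e) ^ 2 ≤ m) (h2 : m < (c + e + 1) ^ 2) :
    Nat.sqrt m = c + e := by
  symm
  rw [Nat.eq_sqrt]
  constructor <;> nlinarith

/-- Words at two pairs of positions at the same distance `t` whose gaps differ by `D`. -/
lemma exists_gap (l D : ℕ) : ∃ t k₁ k₂ : ℕ, 1 ≤ t ∧ k₁ + t ≤ 9 * (D + 1) ^ 4 ∧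
    k₂ + t ≤ 9 * (D + 1) ^ 4 ∧
    pos l (k₁ + t) + D + pos l k₂ = pos l (k₂ + t) + pos l k₁ := by
  -- With t = h ^ 2 - 1, the root of the `1`-based position climbs from 1 to h = D + 1 + e when
  -- starting at `k₂ = 0`, which passes e + D spacers, but only from D + 1 to D + 1 + e when
  -- starting at `k₁ = (D + 1) ^ 2 - 1`, which passes e. The size of e ensures (D + 1) ^ 2 ≤ 2h + 1,
  -- so that the root does not climb further.
  set e := D ^ 2 + 1 with he
  set h := e + 1 + D with hh
  have hh0 : 1 ≤ h ^ 2 := Nat.one_le_pow _ _ (by omega)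
  have hc0 : 1 ≤ (D + 1) ^ 2 := Nat.one_le_pow _ _ (by omega)
  have hh1 : 2 ^ 2 ≤ h ^ 2 := Nat.pow_le_pow_left (by omega) 2
  have hbound : (D + 1) ^ 2 + h ^ 2 ≤ 9 * (D + 1) ^ 4 := by
    rw [hh, he]; ring_nf; nlinarith [sq_nonneg (D : ℤ)]
  have s1 : Nat.sqrt ((D + 1) ^ 2 - 1 + 1) = D + 1 := by
    rw [Nat.sub_add_cancel hc0, Nat.sqrt_eq']
  have s2 : Nat.sqrt (h ^ 2 - 1 + 1) = h := by rw [Nat.sub_add_cancel hh0, Nat.sqrt_eq']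
  have s3 : Nat.sqrt ((D + 1) ^ 2 - 1 + (h ^ 2 - 1) + 1) = (D + 1) + e := by
    apply sqrt_sq_add
    · have : (D + 1 + e) ^ 2 + 1 ≤ (D + 1) ^ 2 + h ^ 2 := by
        rw [hh]; nlinarith
      omega
    · have : (D + 1) ^ 2 + h ^ 2 < (D + 1 + e + 1) ^ 2 := by
        rw [hh]; nlinarith
      omega
  refine ⟨h ^ 2 - 1, (D + 1) ^ 2 - 1, 0, by omega, by omega, by omega, ?_⟩
  clear_value h e
  unfold pos
  rw [s1, s3, zero_add, zero_add, s2, Nat.add_mul]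
  simp
  omega

/-- Each of the four open sets contains all points located at a fixed offset in a word of stage `J`.
Both coordinates are taken from one point `z`, using two pairs of words `t` places apart; the
discrepancy of the four offsets is at most 2 l and is compensated by `exists_gap`. -/
lemma isTopWeakMixing (hS : S.IsLarge) : IsTopWeakMixing S.shift := by
  rintro U V hU hV ⟨⟨x₁, x₂⟩, hx⟩ ⟨⟨y₁, y₂⟩, hy⟩
  obtain ⟨U₁, U₂, hU₁, hU₂, hx₁, hx₂, hUs⟩ := isOpen_prod_iff.1 hU x₁ x₂ hx
  obtain ⟨V₁, V₂, hV₁, hV₂, hy₁, hy₂, hVs⟩ := isOpen_prod_iff.1 hV y₁ y₂ hy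
  have hoff : ∀ {W : Set S.space} {x : S.space}, IsOpen W → x ∈ W → ∃ J₀, ∀ J ≥ J₀, ∃ A : ℕ,
      A ≤ S.len J ∧ ∀ (z : S.space) (K : Fin (S.card J)) (s : ℤ), S.At z.1 J K s →
        S.shiftBy (s + A) z ∈ W := by
    intro W x hW hx
    obtain ⟨r, hr⟩ := exists_window_subset hW hx
    obtain ⟨J₀, hJ⟩ := exists_offset hS x r
    refine ⟨J₀, fun J hJJ => ?_⟩
    obtain ⟨A, hA, h⟩ := hJ J hJJ
    refine ⟨A, hA, fun z K s hz => hr _ fun i hi => ?_⟩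
    rw [shiftBy_apply, ← h z.1 K s hz i hi, add_comm]
  obtain ⟨Ja, ha⟩ := hoff hU₁ hx₁
  obtain ⟨Jb, hb⟩ := hoff hV₁ hy₁
  obtain ⟨Jc, hc⟩ := hoff hU₂ hx₂
  obtain ⟨Jd, hd⟩ := hoff hV₂ hy₂
  -- A discrepancy D ≤ 2 l needs 9 (D + 1) ^ 4 ≤ 729 l ^ 4 places, fewer than N once 1000 l ^ 4 ≤ N.
  obtain ⟨J, hJ, hJa, hJb, hJc, hJd⟩ := ((eventually_mul_pow_le_card hS 1000 4).and
    ((eventually_ge_atTop Ja).and ((eventually_ge_atTop Jb).and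
      ((eventually_ge_atTop Jc).and (eventually_ge_atTop Jd))))).exists
  obtain ⟨A₁, hA₁, ha⟩ := ha J hJa
  obtain ⟨B₁, hB₁, hb⟩ := hb J hJb
  obtain ⟨A₂, hA₂, hc⟩ := hc J hJc
  obtain ⟨B₂, hB₂, hd⟩ := hd J hJd
  have hl := len_pos hS J
  have hgap : ∃ t k₁ k₂ : ℕ, 1 ≤ t ∧ k₁ + t < S.card J ∧ k₂ + t < S.card J ∧
      pos (S.len J) (k₁ + t) + B₁ + A₂ + pos (S.len J) k₂ =
        pos (S.len J) (k₂ + t) + B₂ + A₁ + pos (S.len J) k₁ := by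
    have hD : ∀ D : ℕ, D ≤ 2 * S.len J → 9 * (D + 1) ^ 4 < S.card J := by
      intro D hD
      have h1 : (D + 1) ^ 4 ≤ (3 * S.len J) ^ 4 := Nat.pow_le_pow_left (by omega) 4
      rw [mul_pow] at h1
      have h2 : 0 < S.len J ^ 4 := by positivity
      omega
    rcases le_total (B₂ + A₁) (B₁ + A₂) with h | h
    · obtain ⟨t, k₁, k₂, ht, h1, h2, h3⟩ := exists_gap (S.len J) (B₁ + A₂ - (B₂ + A₁))
      have := hD (B₁ + A₂ - (B₂ + A₁)) (by omega)
      exact ⟨t, k₁, k₂, ht, by omega, by omega, by omega⟩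
    · obtain ⟨t, k₁, k₂, ht, h1, h2, h3⟩ := exists_gap (S.len J) (B₂ + A₁ - (B₁ + A₂))
      have := hD (B₂ + A₁ - (B₁ + A₂)) (by omega)
      exact ⟨t, k₂, k₁, ht, by omega, by omega, by omega⟩
  obtain ⟨t, k₁, k₂, ht, hk₁, hk₂, h⟩ := hgap
  obtain ⟨z, hz⟩ := exists_at_zero hS (J + 1) ⟨0, by have := large_card hS (J + 1); omega⟩
  have c₁ := hz.child ⟨k₁, by omega⟩
  have c₁' := hz.child ⟨k₁ + t, hk₁⟩
  have c₂ := hz.child ⟨k₂, by omega⟩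
  have c₂' := hz.child ⟨k₂ + t, hk₂⟩
  simp only [zero_add] at c₁ c₁' c₂ c₂'
  have g₁ := pos_add_le_pos (S.len J) (show k₁ < k₁ + t by omega)
  have g₂ := pos_add_le_pos (S.len J) (show k₂ < k₂ + t by omega)
  obtain ⟨n, hn⟩ : ∃ n, n + pos (S.len J) k₁ + A₁ = pos (S.len J) (k₁ + t) + B₁ :=
    ⟨pos (S.len J) (k₁ + t) + B₁ - (pos (S.len J) k₁ + A₁), by omega⟩
  refine ⟨n, (S.shiftBy (pos (S.len J) k₁ + A₁) z, S.shiftBy (pos (S.len J) k₂ + A₂) z),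
    hUs ⟨ha z _ _ c₁, hc z _ _ c₂⟩, ?_⟩
  rw [mem_preimage, Prod.map_iterate]
  refine hVs ⟨?_, ?_⟩
  · have := hb z _ _ c₁'
    rw [Prod.map_fst, iterate_shift, shiftBy_shiftBy]
    convert this using 2
    omega
  · have := hd z _ _ c₂'
    rw [Prod.map_snd, iterate_shift, shiftBy_shiftBy]
    convert this using 2
    omega

end Construction

/-- A monotone sequence is constant on most intervals of length `u`. -/
lemma card_filter_ne_le {f : ℕ → ℕ} (hf : Monotone f) (N u : ℕ) :
    ((Finset.range N).filter fun k => f (k + u) ≠ f k).card ≤ u * f (N + u) := by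
  induction u with
  | zero => simp
  | succ u ih =>
    have h1 : ((Finset.range N).filter fun k => f (k + (u + 1)) ≠ f k) ⊆
        ((Finset.range N).filter fun k => f (k + u) ≠ f k) ∪
        ((Finset.range N).filter fun k => f (k + (u + 1)) ≠ f (k + u)) := by
      intro k
      simp only [Finset.mem_union, Finset.mem_filter]
      rintro ⟨h, h'⟩
      by_cases h2 : f (k + u) = f k
      · right; exact ⟨h, by rwa [h2]⟩
      · left; exact ⟨h, h2⟩
    have h2 : ((Finset.range N).filter fun k => f (k + (u + 1)) ≠ f (k + u)).card ≤ f (N + u) := by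
      have h3 : f u + ((Finset.range N).filter fun k => f (k + (u + 1)) ≠ f (k + u)).card ≤
          f (N + u) := by
        clear ih h1
        induction N with
        | zero => simp
        | succ N ih =>
          rw [Finset.range_add_one, Finset.filter_insert]
          have h4 := hf (show N + u ≤ N + (u + 1) by omega)
          rw [show N + 1 + u = N + (u + 1) by omega]
          split_ifs with h
          · rw [Finset.card_insert_of_notMem (by simp)]
            omega
          · omega
      omega
    have h3 := hf (show N + u ≤ N + (u + 1) by omega)
    have h4 := Nat.mul_le_mul_left u h3
    have h5 := (Finset.card_le_card h1).trans (Finset.card_union_le _ _)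
    rw [Nat.add_mul]
    omega

/-- The integer root changes seldom, so by `card_filter_ne_le` all but about u √N of the stretches
of `u` steps contain no permuted position and no spacer. -/
lemma le_card_filter_sqrt_eq (N u : ℕ) :
    N - u ≤ ((Finset.range (N - u)).filter fun k =>
      Nat.sqrt (k + u + 1) = Nat.sqrt (k + 1)).card + u * (Nat.sqrt N + 1) := by
  have h := card_filter_ne_le (f := fun k => Nat.sqrt (k + 1))
    (fun a b h => Nat.sqrt_le_sqrt (by omega)) (N - u) u
  have h2 := Finset.card_filter_add_card_filter_not (s := Finset.range (N - u))
    (fun k => Nat.sqrt (k + u + 1) = Nat.sqrt (k + 1))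
  rw [Finset.card_range] at h2
  by_cases hu : u ≤ N
  · rw [Nat.sub_add_cancel hu] at h
    have h3 : Nat.sqrt (N + 1) ≤ Nat.sqrt N + 1 := Nat.sqrt_succ_le_succ_sqrt N
    have := Nat.mul_le_mul_left u h3
    simp only [ne_eq] at h
    omega
  · omega

namespace Construction

variable {S : Construction}

/-! ### Matching windows -/

/-- The points that agree with their `t`-th iterate on `[-r, r]`. -/
def matchSet (S : Construction) (r t : ℕ) : Set S.space :=
  {x | ∀ i : ℤ, |i| ≤ r → x.1 i = x.1 (i + t)}

lemma isLocal_matchSet (r t : ℕ) : S.IsLocal (r + t) (S.matchSet r t) := by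
  intro x y hxy hx i hi
  rw [abs_le] at hi
  rw [← hxy i (by rw [abs_le]; push_cast; omega), ← hxy (i + t) (by rw [abs_le]; push_cast; omega)]
  exact hx i (abs_le.2 hi)

lemma matchSet_anti {r r' : ℕ} (h : r ≤ r') (t : ℕ) : S.matchSet r' t ⊆ S.matchSet r t :=
  fun _ hx i hi => hx i (hi.trans (by exact_mod_cast h))

lemma card_not_isPermuted (N : ℕ) :
    N - Nat.sqrt N ≤ (Finset.univ.filter fun k : Fin N => ¬ IsPermuted k).card := by
  have h := Finset.card_filter_add_card_filter_not (s := (Finset.univ : Finset (Fin N)))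
    (fun k : Fin N => IsPermuted k)
  have h2 := card_isPermuted N N le_rfl
  rw [Fintype.card_subtype] at h2
  have h3 : (Finset.univ.filter fun k : Fin N => IsPermuted k ∧ (k : ℕ) < N) =
      Finset.univ.filter fun k : Fin N => IsPermuted k := by
    ext k; simp
  rw [h3] at h2
  rw [Finset.card_univ, Fintype.card_fin] at h
  omega

/-- Whatever the two words of stage `J + 1` are, their non-permuted subwords coincide and stand at
the same places; the windows lying inside these subwords agree. -/
lemma le_visits_matchSet {J r t : ℕ} (hr : 2 * r ≤ S.len J) {x : S.space}
    {K K' : Fin (S.card (J + 1))} {s : ℤ} (h : S.At x.1 (J + 1) K s)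
    (h' : S.At x.1 (J + 1) K' (s + t)) :
    (S.card J - Nat.sqrt (S.card J)) * (S.len J - 2 * r) ≤
      visits (S.matchSet r t) x s (S.len (J + 1)) := by
  refine le_trans ?_ (sum_visits_le _ x s (S.len J) (S.card J))
  refine le_trans (Nat.mul_le_mul_right _ (card_not_isPermuted _)) ?_
  rw [← smul_eq_mul]
  refine le_trans (Finset.card_nsmul_le_sum _
    (fun k : Fin (S.card J) => visits (S.matchSet r t) x (s + pos (S.len J) k) (S.len J)) _ ?_)
    (Finset.sum_le_sum_of_subset (Finset.filter_subset _ _))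
  intro k hk
  rw [Finset.mem_filter] at hk
  have c := h.child k
  have c' := h'.child k
  rw [S.perm_apply _ hk.2] at c c'
  refine le_trans (le_of_eq (Eq.symm ?_)) (visits_inner_le _ x _ hr)
  refine visits_eq_of_forall_mem fun i hi a ha => ?_
  rw [abs_le] at ha
  obtain ⟨q, hq⟩ := Int.eq_ofNat_of_zero_le (show 0 ≤ a + r + i by omega)
  have e1 := c q (by omega)
  have e2 := c' q (by omega)
  rw [shiftBy_apply, shiftBy_apply,
    show a + (s + pos (S.len J) k + r + i) = s + pos (S.len J) k + q by omega,
    show a + t + (s + pos (S.len J) k + r + i) = s + t + pos (S.len J) k + q by omega, e1, e2]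

/-- The proportion of the positions of a word that lie well inside a non-permuted subword. -/
noncomputable def coreDensity (S : Construction) (r J : ℕ) : ℝ :=
  (S.card J - Nat.sqrt (S.card J)) * (S.len J - 2 * r) / (S.card J * (S.len J + 1))

lemma tendsto_card (hS : S.IsLarge) : Tendsto (fun J => (S.card J : ℝ)) atTop atTop := by
  have h := eventually_mul_pow_le_card hS 1 1
  refine tendsto_atTop_mono' _ ?_ (tendsto_len_real hS)
  filter_upwards [h] with J hJ
  have : S.len J ≤ S.card J := by simpa using hJ
  exact_mod_cast this

lemma tendsto_coreDensity (hS : S.IsLarge) (r : ℕ) : Tendsto (S.coreDensity r) atTop (𝓝 1) := by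
  have h1 : Tendsto (fun J => 1 - (Nat.sqrt (S.card J) : ℝ) / S.card J) atTop (𝓝 (1 - 0)) := by
    apply tendsto_const_nhds.sub
    have h2 : Tendsto (fun J => (√(S.card J : ℝ))⁻¹) atTop (𝓝 0) :=
      (Real.tendsto_sqrt_atTop.comp (tendsto_card hS)).inv_tendsto_atTop
    refine squeeze_zero (fun J => by positivity) (fun J => ?_) h2
    have hc : (0 : ℝ) < S.card J := by have := card_pos_real hS J; linarith
    have : (Nat.sqrt (S.card J) : ℝ) ≤ √(S.card J : ℝ) := Real.nat_sqrt_le_real_sqrt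
    rw [div_le_iff₀ hc]
    rwa [← div_eq_inv_mul, Real.div_sqrt]
  have h2 : Tendsto (fun J => 1 - (2 * r + 1 : ℝ) / (S.len J + 1)) atTop (𝓝 (1 - 0)) := by
    apply tendsto_const_nhds.sub
    exact tendsto_const_nhds.div_atTop (tendsto_atTop_add_const_right _ _ (tendsto_len_real hS))
  have h3 := h1.mul h2
  simp only [sub_zero, mul_one] at h3
  refine h3.congr fun J => ?_
  have hc := card_pos_real hS J
  have hl := one_le_len_real hS J
  unfold coreDensity
  field_simp
  ring

/-- For `k` in `G` the subwords `k` and `k + s` of any word of stage `J + 2` are at distance exactly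
`s * len (J + 1) + e`, and `le_visits_matchSet` applies to this pair. The bound is the proportion of
such `k` times the proportion of matching places. -/
lemma le_measureReal_matchSet (hS : S.IsLarge) {μ : Measure S.space} [IsProbabilityMeasure μ]
    (hμ : MeasurePreserving S.shift μ μ) {J r s e : ℕ} (hr : 2 * r ≤ S.len J) {G : Finset ℕ}
    (hG : ∀ k ∈ G, k + s < S.card (J + 1) ∧ Nat.sqrt (k + s + 1) = Nat.sqrt (k + 1) + e) :
    (G.card : ℝ) / S.card (J + 1) * S.coreDensity r J ≤
      μ.real (S.matchSet r (s * S.len (J + 1) + e)) := by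
  set t := s * S.len (J + 1) + e with ht
  have h1 : ((G.card * ((S.card J - Nat.sqrt (S.card J)) * (S.len J - 2 * r)) : ℕ) : ℝ) ≤
      μ.real (S.matchSet r t) * (S.len (J + 2) + 1) := by
    refine le_measureReal_mul hS hμ (isLocal_matchSet r t).measurableSet fun x K p hx => ?_
    refine le_trans ?_ (sum_visits_le _ x p (S.len (J + 1)) (S.card (J + 1)))
    rw [Fin.sum_univ_eq_sum_range
      (fun k => visits (S.matchSet r t) x (p + pos (S.len (J + 1)) k) (S.len (J + 1)))]
    rw [← smul_eq_mul]
    refine le_trans (Finset.card_nsmul_le_sum G _ _ fun k hk => ?_)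
      (Finset.sum_le_sum_of_subset fun k hk => ?_)
    · obtain ⟨hk1, hk2⟩ := hG k hk
      have c := At.child (j := J + 1) hx ⟨k, by omega⟩
      have c' := At.child (j := J + 1) hx ⟨k + s, hk1⟩
      refine le_visits_matchSet (K' := S.perm (J + 1) K ⟨k + s, hk1⟩) hr c ?_
      · convert c' using 1
        have h1 := one_le_sqrt_succ k
        have : pos (S.len (J + 1)) (k + s) = pos (S.len (J + 1)) k + t := by
          unfold pos
          rw [hk2, ht, Nat.add_mul]
          omega
        rw [this]
        push_cast; ring
    · have := (hG k hk).1
      rw [Finset.mem_range]; omega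
  have hc := card_pos_real hS J
  have hc' := card_pos_real hS (J + 1)
  have hl := one_le_len_real hS J
  have hL : (S.len (J + 2) : ℝ) + 1 ≤ S.card (J + 1) * (S.card J * (S.len J + 1)) := by
    have h2 := len_succ_add_one_le hS (J + 1)
    have h3 := Nat.mul_le_mul_left (S.card (J + 1)) (len_succ_add_one_le hS J)
    exact_mod_cast h2.trans h3
  push_cast [hr, Nat.sqrt_le_self] at h1
  unfold coreDensity
  rw [div_mul_div_comm, div_le_iff₀ (by positivity)]
  refine h1.trans ?_
  exact mul_le_mul_of_nonneg_left hL measureReal_nonneg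

/-- Approximate `A` by a local set `B`: on the matching set, membership in `B` does not change after
`t` steps, so only the approximation error, counted twice, remains. The radius does not depend on
`t`. -/
lemma measure_matchSet_inter_le {μ : Measure S.space} [IsProbabilityMeasure μ]
    (hμ : MeasurePreserving S.shift μ μ) {A : Set S.space} (hA : MeasurableSet A) {ε : ℝ≥0∞}
    (hε : 0 < ε) : ∃ r, ∀ t, μ (S.matchSet r t ∩ symmDiff (S.shift^[t] ⁻¹' A) A) ≤ ε := by
  obtain ⟨r, B, hB, hBA⟩ := exists_isLocal_symmDiff_lt μ hA (ENNReal.half_pos hε.ne')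
  refine ⟨r, fun t => ?_⟩
  have hsub : S.matchSet r t ∩ symmDiff (S.shift^[t] ⁻¹' A) A ⊆
      (S.shift^[t] ⁻¹' (symmDiff B A)) ∪ symmDiff B A := by
    rintro x ⟨hx, hxA⟩
    have hloc : S.shift^[t] x ∈ B ↔ x ∈ B :=
      ⟨hB _ _ fun i hi => by rw [iterate_shift_apply]; exact (hx i hi).symm,
        hB _ _ fun i hi => by rw [iterate_shift_apply]; exact hx i hi⟩
    simp only [mem_union, mem_preimage, mem_symmDiff] at *
    tauto
  calc _ ≤ _ := measure_mono hsub
    _ ≤ _ := measure_union_le _ _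
    _ = μ (symmDiff B A) + μ (symmDiff B A) := by
      rw [(hμ.iterate t).measure_preimage (hB.measurableSet.symmDiff hA).nullMeasurableSet]
    _ ≤ ε / 2 + ε / 2 := by gcongr
    _ = ε := ENNReal.add_halves ε

/-! ### Rigidity -/

/-- The case `s = 1`, `e = 0`: all but O(√N) pairs of neighbouring words have no spacer between
them. The constant 3 absorbs √N + 2 exceptional positions. -/
lemma tendsto_measureReal_matchSet (hS : S.IsLarge) {μ : Measure S.space} [IsProbabilityMeasure μ]
    (hμ : MeasurePreserving S.shift μ μ) (r : ℕ) :
    Tendsto (fun J => μ.real (S.matchSet r (S.len (J + 1)))) atTop (𝓝 1) := by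
  have h1 : Tendsto (fun J => (1 - 3 / √(S.card (J + 1) : ℝ)) * S.coreDensity r J) atTop
      (𝓝 ((1 - 0) * 1)) := by
    refine Tendsto.mul (tendsto_const_nhds.sub ?_) (tendsto_coreDensity hS r)
    exact tendsto_const_nhds.div_atTop (Real.tendsto_sqrt_atTop.comp
      ((tendsto_add_atTop_iff_nat 1).2 (tendsto_card hS)))
  rw [sub_zero, mul_one] at h1
  refine tendsto_of_tendsto_of_tendsto_of_le_of_le' h1 tendsto_const_nhds ?_
    (Eventually.of_forall fun J => measureReal_le_one)
  filter_upwards [(tendsto_len hS).eventually_ge_atTop (2 * r)] with J hr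
  have h := le_measureReal_matchSet hS hμ (s := 1) (e := 0) hr
    (G := (Finset.range (S.card (J + 1) - 1)).filter fun k =>
      Nat.sqrt (k + 1 + 1) = Nat.sqrt (k + 1)) (fun k hk => by
        rw [Finset.mem_filter, Finset.mem_range] at hk
        exact ⟨by omega, hk.2⟩)
  rw [one_mul, add_zero] at h
  refine le_trans (mul_le_mul_of_nonneg_right ?_ ?_) h
  · have h2 := le_card_filter_sqrt_eq (S.card (J + 1)) 1
    have h3 := large_card hS (J + 1)
    have hc := card_pos_real hS (J + 1)
    set g := ((Finset.range (S.card (J + 1) - 1)).filter fun k =>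
      Nat.sqrt (k + 1 + 1) = Nat.sqrt (k + 1)).card
    have h4 : S.card (J + 1) ≤ g + Nat.sqrt (S.card (J + 1)) + 2 := by omega
    have h5 : (S.card (J + 1) : ℝ) ≤ g + Nat.sqrt (S.card (J + 1)) + 2 := by exact_mod_cast h4
    have h6 : (Nat.sqrt (S.card (J + 1)) : ℝ) ≤ √(S.card (J + 1)) := Real.nat_sqrt_le_real_sqrt
    have h7 : (1 : ℝ) ≤ √(S.card (J + 1)) := Real.one_le_sqrt.2 (by linarith)
    have h8 := Real.mul_self_sqrt (show (0 : ℝ) ≤ S.card (J + 1) by linarith)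
    rw [le_div_iff₀ (by linarith)]
    have h9 : 3 / √(S.card (J + 1) : ℝ) * S.card (J + 1) = 3 * √(S.card (J + 1) : ℝ) := by
      rw [div_mul_eq_mul_div, div_eq_iff (by positivity), mul_assoc, h8]
    rw [sub_mul, h9]
    linarith
  · unfold coreDensity
    have hr' : ((2 * r : ℕ) : ℝ) ≤ S.len J := by exact_mod_cast hr
    push_cast at hr'
    have : (Nat.sqrt (S.card J) : ℝ) ≤ S.card J := by exact_mod_cast Nat.sqrt_le_self _
    have h1 : (0 : ℝ) ≤ S.len J - 2 * r := by linarith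
    have h2 : (0 : ℝ) ≤ S.card J - Nat.sqrt (S.card J) := by linarith
    positivity

lemma isMetricRigid (hS : S.IsLarge) {μ : Measure S.space} [IsProbabilityMeasure μ]
    (hμ : MeasurePreserving S.shift μ μ) : IsMetricRigid S.shift μ := by
  refine ⟨fun k => S.len (k + 1), (len_strictMono hS).comp (strictMono_id.add_const 1),
    fun A hA => ?_⟩
  rw [ENNReal.tendsto_nhds_zero]
  intro ε hε
  obtain ⟨r, hr⟩ := measure_matchSet_inter_le hμ hA (ENNReal.half_pos hε.ne')
  have h1 : Tendsto (fun J => μ (S.matchSet r (S.len (J + 1)))ᶜ) atTop (𝓝 0) := by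
    have h2 := (tendsto_const_nhds (x := (1 : ℝ))).sub (tendsto_measureReal_matchSet hS hμ r)
    rw [sub_self] at h2
    rw [← ENNReal.ofReal_zero]
    refine (ENNReal.tendsto_ofReal h2).congr fun J => ?_
    rw [← probReal_compl_eq_one_sub (isLocal_matchSet r _).measurableSet, ofReal_measureReal]
  filter_upwards [ENNReal.tendsto_nhds_zero.1 h1 _ (ENNReal.half_pos hε.ne')] with J hJ
  calc μ (symmDiff (S.shift^[S.len (J + 1)] ⁻¹' A) A)
      ≤ μ ((S.matchSet r (S.len (J + 1)) ∩ symmDiff (S.shift^[S.len (J + 1)] ⁻¹' A) A) ∪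
          (S.matchSet r (S.len (J + 1)))ᶜ) := measure_mono fun x hx => by
        by_cases h : x ∈ S.matchSet r (S.len (J + 1))
        · exact Or.inl ⟨h, hx⟩
        · exact Or.inr h
    _ ≤ _ := measure_union_le _ _
    _ ≤ ε / 2 + ε / 2 := add_le_add (hr _) hJ
    _ = ε := ENNReal.add_halves ε

end Construction

/-! ### Pairs of positions with a prescribed number of squares between them -/

lemma card_image_sq_add {I D : Finset ℕ} (hI : ∀ i ∈ I, 1 ≤ i) (h : ∀ i ∈ I, ∀ d ∈ D, d ≤ 2 * i) :
    ((I ×ˢ D).image fun p : ℕ × ℕ => p.1 ^ 2 + p.2 - 1).card = I.card * D.card := by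
  rw [Finset.card_image_of_injOn, Finset.card_product]
  rintro ⟨i, d⟩ hp ⟨i', d'⟩ hp' he
  simp only [Finset.coe_product, mem_prod, Finset.mem_coe] at hp hp'
  have e1 : i ^ 2 + d = i' ^ 2 + d' := by
    have h1 : 1 ≤ i ^ 2 := Nat.one_le_pow _ _ (hI _ hp.1)
    have h2 : 1 ≤ i' ^ 2 := Nat.one_le_pow _ _ (hI _ hp'.1)
    simp only at he
    omega
  -- Since a ^ 2 + b stays below (a + 1) ^ 2, the pair is recovered by the integer root and the
  -- remainder.
  have hs : ∀ a b : ℕ, b ≤ 2 * a → Nat.sqrt (a ^ 2 + b) = a := fun a b hb =>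
    Nat.sqrt_add_eq' a (by omega)
  have e2 := hs i d (h _ hp.1 _ hp.2)
  rw [e1, hs i' d' (h _ hp'.1 _ hp'.2)] at e2
  subst e2
  simp at e1
  rw [e1]

/-- For a suitable distance `s`, many pairs of positions at the distance `s` have no permuted
position between them, and many have exactly one. -/
lemma exists_many_positions {N : ℕ} (hN : 1000 ≤ N) (e : ℕ) (he : e ≤ 1) : ∃ G : Finset ℕ,
    (N : ℝ) ≤ 64 * G.card ∧ ∀ k ∈ G, k + 4 * (Nat.sqrt N / 4) < N ∧
      Nat.sqrt (k + 4 * (Nat.sqrt N / 4) + 1) = Nat.sqrt (k + 1) + e := by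
  set a := Nat.sqrt N / 4 with ha
  have hq : 30 ≤ Nat.sqrt N := by rw [Nat.le_sqrt]; omega
  have hq2 := Nat.sqrt_le N
  have ha1 : 1 ≤ a := by omega
  have hb : N ≤ (4 * a + 4) ^ 2 := by
    have h1 := Nat.lt_succ_sqrt N
    have h2 : Nat.sqrt N + 1 ≤ 4 * a + 4 := by omega
    have := Nat.mul_le_mul h2 h2
    simp only [Nat.succ_eq_add_one] at h1
    rw [sq]; omega
  have hN2 : N ≤ 64 * (a * a) := by nlinarith
  have hsq : (4 * a) ^ 2 ≤ N := by
    have h2 : 4 * a ≤ Nat.sqrt N := by omega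
    have := Nat.mul_le_mul h2 h2
    rw [sq]; omega
  -- Positions are written k + 1 = i ^ 2 + d with i and d ranging over intervals of length a, which
  -- gives a ^ 2 ≥ N / 64 of them.
  have key : ∀ x y : ℕ, 1 ≤ x → y + a ≤ 2 * x + 1 →
      (∀ i d, x ≤ i → i < x + a → y ≤ d → d < y + a → i ^ 2 + d - 1 + 4 * a < N ∧
        Nat.sqrt (i ^ 2 + d + 4 * a) = i + e) →
      ∃ G : Finset ℕ, (N : ℝ) ≤ 64 * G.card ∧ ∀ k ∈ G, k + 4 * a < N ∧
        Nat.sqrt (k + 4 * a + 1) = Nat.sqrt (k + 1) + e := by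
    intro x y hx hy h
    refine ⟨(Finset.Ico x (x + a) ×ˢ Finset.Ico y (y + a)).image
      fun p : ℕ × ℕ => p.1 ^ 2 + p.2 - 1, ?_, ?_⟩
    · rw [card_image_sq_add (fun i hi => by rw [Finset.mem_Ico] at hi; omega)
        (fun i hi d hd => by rw [Finset.mem_Ico] at hi hd; omega)]
      simp only [Nat.card_Ico, Nat.add_sub_cancel_left]
      exact_mod_cast hN2
    · intro k hk
      simp only [Finset.mem_image, Finset.mem_product, Finset.mem_Ico, Prod.exists] at hk
      obtain ⟨i, d, ⟨⟨h1, h2⟩, h3, h4⟩, rfl⟩ := hk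
      obtain ⟨h5, h6⟩ := h i d h1 h2 h3 h4
      have hi : 1 ≤ i ^ 2 := Nat.one_le_pow _ _ (by omega)
      refine ⟨h5, ?_⟩
      rw [show i ^ 2 + d - 1 + 4 * a + 1 = i ^ 2 + d + 4 * a by omega, h6,
        show i ^ 2 + d - 1 + 1 = i ^ 2 + d by omega, Nat.sqrt_add_eq' i (by omega)]
  interval_cases e
  -- Here d + 4a < 5a ≤ 2i, so adding 4a does not reach the next square.
  · refine key (3 * a) 0 (by omega) (by omega) fun i d h1 h2 h3 h4 => ?_
    have h5 : (i + 1) ^ 2 ≤ (4 * a) ^ 2 := Nat.pow_le_pow_left (by omega) 2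
    have h6 : (i + 1) ^ 2 = i ^ 2 + 2 * i + 1 := by ring
    refine ⟨by omega, ?_⟩
    rw [add_assoc, Nat.sqrt_add_eq' i (by omega)]
    rfl
  -- Here 6a ≤ d + 4a < 7a while 4a ≤ 2i < 6a, so adding 4a passes (i + 1) ^ 2 but does not reach (i
  -- + 2) ^ 2.
  · refine key (2 * a) (2 * a) (by omega) (by omega) fun i d h1 h2 h3 h4 => ?_
    have h5 : (i + 2) ^ 2 ≤ (4 * a) ^ 2 := Nat.pow_le_pow_left (by omega) 2
    have h6 : (i + 2) ^ 2 = i ^ 2 + 4 * i + 4 := by ring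
    refine ⟨by omega, ?_⟩
    have h7 : (i + 1) ^ 2 = i ^ 2 + 2 * i + 1 := by ring
    rw [show i ^ 2 + d + 4 * a = (i + 1) ^ 2 + (d + 4 * a - (2 * i + 1)) by omega,
      Nat.sqrt_add_eq' (i + 1) (by omega)]

namespace Construction

variable {S : Construction}

/-! ### Metric weak mixing -/

lemma exists_le_measureReal_matchSet (hS : S.IsLarge) {μ : Measure S.space}
    [IsProbabilityMeasure μ] (hμ : MeasurePreserving S.shift μ μ) (r : ℕ) :
    ∃ t, 1 / 100 ≤ μ.real (S.matchSet r t) ∧ 1 / 100 ≤ μ.real (S.matchSet r (t + 1)) := by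
  -- A core density above 64/100 and a proportion 1/64 of positions give 1/100.
  obtain ⟨J, hr, hJ⟩ := (((tendsto_len hS).eventually_ge_atTop (2 * r)).and
    ((tendsto_coreDensity hS r).eventually (lt_mem_nhds (show (64 : ℝ) / 100 < 1 by norm_num)))).exists
  have hc := card_pos_real hS (J + 1)
  have main : ∀ e ≤ 1, 1 / 100 ≤ μ.real (S.matchSet r
      (4 * (Nat.sqrt (S.card (J + 1)) / 4) * S.len (J + 1) + e)) := by
    intro e he
    obtain ⟨G, hG1, hG2⟩ := exists_many_positions
      (show 1000 ≤ S.card (J + 1) by have := large_card hS (J + 1); omega) e he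
    refine le_trans ?_ (le_measureReal_matchSet hS hμ hr hG2)
    have : (1 : ℝ) / 64 ≤ G.card / S.card (J + 1) := by
      rw [le_div_iff₀ (by linarith)]; linarith
    nlinarith
  exact ⟨_, main 0 (by norm_num), main 1 le_rfl⟩

lemma iterate_eigenfunction {μ : Measure S.space} (hμ : MeasurePreserving S.shift μ μ)
    {f : S.space → ℂ} {z : ℂ} (h : ∀ᵐ x ∂μ, f (S.shift x) = z * f x) (t : ℕ) :
    ∀ᵐ x ∂μ, f (S.shift^[t] x) = z ^ t * f x := by
  induction t with
  | zero => simp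
  | succ t ih =>
    filter_upwards [ih, (hμ.iterate t).quasiMeasurePreserving.ae h] with x h1 h2
    rw [Function.iterate_succ_apply', h2, h1, pow_succ]
    ring

/-- The zero set of an eigenfunction is carried into itself up to a null set, so ergodicity makes it
null or conull. -/
lemma eigenfunction_ne_zero (hS : S.IsLarge) {μ : Measure S.space} [IsProbabilityMeasure μ]
    (hμ : MeasurePreserving S.shift μ μ) {f : S.space → ℂ} {z : ℂ} (hf : Measurable f)
    (hf0 : ¬ f =ᵐ[μ] 0) (h : ∀ᵐ x ∂μ, f (S.shift x) = z * f x) : μ {x | f x = 0} = 0 := by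
  have hmeas : MeasurableSet {x | f x = 0} := hf (measurableSet_singleton 0)
  have hle : {x | f x = 0} ≤ᵐ[μ] S.shift ⁻¹' {x | f x = 0} := by
    filter_upwards [h] with x hx h0
    change f (S.shift x) = 0
    rw [hx, show f x = 0 from h0, mul_zero]
  rcases (ergodic hS hμ).ae_empty_or_univ_of_ae_le_preimage hmeas.nullMeasurableSet hle with h | h
  · exact ae_eq_empty.1 h
  · exact absurd (by filter_upwards [eventuallyEq_univ.1 h] with x hx using hx) hf0

lemma exists_norm_lt_small {μ : Measure S.space} [IsProbabilityMeasure μ] {f : S.space → ℂ}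
    (hf : Measurable f) (h : μ {x | f x = 0} = 0) {ε : ℝ≥0∞} (hε : 0 < ε) :
    ∃ η : ℝ, 0 < η ∧ μ {x | ‖f x‖ < η} ≤ ε := by
  have ht : Tendsto (fun n : ℕ => μ {x | ‖f x‖ < 1 / ((n : ℝ) + 1)}) atTop
      (𝓝 (μ (⋂ n : ℕ, {x | ‖f x‖ < 1 / ((n : ℝ) + 1)}))) := by
    refine tendsto_measure_iInter_atTop
      (fun n => (measurableSet_lt hf.norm measurable_const).nullMeasurableSet) ?_
      ⟨0, measure_ne_top _ _⟩
    intro m n hmn x hx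
    have hx' : ‖f x‖ < 1 / ((n : ℝ) + 1) := hx
    have hmn' : (m : ℝ) ≤ n := by exact_mod_cast hmn
    exact show ‖f x‖ < 1 / ((m : ℝ) + 1) from
      lt_of_lt_of_le hx' (one_div_le_one_div_of_le (by positivity) (by linarith))
  have he : (⋂ n : ℕ, {x | ‖f x‖ < 1 / ((n : ℝ) + 1)}) = {x | f x = 0} := by
    ext x
    simp only [mem_iInter, mem_ofPred_eq]
    constructor
    · intro hx
      by_contra h0
      obtain ⟨n, hn⟩ := exists_nat_one_div_lt (norm_pos_iff.2 h0)
      exact lt_asymm hn (hx n)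
    · intro hx n
      rw [hx, norm_zero]; positivity
  rw [he, h, ENNReal.tendsto_nhds_zero] at ht
  obtain ⟨n, hn⟩ := (ht ε hε).exists
  exact ⟨_, by positivity, hn⟩

/-- Up to small measure `f` takes values in finitely many small discs, and one radius `r` serves all
their preimages. If the matching set has measure 1/100, some point of it has |f| ≥ η and returns
after `t` steps to the same preimage; comparing the values of `f` there bounds z ^ t - 1. -/
lemma eigenvalue_pow_near_one (hS : S.IsLarge) {μ : Measure S.space} [IsProbabilityMeasure μ]
    (hμ : MeasurePreserving S.shift μ μ) {f : S.space → ℂ} {z : ℂ} (hf : Measurable f)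
    (hf0 : ¬ f =ᵐ[μ] 0) (h : ∀ᵐ x ∂μ, f (S.shift x) = z * f x) {δ : ℝ} (hδ : 0 < δ) :
    ∃ r, ∀ t, 1 / 100 ≤ μ.real (S.matchSet r t) → ‖z ^ t - 1‖ ≤ δ := by
  have hε : (0 : ℝ≥0∞) < ENNReal.ofReal (1 / 1000) := by simp
  set ε : ℝ≥0∞ := ENNReal.ofReal (1 / 1000) with hεdef
  obtain ⟨η, hη, hη2⟩ := exists_norm_lt_small hf (eigenfunction_ne_zero hS hμ hf hf0 h) hε
  let c := TopologicalSpace.denseSeq ℂ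
  let A : ℕ → Set S.space := fun i => f ⁻¹' Metric.ball (c i) (η * δ / 2)
  have hA : ∀ i, MeasurableSet (A i) := fun i => hf measurableSet_ball
  have hrad : 0 < η * δ / 2 := by positivity
  have hAu : ⋃ i, A i = univ := by
    rw [eq_univ_iff_forall]
    intro x
    obtain ⟨i, hi⟩ := (TopologicalSpace.denseRange_denseSeq ℂ).exists_dist_lt (f x) hrad
    exact mem_iUnion.2 ⟨i, hi⟩
  obtain ⟨q, hq⟩ : ∃ q : ℕ, μ (⋃ i ∈ Finset.range q, A i)ᶜ ≤ ε := by
    have ht : Tendsto (fun n : ℕ => μ (⋃ i ∈ Finset.range n, A i)ᶜ) atTop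
        (𝓝 (μ (⋂ n : ℕ, (⋃ i ∈ Finset.range n, A i)ᶜ))) := by
      refine tendsto_measure_iInter_atTop (fun n => ?_) ?_ ⟨0, measure_ne_top _ _⟩
      · exact (Finset.measurableSet_biUnion _ fun i _ => hA i).compl.nullMeasurableSet
      · intro m n hmn
        exact compl_subset_compl.2 (biUnion_subset_biUnion_left fun i hi => by
          simp only [Finset.mem_range, SetLike.mem_coe] at *; omega)
    have he : (⋂ n : ℕ, (⋃ i ∈ Finset.range n, A i)ᶜ) = ∅ := by
      rw [eq_empty_iff_forall_notMem]
      intro x hx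
      obtain ⟨i, hi⟩ := mem_iUnion.1 (hAu.symm ▸ mem_univ x : x ∈ ⋃ i, A i)
      exact mem_iInter.1 hx (i + 1) (mem_biUnion (by simp) hi)
    rw [he, measure_empty, ENNReal.tendsto_nhds_zero] at ht
    exact (ht ε hε).exists
  have hεq : 0 < ε / (q + 1) := ENNReal.div_pos hε.ne' (by finiteness)
  choose r hr using fun i => measure_matchSet_inter_le hμ (hA i) hεq
  refine ⟨(Finset.range q).sup r, fun t ht => ?_⟩
  set E := S.matchSet ((Finset.range q).sup r) t
  -- The bad points: small value of `f`, value outside the finitely many discs, change of preimage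
  -- despite matching, failure of the eigenvalue equation. Their measure is at most 3/1000 < 1/100.
  let B : Set S.space := {x | ‖f x‖ < η} ∪ (⋃ i ∈ Finset.range q, A i)ᶜ ∪
    (⋃ i ∈ Finset.range q, (E ∩ symmDiff (S.shift^[t] ⁻¹' A i) (A i))) ∪
    {x | ¬ f (S.shift^[t] x) = z ^ t * f x}
  have hB : μ B ≤ ε + ε + ε + 0 := by
    refine (measure_union_le _ _).trans (add_le_add ((measure_union_le _ _).trans
      (add_le_add ((measure_union_le _ _).trans (add_le_add hη2 hq)) ?_)) ?_)
    · refine (measure_biUnion_finset_le _ _).trans ?_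
      calc ∑ i ∈ Finset.range q, μ (E ∩ symmDiff (S.shift^[t] ⁻¹' A i) (A i))
          ≤ ∑ i ∈ Finset.range q, ε / (q + 1) := by
            refine Finset.sum_le_sum fun i hi => (measure_mono ?_).trans (hr i t)
            exact inter_subset_inter_left _ (matchSet_anti (Finset.le_sup hi) t)
        _ = q * (ε / (q + 1)) := by simp
        _ ≤ (q + 1) * (ε / (q + 1)) := by gcongr; exact le_self_add
        _ = ε := ENNReal.mul_div_cancel (by simp) (by finiteness)
    · exact (ae_iff.1 (iterate_eigenfunction hμ h t)).le
  obtain ⟨x, hxE, hxB⟩ : ∃ x ∈ E, x ∉ B := by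
    by_contra! hcon
    have h1 : μ E ≤ μ B := measure_mono hcon
    have h2 : ENNReal.ofReal (1 / 100) ≤ μ E := by
      rw [← ofReal_measureReal (μ := μ) (s := E)]
      exact ENNReal.ofReal_le_ofReal ht
    have h3 := h2.trans (h1.trans hB)
    rw [add_zero, hεdef, ← ENNReal.ofReal_add (by norm_num) (by norm_num),
      ← ENNReal.ofReal_add (by norm_num) (by norm_num),
      ENNReal.ofReal_le_ofReal_iff (by norm_num)] at h3
    norm_num at h3
  simp only [B, mem_union, not_or, mem_ofPred_eq, not_lt, not_not, mem_compl_iff] at hxB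
  obtain ⟨⟨⟨h1, h2⟩, h3⟩, h4⟩ := hxB
  obtain ⟨i, hi, hxi⟩ := mem_iUnion₂.1 h2
  have h5 : S.shift^[t] x ∈ A i := by
    by_contra h5
    exact h3 (mem_biUnion hi ⟨hxE, Or.inr ⟨hxi, h5⟩⟩)
  have h6 : ‖z ^ t * f x - f x‖ < η * δ := by
    rw [← h4, ← dist_eq_norm]
    calc dist (f (S.shift^[t] x)) (f x)
        ≤ dist (f (S.shift^[t] x)) (c i) + dist (f x) (c i) := dist_triangle_right _ _ _
      _ < η * δ / 2 + η * δ / 2 := add_lt_add h5 hxi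
      _ = η * δ := by ring
  rw [← sub_one_mul, norm_mul] at h6
  by_contra! h7
  have : δ * η ≤ ‖z ^ t - 1‖ * ‖f x‖ := mul_le_mul h7.le h1 hη.le (norm_nonneg _)
  linarith

lemma isMetricWeakMixing (hS : S.IsLarge) {μ : Measure S.space} [IsProbabilityMeasure μ]
    (hμ : MeasurePreserving S.shift μ μ) : IsMetricWeakMixing S.shift μ := by
  refine ⟨ergodic hS hμ, fun f z hf hf0 h => ?_⟩
  by_contra hz
  have hz0 : 0 < ‖z - 1‖ := norm_pos_iff.2 (sub_ne_zero.2 hz)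
  -- Both powers being within δ of 1 gives |z ^ t| ≥ 1/2 and |z ^ t| |z - 1| ≤ 2δ, hence |z - 1| ≤
  -- 4δ ≤ |z - 1| / 2, which is absurd.
  set δ := min (1 / 2) (‖z - 1‖ / 8) with hδ
  have hδ0 : 0 < δ := by positivity
  obtain ⟨r, hr⟩ := eigenvalue_pow_near_one hS hμ hf hf0 h hδ0
  obtain ⟨t, h1, h2⟩ := exists_le_measureReal_matchSet hS hμ r
  have h3 := hr _ h1
  have h4 := hr _ h2
  have h5 : δ ≤ 1 / 2 := min_le_left _ _
  have h6 : δ ≤ ‖z - 1‖ / 8 := min_le_right _ _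
  have h7 : 1 - δ ≤ ‖z ^ t‖ := by
    have := norm_sub_norm_le (1 : ℂ) (1 - z ^ t)
    rw [norm_one, sub_sub_cancel, norm_sub_rev] at this
    linarith
  have h8 : ‖z ^ t‖ * ‖z - 1‖ ≤ 2 * δ := by
    rw [← norm_mul, show z ^ t * (z - 1) = (z ^ (t + 1) - 1) - (z ^ t - 1) by ring]
    exact (norm_sub_le _ _).trans (by linarith)
  nlinarith

end Construction

/-! ### Permuted positions inside a window -/

lemma sqrt_add_le (a b : ℕ) : Nat.sqrt (a + b) ≤ Nat.sqrt a + Nat.sqrt b + 1 := by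
  have h1 := Nat.lt_succ_sqrt a
  have h2 := Nat.lt_succ_sqrt b
  have h3 : Nat.sqrt (a + b) < Nat.sqrt a + Nat.sqrt b + 2 := by
    rw [Nat.sqrt_lt]
    simp only [Nat.succ_eq_add_one] at h1 h2
    nlinarith [Nat.zero_le (Nat.sqrt a * Nat.sqrt b)]
  omega

/-- A map that factors through a finite type has a small image. -/
lemma ncard_image_le_of_factors {α β D : Type*} [Fintype D] {f : α → β} {g : α → D} {G : Set α}
    (h : ∀ x ∈ G, ∀ y ∈ G, g x = g y → f x = f y) :
    (f '' G).Finite ∧ (f '' G).ncard ≤ Fintype.card D := by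
  rcases G.eq_empty_or_nonempty with rfl | ⟨x₀, hx₀⟩
  · simp
  · classical
    let φ : D → β := fun d => if hd : ∃ x ∈ G, g x = d then f hd.choose else f x₀
    have hsub : f '' G ⊆ range φ := by
      rintro _ ⟨x, hx, rfl⟩
      have hd : ∃ y ∈ G, g y = g x := ⟨x, hx, rfl⟩
      refine ⟨g x, ?_⟩
      simp only [φ, dif_pos hd]
      exact h _ hd.choose_spec.1 _ hx hd.choose_spec.2
    have hfin : (range φ).Finite := finite_range φ
    refine ⟨hfin.subset hsub, (ncard_le_ncard hsub hfin).trans ?_⟩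
    rw [← image_univ]
    refine (ncard_image_le finite_univ).trans ?_
    rw [ncard_univ, Nat.card_eq_fintype_card]

/-- The first index whose word ends to the right of the position `o`. -/
noncomputable def firstIndex (l o : ℕ) : ℕ := sInf {k | o < pos l k + l}

lemma pos_add_le_of_lt_firstIndex {l o k : ℕ} (h : k < firstIndex l o) : pos l k + l ≤ o :=
  not_lt.1 fun h' => Nat.notMem_of_lt_sInf (s := {k | o < pos l k + l}) h h'

/-- The indices of the words met by a window of length `n` differ by at most n / l + 1, and
`sqrt_add_le` bounds the increase of the root. The bound is the number of permuted words that have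
to be recorded. -/
lemma sqrt_sub_sqrt_firstIndex_le {l o n k : ℕ} (hl : 0 < l) (hk : pos l k < o + n)
    (hk0 : firstIndex l o ≤ k) :
    Nat.sqrt (k + 1) - Nat.sqrt (firstIndex l o + 1) < Nat.sqrt (n / l) + 3 := by
  set k₀ := firstIndex l o with hk0def
  have h1 : (k - k₀) * l < n + l := by
    have h2 : o < pos l k₀ + l := by
      apply Nat.sInf_mem (s := {k | o < pos l k + l})
      refine ⟨o, ?_⟩
      have : o ≤ o * l := Nat.le_mul_of_pos_right _ hl
      change o < pos l o + l
      unfold pos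
      omega
    have h3 : pos l k₀ + (k - k₀) * l ≤ pos l k := by
      have h4 : Nat.sqrt (k₀ + 1) ≤ Nat.sqrt (k + 1) := Nat.sqrt_le_sqrt (by omega)
      have h5 : k₀ * l + (k - k₀) * l = k * l := by
        rw [← Nat.add_mul]; congr 1; omega
      unfold pos
      omega
    omega
  have h2 : k - k₀ ≤ n / l + 1 := by
    rw [← Nat.add_div_right n hl, Nat.le_div_iff_mul_le hl]
    exact h1.le
  have h3 : Nat.sqrt (k + 1) ≤ Nat.sqrt (k₀ + 1) + Nat.sqrt (n / l + 1) + 1 :=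
    (Nat.sqrt_le_sqrt (by omega)).trans (sqrt_add_le _ _)
  have h4 : Nat.sqrt (n / l + 1) ≤ Nat.sqrt (n / l) + 1 := Nat.sqrt_succ_le_succ_sqrt _
  omega

namespace Construction

variable {S : Construction}

/-! ### Complexity -/

/-- The word `x_0 ⋯ x_{n-1}`. -/
def wordOf (n : ℕ) (x : S.space) : Fin n → Letter := fun i => x.1 (i : ℕ)

/-- The number of words of length `n`. -/
noncomputable def complexity (S : Construction) (n : ℕ) : ℕ := (range (S.wordOf n)).ncard

lemma complexity_pos (hS : S.IsLarge) (n : ℕ) : 0 < S.complexity n := by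
  obtain ⟨x⟩ := exists_point hS
  exact (ncard_pos (toFinite _)).2 ⟨_, x, rfl⟩

/-- The words at the `Q` permuted positions from the square of `c` on. -/
noncomputable def permutedWords (S : Construction) {J : ℕ} (K : Fin (S.card (J + 1))) (c Q : ℕ) :
    Fin Q → Fin (S.card J + 1) :=
  -- The additional value `Fin.last` stands for square positions beyond the last word.
  fun i => if h : (c + i) ^ 2 - 1 < S.card J then (S.perm J K ⟨_, h⟩).castSucc else Fin.last _

/-- Two words of stage `J + 1` can differ only at permuted positions, and the permuted words met by
the window are among those recorded by `permutedWords`. -/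
lemma letter_eq_of_permutedWords_eq (hS : S.IsLarge) {J : ℕ} {K K' : Fin (S.card (J + 1))}
    {o n i : ℕ} (h : S.permutedWords K (Nat.sqrt (firstIndex (S.len J) o + 1))
        (Nat.sqrt (n / S.len J) + 3) =
      S.permutedWords K' (Nat.sqrt (firstIndex (S.len J) o + 1)) (Nat.sqrt (n / S.len J) + 3))
    (h1 : o ≤ i) (h2 : i < o + n) (h3 : i < S.len (J + 1)) :
    S.letter (J + 1) K i = S.letter (J + 1) K' i := by
  obtain ⟨k, hk, h4⟩ := exists_index_of_lt_concatLength (l := S.len J) (N := S.card J) h3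
  rcases h4 with ⟨h4, h5⟩ | ⟨h4, h5⟩
  · have hperm : S.perm J K ⟨k, hk⟩ = S.perm J K' ⟨k, hk⟩ := by
      by_cases hp : IsPermuted k
      · obtain ⟨m, hm⟩ := hp.1
        have hk0 : firstIndex (S.len J) o ≤ k := by
          by_contra hlt
          have := pos_add_le_of_lt_firstIndex (not_le.1 hlt)
          omega
        have hlt := sqrt_sub_sqrt_firstIndex_le (n := n) (by have := len_pos hS J; omega)
          (show pos (S.len J) k < o + n by omega) hk0
        have hle : Nat.sqrt (firstIndex (S.len J) o + 1) ≤ Nat.sqrt (k + 1) :=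
          Nat.sqrt_le_sqrt (by omega)
        have hsq : Nat.sqrt (k + 1) = m := by rw [hm, Nat.sqrt_eq]
        have := congrFun h ⟨_, hlt⟩
        unfold permutedWords at this
        have e : (Nat.sqrt (firstIndex (S.len J) o + 1) +
            (Nat.sqrt (k + 1) - Nat.sqrt (firstIndex (S.len J) o + 1))) ^ 2 - 1 = k := by
          rw [Nat.add_sub_cancel' hle, hsq, sq]; omega
        simp only [e, hk, dif_pos, Fin.castSucc_inj] at this
        exact this
      · rw [S.perm_apply _ hp, S.perm_apply _ hp]
    obtain ⟨i', rfl⟩ := Nat.exists_eq_add_of_le h4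
    have hi' : i' < S.len J := by omega
    have e1 := S.letter_succ J K ⟨k, hk⟩ hi'
    have e2 := S.letter_succ J K' ⟨k, hk⟩ hi'
    rw [hperm, ← e2] at e1
    exact e1
  · have e1 := S.letter_succ_spacer J K ⟨k, hk⟩ h4
    have e2 := S.letter_succ_spacer J K' ⟨k, hk⟩ h4
    rw [← e2] at e1
    simpa [← h5] using e1

/-- The window [0, n) meets at most two successive words of stage `J + 1`. It is determined by the
offset in the first, by whether a spacer separates them, and by the permuted subwords visible in
each. -/
lemma complexity_le (hS : S.IsLarge) {J n : ℕ} (hn : n ≤ S.len (J + 1)) :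
    S.complexity n ≤ (S.len (J + 1) + 1) * (2 * ((S.card J + 1) ^ (Nat.sqrt (n / S.len J) + 3) *
      (S.card J + 1) ^ (Nat.sqrt (n / S.len J) + 3))) := by
  set Q := Nat.sqrt (n / S.len J) + 3
  choose s s' hs hs' hcase hk hk' using fun x : S.space => exists_two_words hS x.2 (J + 1) 0
  choose K hK using hk
  choose K' hK' using hk'
  have hos : ∀ x, (-s x).toNat < S.len (J + 1) + 1 := by
    intro x
    have h1 := hs x
    have h2 := hs' x
    have h3 := hcase x
    omega
  classical
  let g : S.space → Fin (S.len (J + 1) + 1) × Bool × (Fin Q → Fin (S.card J + 1)) ×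
      (Fin Q → Fin (S.card J + 1)) := fun x =>
    (⟨(-s x).toNat, hos x⟩, decide (s' x = s x + S.len (J + 1)),
      S.permutedWords (K x) (Nat.sqrt (firstIndex (S.len J) (-s x).toNat + 1)) Q,
      S.permutedWords (K' x) (Nat.sqrt (firstIndex (S.len J) 0 + 1)) Q)
  have h := (ncard_image_le_of_factors (f := S.wordOf n) (g := g) (G := univ) ?_).2
  · rw [image_univ] at h
    refine h.trans (le_of_eq ?_)
    simp
  · rintro x - y - hxy
    simp only [g, Prod.mk.injEq, Fin.mk.injEq, decide_eq_decide] at hxy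
    obtain ⟨h1, h2, h3, h4⟩ := hxy
    have hsx := hs x
    have hsy := hs y
    have es : s x = s y := by omega
    have es' : s' x = s' y := by
      rcases hcase x with hx | ⟨-, hx⟩ <;> rcases hcase y with hy | ⟨-, hy⟩ <;> omega
    rw [← h1] at h3
    funext i
    unfold wordOf
    have hi := i.2
    by_cases hlt : (i : ℤ) < s x + S.len (J + 1)
    · obtain ⟨q, hq⟩ := Int.eq_ofNat_of_zero_le (show 0 ≤ (i : ℤ) - s x by omega)
      have e1 := hK x q (by omega)
      have e2 := hK y q (by omega)
      rw [letter_eq_of_permutedWords_eq hS h3 (i := q) (by omega) (by omega) (by omega), ← e2] at e1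
      rw [show ((i : ℕ) : ℤ) = s x + q by omega, e1, es]
    · by_cases hlt' : (i : ℤ) < s' x
      · have hx : x.1 (s x + S.len (J + 1)) = spacer := by
          rcases hcase x with hx | ⟨hx, -⟩
          · omega
          · exact hx
        have hy : y.1 (s y + S.len (J + 1)) = spacer := by
          rcases hcase y with hy | ⟨hy, -⟩
          · omega
          · exact hy
        have : ((i : ℕ) : ℤ) = s x + S.len (J + 1) := by
          rcases hcase x with hx | ⟨-, hx⟩ <;> omega
        rw [this, hx, es, hy]
      · have := hs' x
        obtain ⟨q, hq⟩ := Int.eq_ofNat_of_zero_le (show 0 ≤ (i : ℤ) - s' x by omega)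
        have e1 := hK' x q (by omega)
        have e2 := hK' y q (by omega)
        rw [letter_eq_of_permutedWords_eq hS h4 (i := q) (by omega) (by omega) (by omega),
          ← e2] at e1
        rw [show ((i : ℕ) : ℤ) = s' x + q by omega, e1, es']

lemma exists_len_le_lt (hS : S.IsLarge) {u : ℕ → ℕ} {n : ℕ}
    (hn : u (S.len 0) ≤ n) (hlt : ∀ m, m ≤ u m) : ∃ J, u (S.len J) ≤ n ∧ n < u (S.len (J + 1)) := by
  classical
  have hex : ∃ J, n < u (S.len J) := by
    refine ⟨n, ?_⟩
    have := le_len hS n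
    have := hlt (S.len n)
    omega
  have h0 : Nat.find hex ≠ 0 := by
    intro h
    have := Nat.find_spec hex
    rw [h] at this
    omega
  refine ⟨Nat.find hex - 1, ?_, ?_⟩
  · exact not_lt.1 (Nat.find_min hex (by omega))
  · rw [Nat.sub_add_cancel (by omega)]
    exact Nat.find_spec hex

/-- For l ≤ n with `n` below the next length, each of the two words costs about (√(n / l) + 3) log
N, and log N ≤ √l turns this into O(√n). -/
lemma log_complexity_le (hS : S.IsLarge) {n : ℕ} (hn : S.len 0 ≤ n) :
    Real.log (S.complexity n) ≤ 30 * √n := by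
  obtain ⟨J, h1, h2⟩ := exists_len_le_lt hS (u := fun l => l) hn (fun m => le_rfl)
  have hp : (0 : ℝ) < S.complexity n := by exact_mod_cast complexity_pos hS n
  have hl := one_le_len_real hS J
  have hc := card_pos_real hS J
  have hln : (S.len J : ℝ) ≤ n := by exact_mod_cast h1
  have hcl : 1 ≤ √(n : ℝ) := Real.one_le_sqrt.2 (by linarith)
  set Q := Nat.sqrt (n / S.len J) + 3 with hQ
  set a := S.logCard J with ha
  have ha0 : 60 ≤ a := sixty_le_logCard hS J
  have hal : a ≤ √(S.len J) := logCard_le_sqrt_len hS J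
  have hsn : √(S.len J : ℝ) ≤ √n := Real.sqrt_le_sqrt hln
  have hQr : (Q : ℝ) ≤ √n / √(S.len J) + 3 := by
    rw [hQ, ← Real.sqrt_div (by positivity)]
    push_cast
    have h3 : (Nat.sqrt (n / S.len J) : ℝ) ≤ √((n / S.len J : ℕ) : ℝ) := Real.nat_sqrt_le_real_sqrt
    have h4 : √((n / S.len J : ℕ) : ℝ) ≤ √((n : ℝ) / S.len J) := Real.sqrt_le_sqrt Nat.cast_div_le
    linarith
  have hQa : Q * a ≤ 4 * √n := by
    calc Q * a ≤ (√n / √(S.len J) + 3) * √(S.len J) := by gcongr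
      _ = √n + 3 * √(S.len J) := by
        have : √(S.len J : ℝ) ≠ 0 := by positivity
        field_simp
      _ ≤ _ := by linarith
  have hb1 : Real.log (S.card J + 1) ≤ 2 * a := by
    have h3 : Real.log ((S.card J : ℝ) + 1) ≤ Real.log ((S.card J : ℝ) ^ 2) :=
      Real.log_le_log (by linarith) (by nlinarith)
    rw [Real.log_pow] at h3
    exact_mod_cast h3
  have hb2 : Real.log (S.len (J + 1) + 1) ≤ 4 * √n := by
    have h3 : (S.len (J + 1) : ℝ) + 1 ≤ S.card J * (S.len J + 1) := by
      exact_mod_cast len_succ_add_one_le hS J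
    have h4 : Real.log (S.len (J + 1) + 1) ≤ Real.log (S.card J * (S.len J + 1)) :=
      Real.log_le_log (by positivity) h3
    rw [Real.log_mul (by linarith) (by linarith)] at h4
    have h5 : Real.log (S.len J + 1) ≤ 2 * √n := by
      have h6 := Real.log_le_sub_one_of_pos (show 0 < √((S.len J : ℝ) + 1) by positivity)
      rw [Real.log_sqrt (by positivity)] at h6
      have h7 : √((S.len J : ℝ) + 1) ≤ √(S.len J) + 1 := by
        rw [Real.sqrt_le_left (by positivity), add_sq, Real.sq_sqrt (by positivity)]
        have : 0 ≤ √(S.len J : ℝ) := by positivity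
        linarith
      linarith
    change _ ≤ a + _ at h4
    linarith
  have hb : (S.complexity n : ℝ) ≤ (S.len (J + 1) + 1) * (2 * ((S.card J + 1) ^ Q *
      (S.card J + 1) ^ Q)) := by exact_mod_cast complexity_le hS h2.le
  have h8 := Real.log_le_log hp hb
  rw [Real.log_mul (by positivity) (by positivity), Real.log_mul (by positivity) (by positivity),
    Real.log_mul (by positivity) (by positivity), Real.log_pow] at h8
  have h9 := Real.log_two_lt_d9
  have h10 : Q * Real.log (S.card J + 1) ≤ Q * (2 * a) := by gcongr
  linarith

/-- Any injection of the permuted positions below `M` into all permuted positions extends to a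
permutation, hence is displayed at the beginning of some word of stage `J + 1`; different injections
give different prefixes. -/
lemma descFactorial_le_complexity (hS : S.IsLarge) {J n M : ℕ} (hM : M ≤ S.card J)
    (hn : M * (S.len J + 1) ≤ n) :
    (Nat.sqrt (S.card J) - 1).descFactorial (Nat.sqrt M - 1) ≤ S.complexity n := by
  classical
  let α := {k : Fin (S.card J) // IsPermuted k}
  let p : α → Prop := fun k => (k.1 : ℕ) < M
  have hα : Fintype.card α = Nat.sqrt (S.card J) - 1 := by
    rw [← card_isPermuted _ _ le_rfl]
    exact Fintype.card_congr (Equiv.subtypeEquivRight fun k => by simp)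
  have hp : Fintype.card {a : α // p a} = Nat.sqrt M - 1 := by
    rw [← card_isPermuted _ _ hM]
    exact Fintype.card_congr (Equiv.subtypeSubtypeEquivSubtypeInter
      (fun k : Fin (S.card J) => IsPermuted k) (fun k => (k : ℕ) < M))
  have key : ∀ e : {a : α // p a} ↪ α, ∃ x : S.space, ∀ a : {a : α // p a},
      S.At x.1 J (e a).1 (pos (S.len J) a.1.1) := by
    intro e
    let σ : Equiv.Perm α := (Equiv.ofInjective e e.injective).extendSubtype
    let π := (Equiv.Perm.subtypeEquivSubtypePerm (fun k : Fin (S.card J) => IsPermuted k)) σ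
    obtain ⟨K, hK⟩ := S.exists_perm_eq J π.1 (fun k hk => π.2 k hk)
    obtain ⟨x, hx⟩ := exists_at_zero hS (J + 1) K
    refine ⟨x, fun a => ?_⟩
    have h1 := hx.child a.1.1
    have h2 : S.perm J K a.1.1 = (e a).1 := by
      rw [hK]
      refine (Equiv.Perm.subtypeEquivSubtypePerm_apply_of_mem
        (p := fun k : Fin (S.card J) => IsPermuted k) σ a.1.2).trans ?_
      exact congrArg Subtype.val
        (Equiv.extendSubtype_apply_of_mem (Equiv.ofInjective e e.injective) a.1 a.2)
    rwa [h2, zero_add] at h1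
  choose x hx using key
  have hinj : Function.Injective fun e => S.wordOf n (x e) := by
    intro e e' h
    ext1 a
    apply Subtype.ext
    apply S.eq_of_letter_eq
    intro i hi
    have hlt : pos (S.len J) a.1.1 + i < n := by
      have h1 := pos_add_le_concatLength (S.len J) a.2
      have h2 : concatLength (S.len J) M ≤ M * (S.len J + 1) := by
        unfold concatLength
        have := Nat.sqrt_le_self M
        rw [Nat.mul_add]
        omega
      omega
    have h1 := congrFun h ⟨_, hlt⟩
    have h2 := hx e a i hi
    have h3 := hx e' a i hi
    unfold wordOf at h1
    simp only at h1
    push_cast at h1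
    rw [← h2, ← h3, h1]
  have hcard : Fintype.card ({a : α // p a} ↪ α) =
      (Nat.sqrt (S.card J) - 1).descFactorial (Nat.sqrt M - 1) := by
    rw [Fintype.card_embedding_eq, hα, hp]
  rw [← hcard, ← Nat.card_eq_fintype_card, ← ncard_univ, ← ncard_image_of_injective _ hinj]
  refine ncard_le_ncard ?_ (toFinite _)
  rintro _ ⟨e, -, rfl⟩
  exact mem_range_self _

/-- `M` is the number of whole words in the window, capped at N / 4: then the √M - 1 factors of the
falling factorial are still comparable to √N, so each has logarithm at least log N / 4. The cap
costs only a constant as `n` is at most about the next length. -/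
lemma le_log_complexity (hS : S.IsLarge) {J n : ℕ} (h1 : 16 * (S.len J + 1) ≤ n)
    (h2 : n < 16 * (S.len (J + 1) + 1)) :
    √n / 32 ^ (J + 1) / 256 ≤ Real.log (S.complexity n) := by
  have hl := one_le_len_real hS J
  have hc := card_pos_real hS J
  have hcn := large_card hS J
  have hln := len_pos hS J
  set M := min (n / (S.len J + 1)) (S.card J / 4) with hM
  have hM16 : 16 ≤ M := by
    rw [hM, le_min_iff]
    exact ⟨(Nat.le_div_iff_mul_le (by omega)).2 h1, by omega⟩
  have hMc : 4 * M ≤ S.card J := by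
    have := min_le_right (n / (S.len J + 1)) (S.card J / 4)
    omega
  have hMn : n ≤ 256 * S.len J * M := by
    rcases min_choice (n / (S.len J + 1)) (S.card J / 4) with h | h
    · rw [← hM] at h
      have h3 := Nat.lt_div_mul_add (a := n) (show 0 < S.len J + 1 by omega)
      rw [← h] at h3
      nlinarith
    · rw [← hM] at h
      have h3 := len_succ_add_one_le hS J
      have h4 : S.card J ≤ 8 * M := by omega
      have h5 : S.card J * (S.len J + 1) ≤ 8 * M * (2 * S.len J) :=
        Nat.mul_le_mul h4 (by omega)
      have h6 : 8 * M * (2 * S.len J) = 16 * (S.len J * M) := by ring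
      have h7 : 256 * S.len J * M = 256 * (S.len J * M) := by ring
      omega
  have hsM : 4 ≤ Nat.sqrt M := by rw [Nat.le_sqrt]; omega
  have hsN : 2 * Nat.sqrt M ≤ Nat.sqrt (S.card J) := by
    rw [Nat.le_sqrt]
    have := Nat.sqrt_le M
    nlinarith
  have hd := descFactorial_le_complexity hS (n := n) (show M ≤ S.card J by omega) (by
    have h3 := min_le_left (n / (S.len J + 1)) (S.card J / 4)
    rw [← hM] at h3
    exact (Nat.mul_le_mul_right _ h3).trans (Nat.div_mul_le_self _ _))
  set q := Nat.sqrt M - 1 with hq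
  set R := Nat.sqrt (S.card J) - 1 with hR
  have hpow : (R + 1 - q) ^ q ≤ S.complexity n := (Nat.pow_sub_le_descFactorial R q).trans hd
  have hlog : q * Real.log ((R + 1 - q : ℕ) : ℝ) ≤ Real.log (S.complexity n) := by
    rw [← Real.log_pow]
    apply Real.log_le_log
    · have : 0 < R + 1 - q := by omega
      positivity
    · exact_mod_cast hpow
  have ha := sixty_le_logCard hS J
  have hbase : S.logCard J / 4 ≤ Real.log ((R + 1 - q : ℕ) : ℝ) := by
    have h3 : √(S.card J : ℝ) ≤ 4 * ((R + 1 - q : ℕ) : ℝ) := by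
      have h4 : √(S.card J : ℝ) < Nat.sqrt (S.card J) + 1 := Real.real_sqrt_lt_nat_sqrt_succ
      have h5 : Nat.sqrt (S.card J) + 1 ≤ 4 * (R + 1 - q) := by omega
      have h6 : ((Nat.sqrt (S.card J) : ℝ) + 1) ≤ 4 * ((R + 1 - q : ℕ) : ℝ) := by exact_mod_cast h5
      linarith
    have h7 : Real.log (√(S.card J : ℝ) / 4) ≤ Real.log ((R + 1 - q : ℕ) : ℝ) :=
      Real.log_le_log (by positivity) (by linarith)
    rw [Real.log_div (by positivity) (by norm_num), Real.log_sqrt (by linarith)] at h7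
    have h8 : Real.log 4 ≤ 4 := by
      have := Real.log_le_sub_one_of_pos (show (0 : ℝ) < 4 by norm_num); linarith
    change S.logCard J / 2 - Real.log 4 ≤ _ at h7
    linarith
  have hqM : √(M : ℝ) ≤ 4 * q := by
    have h4 : √(M : ℝ) < Nat.sqrt M + 1 := Real.real_sqrt_lt_nat_sqrt_succ
    have h5 : Nat.sqrt M + 1 ≤ 4 * q := by omega
    have h6 : ((Nat.sqrt M : ℝ) + 1) ≤ 4 * q := by exact_mod_cast h5
    linarith
  have hsq : √(n : ℝ) ≤ 16 * √(S.len J) * √M := by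
    have h3 : (n : ℝ) ≤ 16 ^ 2 * (S.len J * M) := by
      have : (n : ℝ) ≤ 256 * S.len J * M := by exact_mod_cast hMn
      linarith
    calc √(n : ℝ) ≤ √(16 ^ 2 * (S.len J * M)) := Real.sqrt_le_sqrt h3
      _ = 16 * √(S.len J) * √M := by
        rw [Real.sqrt_mul (by positivity), Real.sqrt_sq (by norm_num),
          Real.sqrt_mul (by positivity), mul_assoc]
  have h32 := sqrt_len_le_mul_logCard hS J
  have h9 : (q : ℝ) * (S.logCard J / 4) ≤ Real.log (S.complexity n) :=
    (mul_le_mul_of_nonneg_left hbase (by positivity)).trans hlog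
  rw [div_div, div_le_iff₀ (by positivity)]
  calc √(n : ℝ) ≤ 16 * √(S.len J) * √M := hsq
    _ ≤ 16 * (32 ^ (J + 1) * S.logCard J) * (4 * q) := by gcongr
    _ = q * (S.logCard J / 4) * (32 ^ (J + 1) * 256) := by ring
    _ ≤ _ := by gcongr

lemma eventually_rpow_le_log_complexity (hS : S.IsLarge) {α : ℝ} (hα : α < 1 / 2) :
    ∀ᶠ n : ℕ in atTop, (n : ℝ) ^ α ≤ Real.log (S.complexity n) := by
  -- One factor n ^ ε absorbs 32 ^ (J + 1), another absorbs 256, and α + 2ε = 1/2.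
  set ε := (1 / 2 - α) / 2 with hε
  have hε0 : 0 < ε := by rw [hε]; linarith
  obtain ⟨J₀, hJ₀⟩ := eventually_atTop.1 (eventually_pow_le_len_rpow hS hε0)
  have h256 : ∀ᶠ n : ℕ in atTop, (256 : ℝ) ≤ (n : ℝ) ^ ε :=
    ((tendsto_rpow_atTop hε0).comp tendsto_natCast_atTop_atTop).eventually_ge_atTop 256
  filter_upwards [h256, eventually_ge_atTop (16 * (S.len J₀ + 1))] with n h1 h2
  have h00 : S.len 0 ≤ S.len J₀ := (len_strictMono hS).monotone (Nat.zero_le _)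
  obtain ⟨J, h3, h4⟩ := exists_len_le_lt hS (u := fun l => 16 * (l + 1)) (n := n) (by omega)
    (fun m => by omega)
  have hJ : J₀ ≤ J := by
    by_contra hlt
    have := (len_strictMono hS).monotone (show J + 1 ≤ J₀ by omega)
    omega
  have h5 := hJ₀ J hJ
  have hl := one_le_len_real hS J
  have hnl : (S.len J : ℝ) ≤ n := by
    have : S.len J ≤ n := by omega
    exact_mod_cast this
  have hn0 : (0 : ℝ) < n := by linarith
  have h6 : (32 : ℝ) ^ (J + 1) ≤ (n : ℝ) ^ ε :=
    h5.trans (Real.rpow_le_rpow (by linarith) hnl hε0.le)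
  refine le_trans ?_ (le_log_complexity hS h3 h4)
  rw [div_div, le_div_iff₀ (by positivity)]
  calc (n : ℝ) ^ α * (32 ^ (J + 1) * 256) ≤ (n : ℝ) ^ α * ((n : ℝ) ^ ε * (n : ℝ) ^ ε) := by gcongr
    _ = √n := by
      rw [← Real.rpow_add hn0, ← Real.rpow_add hn0, Real.sqrt_eq_rpow]
      congr 1; rw [hε]; ring

/-! ### Entropy dimension -/

/-- The Lebesgue number of the cover, expressed by windows. -/
lemma exists_uniform_window {𝒰 : Set (Set S.space)} (h : IsFiniteOpenCover 𝒰) :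
    ∃ r : ℕ, ∀ x : S.space, ∃ A ∈ 𝒰, ∀ y : S.space, (∀ i : ℤ, |i| ≤ r → y.1 i = x.1 i) → y ∈ A := by
  have hx : ∀ x : S.space, ∃ A ∈ 𝒰, ∃ r : ℕ, ∀ y : S.space,
      (∀ i : ℤ, |i| ≤ r → y.1 i = x.1 i) → y ∈ A := by
    intro x
    obtain ⟨A, hA, hxA⟩ := mem_sUnion.1 (h.2.2.symm ▸ mem_univ x : x ∈ ⋃₀ 𝒰)
    obtain ⟨r, hr⟩ := exists_window_subset (h.2.1 A hA) hxA
    exact ⟨A, hA, r, hr⟩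
  choose A hA r hr using hx
  let W : S.space → Set S.space := fun x => {y | ∀ i : ℤ, |i| ≤ r x → y.1 i = x.1 i}
  have hW : ∀ x, IsOpen (W x) := fun x =>
    (show S.IsLocal (r x) (W x) from fun y z hyz hy i hi =>
      (hyz i hi).symm.trans (hy i hi)).isClopen.isOpen
  obtain ⟨t, ht⟩ := isCompact_univ.elim_nhds_subcover W
    (fun x _ => (hW x).mem_nhds fun i _ => rfl)
  refine ⟨t.sup r, fun x => ?_⟩
  obtain ⟨z, hz, hxz⟩ := mem_iUnion₂.1 (ht.2 (mem_univ x))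
  refine ⟨A z, hA z, fun y hy => hr z y fun i hi => ?_⟩
  have : (r z : ℤ) ≤ (t.sup r : ℕ) := by exact_mod_cast Finset.le_sup hz
  rw [hy i (hi.trans this), hxz i hi]

/-- The coordinates in [-r, n + r] determine an element of the join containing the point, so one
element for each word of length n + 2r + 1 suffices. -/
lemma exists_subcover (𝒰 : Set (Set S.space)) (h : IsFiniteOpenCover 𝒰) : ∃ r : ℕ, ∀ n,
    ∃ V : Finset (Set S.space), (V : Set (Set S.space)) ⊆ iterJoin S.shift 𝒰 n ∧
      ⋃₀ (V : Set (Set S.space)) = univ ∧ V.card ≤ S.complexity (n + (2 * r + 1)) := by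
  classical
  obtain ⟨r, hr⟩ := exists_uniform_window h
  choose A hA hAr using hr
  refine ⟨r, fun n => ?_⟩
  have hfin : (range (S.wordOf (n + (2 * r + 1)))).Finite := toFinite _
  have hrep : ∀ w : range (S.wordOf (n + (2 * r + 1))), ∃ x, S.wordOf _ x = w.1 := fun w => w.2
  choose ρ hρ using hrep
  let B : S.space → Set S.space := fun x =>
    ⋂ i : Fin n, S.shift^[i] ⁻¹' A (S.shift^[i] (S.shiftBy r x))
  let V : Finset (Set S.space) := Finset.univ.image fun w => B (ρ w)
  refine ⟨V, ?_, ?_, ?_⟩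
  · intro C hC
    obtain ⟨w, -, rfl⟩ := Finset.mem_image.1 (Finset.mem_coe.1 hC)
    exact ⟨_, fun i => hA _, rfl⟩
  · rw [eq_univ_iff_forall]
    intro y
    let w : range (S.wordOf (n + (2 * r + 1))) := ⟨_, S.shiftBy (-r) y, rfl⟩
    refine mem_sUnion.2 ⟨B (ρ w), Finset.mem_coe.2 (Finset.mem_image_of_mem _ (Finset.mem_univ w)),
      ?_⟩
    refine mem_iInter.2 fun i => hAr _ _ fun a ha => ?_
    rw [abs_le] at ha
    obtain ⟨q, hq⟩ := Int.eq_ofNat_of_zero_le (show 0 ≤ a + r by omega)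
    have hi := i.2
    have := congrFun (hρ w) ⟨q + i, by omega⟩
    simp only [w, wordOf, shiftBy_apply] at this
    rw [iterate_shift_apply, iterate_shift_apply, shiftBy_apply,
      show a + (i : ℕ) + (r : ℤ) = ((q + i : ℕ) : ℤ) by push_cast; omega, this]
    exact congrArg y.1 (by push_cast; omega)
  · refine Finset.card_image_le.trans ?_
    rw [Finset.card_univ, ← Nat.card_eq_fintype_card]
    exact le_of_eq rfl

lemma minSubcoverCard_le {X : Type*} {𝒰 : Set (Set X)} (V : Finset (Set X))
    (h : (V : Set (Set X)) ⊆ 𝒰) (h' : ⋃₀ (V : Set (Set X)) = univ) :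
    minSubcoverCard 𝒰 ≤ V.card :=
  Nat.sInf_le (s := {k | ∃ V : Finset (Set X), (V : Set (Set X)) ⊆ 𝒰 ∧
    ⋃₀ (V : Set (Set X)) = univ ∧ V.card = k}) ⟨V, h, h', rfl⟩

lemma exists_minSubcoverCard_le (𝒰 : Set (Set S.space)) (h : IsFiniteOpenCover 𝒰) :
    ∃ r : ℕ, ∀ n, minSubcoverCard (iterJoin S.shift 𝒰 n) ≤ S.complexity (n + (2 * r + 1)) := by
  obtain ⟨r, hr⟩ := exists_subcover 𝒰 h
  refine ⟨r, fun n => ?_⟩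
  obtain ⟨V, h1, h2, h3⟩ := hr n
  exact (minSubcoverCard_le V h1 h2).trans h3

/-- The cover by the cylinders of length one. -/
def letterCover (S : Construction) : Set (Set S.space) :=
  range fun a : Letter => {x : S.space | x.1 0 = a}

lemma isFiniteOpenCover_letterCover : IsFiniteOpenCover S.letterCover := by
  refine ⟨finite_range _, ?_, ?_⟩
  · rintro _ ⟨a, rfl⟩
    exact (isOpen_discrete {a}).preimage (continuous_coord 0)
  · rw [eq_univ_iff_forall]
    intro x
    exact mem_sUnion.2 ⟨_, ⟨x.1 0, rfl⟩, rfl⟩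

/-- All points of one element of the join of the letter cover have the same prefix of length `n`, so
a subcover has at least as many elements as there are prefixes. -/
lemma complexity_le_minSubcoverCard (n : ℕ) :
    S.complexity n ≤ minSubcoverCard (iterJoin S.shift S.letterCover n) := by
  classical
  obtain ⟨r, hr⟩ := exists_subcover _ (isFiniteOpenCover_letterCover (S := S))
  obtain ⟨V₀, h1, h2, -⟩ := hr n
  -- The subcover `V₀` makes the set of cardinalities non-empty; otherwise its infimum would be the
  -- default value 0.
  obtain ⟨V, hV1, hV2, hV3⟩ := Nat.sInf_mem (s := {k | ∃ V : Finset (Set S.space),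
    (V : Set (Set S.space)) ⊆ iterJoin S.shift S.letterCover n ∧
      ⋃₀ (V : Set (Set S.space)) = univ ∧ V.card = k}) ⟨_, V₀, h1, h2, rfl⟩
  unfold minSubcoverCard
  rw [← hV3]
  have hword : ∀ A ∈ V, ∃ w, ∀ x ∈ A, S.wordOf n x = w := by
    intro A hA
    obtain ⟨f, hf, rfl⟩ := hV1 hA
    choose a ha using hf
    refine ⟨a, fun x hx => funext fun i => ?_⟩
    have := mem_iInter.1 hx i
    rw [← ha i] at this
    have h3 : (S.shift^[i] x).1 0 = a i := this
    rw [iterate_shift_apply, zero_add] at h3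
    exact h3
  choose! w hw using hword
  have hsub : range (S.wordOf n) ⊆ (V.image w : Finset _) := by
    rintro _ ⟨x, rfl⟩
    obtain ⟨A, hA, hx⟩ := mem_sUnion.1 (hV2.symm ▸ mem_univ x : x ∈ ⋃₀ (V : Set (Set S.space)))
    rw [hw A hA x hx]
    exact Finset.mem_coe.2 (Finset.mem_image_of_mem _ hA)
  calc S.complexity n ≤ ((V.image w : Finset _) : Set (Fin n → Letter)).ncard :=
        ncard_le_ncard hsub (Finset.finite_toSet _)
    _ = (V.image w).card := ncard_coe_finset _
    _ ≤ V.card := Finset.card_image_le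

lemma tendsto_log_complexity_div (hS : S.IsLarge) (d : ℕ) {α : ℝ} (hα : 1 / 2 < α) :
    Tendsto (fun n : ℕ => Real.log (S.complexity (n + d)) / (n : ℝ) ^ α) atTop (𝓝 0) := by
  have h1 : Tendsto (fun n : ℕ => 60 * (n : ℝ) ^ (-(α - 1 / 2))) atTop (𝓝 (60 * 0)) :=
    ((tendsto_rpow_neg_atTop (sub_pos.2 hα)).comp tendsto_natCast_atTop_atTop).const_mul 60
  rw [mul_zero] at h1
  refine squeeze_zero' ?_ ?_ h1
  · refine Eventually.of_forall fun n => div_nonneg (Real.log_nonneg ?_) (by positivity)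
    exact_mod_cast complexity_pos hS _
  · filter_upwards [eventually_ge_atTop (S.len 0), eventually_ge_atTop d,
      eventually_gt_atTop 0] with n h2 h3 h4
    have hn : (0 : ℝ) < n := by exact_mod_cast h4
    have h5 := log_complexity_le hS (n := n + d) (by omega)
    have h6 : √((n + d : ℕ) : ℝ) ≤ 2 * √n := by
      rw [Real.sqrt_le_left (by positivity), mul_pow, Real.sq_sqrt hn.le]
      have : (d : ℝ) ≤ n := by exact_mod_cast h3
      push_cast; linarith
    rw [div_le_iff₀ (by positivity), mul_assoc, ← Real.rpow_add hn,
      show -(α - 1 / 2) + α = 1 / 2 by ring, ← Real.sqrt_eq_rpow]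
    linarith

lemma tendsto_coverGrowth (hS : S.IsLarge) {𝒰 : Set (Set S.space)} (h : IsFiniteOpenCover 𝒰)
    {α : ℝ} (hα : 1 / 2 < α) : Tendsto (coverGrowth S.shift 𝒰 α) atTop (𝓝 0) := by
  obtain ⟨r, hr⟩ := exists_minSubcoverCard_le 𝒰 h
  have h1 : Tendsto (fun n : ℕ => Real.log (minSubcoverCard (iterJoin S.shift 𝒰 n)) /
      (n : ℝ) ^ α) atTop (𝓝 0) := by
    refine squeeze_zero (fun n => div_nonneg (Real.log_natCast_nonneg _) (by positivity))
      (fun n => ?_) (tendsto_log_complexity_div hS (2 * r + 1) hα)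
    rcases Nat.eq_zero_or_pos (minSubcoverCard (iterJoin S.shift 𝒰 n)) with h0 | h0
    · rw [h0, Nat.cast_zero, Real.log_zero, zero_div]
      exact div_nonneg (Real.log_natCast_nonneg _) (by positivity)
    · gcongr
      exact hr n
  exact (continuous_coe_real_ereal.tendsto 0).comp h1

lemma eventually_one_le_coverGrowth (hS : S.IsLarge) {α : ℝ} (hα : α < 1 / 2) :
    ∀ᶠ n in atTop, 1 ≤ coverGrowth S.shift S.letterCover α n := by
  filter_upwards [eventually_rpow_le_log_complexity hS hα, eventually_gt_atTop 0] with n h1 h2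
  have hn : (0 : ℝ) < n := by exact_mod_cast h2
  unfold coverGrowth
  have : (1 : ℝ) ≤ Real.log (minSubcoverCard (iterJoin S.shift S.letterCover n)) / (n : ℝ) ^ α := by
    rw [le_div_iff₀ (by positivity), one_mul]
    refine h1.trans (Real.log_le_log ?_ ?_)
    · exact_mod_cast complexity_pos hS n
    · exact_mod_cast complexity_le_minSubcoverCard n
  exact_mod_cast this

lemma hasEntropyDim (hS : S.IsLarge) : HasEntropyDim S.shift (1 / 2) := by
  -- `F` stands for limsup and for liminf, so both dimensions are treated by the same argument.
  have hle : ∀ F : (ℕ → EReal) → EReal, (∀ u, Tendsto u atTop (𝓝 0) → F u = 0) →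
      ∀ 𝒰 : Set (Set S.space), IsFiniteOpenCover 𝒰 →
      sInf {a : EReal | ∃ α : ℝ, 0 < α ∧ a = (α : EReal) ∧ F (coverGrowth S.shift 𝒰 α) = 0} ≤
        ((1 / 2 : ℝ) : EReal) := by
    intro F hF 𝒰 h
    refine EReal.le_of_forall_lt_iff_le.1 fun α hα => ?_
    have hα' : 1 / 2 < α := by exact_mod_cast hα
    exact sInf_le ⟨α, by linarith, rfl, hF _ (tendsto_coverGrowth hS h hα')⟩
  have hge : ∀ F : (ℕ → EReal) → EReal, (∀ u, (∀ᶠ n in atTop, 1 ≤ u n) → 1 ≤ F u) →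
      ((1 / 2 : ℝ) : EReal) ≤ sInf {a : EReal | ∃ α : ℝ, 0 < α ∧ a = (α : EReal) ∧
        F (coverGrowth S.shift S.letterCover α) = 0} := by
    intro F hF
    refine le_sInf ?_
    rintro _ ⟨α, -, rfl, hα⟩
    by_contra hlt
    have hα' : α < 1 / 2 := by exact_mod_cast not_le.1 hlt
    have := hF _ (eventually_one_le_coverGrowth hS hα')
    rw [hα] at this
    exact absurd this (by norm_num)
  have l1 : ∀ u : ℕ → EReal, (∀ᶠ n in atTop, 1 ≤ u n) → 1 ≤ liminf u atTop :=
    fun u hu => le_liminf_of_le (by isBoundedDefault) hu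
  have l2 : ∀ u : ℕ → EReal, (∀ᶠ n in atTop, 1 ≤ u n) → 1 ≤ limsup u atTop :=
    fun u hu => (l1 u hu).trans (liminf_le_limsup (by isBoundedDefault) (by isBoundedDefault))
  constructor
  · apply le_antisymm
    · refine sSup_le ?_
      rintro _ ⟨𝒰, h, rfl⟩
      exact hle (fun u => limsup u atTop) (fun u hu => hu.limsup_eq) 𝒰 h
    · exact (hge (fun u => limsup u atTop) l2).trans
        (le_sSup ⟨_, isFiniteOpenCover_letterCover, rfl⟩)
  · apply le_antisymm
    · refine sSup_le ?_
      rintro _ ⟨𝒰, h, rfl⟩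
      exact hle (fun u => liminf u atTop) (fun u hu => hu.liminf_eq) 𝒰 h
    · exact (hge (fun u => liminf u atTop) l1).trans
        (le_sSup ⟨_, isFiniteOpenCover_letterCover, rfl⟩)

/-! ### Recognizability -/

lemma HasMarkers.letter (hM : S.HasMarkers) (k : Fin (S.card 0)) :
    S.letter 0 k 0 = 0 ∧ S.letter 0 k 1 = 0 ∧ S.letter 0 k 2 = 1 := by
  obtain ⟨t, ht⟩ := (hM k).1
  unfold Construction.letter
  rw [← ht]
  simp

lemma HasMarkers.not_zero_zero (hM : S.HasMarkers) (k : Fin (S.card 0)) {e : ℕ} (he : 1 ≤ e)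
    (he' : e + 1 < S.len 0) : ¬ (S.letter 0 k e = 0 ∧ S.letter 0 k (e + 1) = 0) := by
  rintro ⟨h1, h2⟩
  apply (hM k).2
  have hlen := S.length_word 0 k
  have e1 : ([0, 0] : List Letter) = ((S.word 0 k).tail.drop (e - 1)).take 2 := by
    apply List.ext_getElem
    · simp [hlen]; omega
    · intro i hi hi'
      unfold Construction.letter at h1 h2
      rw [List.getD_eq_getElem _ _ (by omega)] at h1 h2
      have hi2 : i < 2 := by simpa using hi
      simp only [List.getElem_take, List.getElem_drop, List.getElem_tail]
      interval_cases i
      · simp only [show e - 1 + 0 + 1 = e by omega, h1]; rfl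
      · simp only [show e - 1 + 1 + 1 = e + 1 by omega, h2]; rfl
  rw [e1]
  exact (List.take_prefix _ _).isInfix.trans (List.drop_suffix _ _).isInfix

/-- The marker 001 starts neither at a spacer nor at an inner letter of a word, where it would
produce a second 00. If it started at the last letter, the next symbols would have to be 01, but
they are 00 or begin with a spacer. -/
lemma mem_starts_zero (hS : S.IsLarge) (hM : S.HasMarkers) {e : ℕ} {y : ℤ → Letter}
    {K : Fin (S.card (0 + e))} {p : ℤ} (hy : S.At y (0 + e) K p) {i : ℕ} {k : Fin (S.card 0)}
    (hk : S.At y 0 k (p + i)) (hi : i + S.len 0 ≤ S.len (0 + e)) : i ∈ S.starts 0 e := by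
  have hl := len_pos hS 0
  have m := hM.letter k
  have y0 := hk 0 (by omega)
  have y1 := hk 1 (by omega)
  have y2 := hk 2 (by omega)
  rw [m.1] at y0
  rw [m.2.1] at y1
  rw [m.2.2] at y2
  have hz : (0 : Letter) ≠ spacer := by decide
  obtain ⟨d, hd, h⟩ := exists_mem_starts hS (show i < S.len (0 + e) by omega)
  rcases h with ⟨h1, h2⟩ | ⟨-, h2⟩
  · rcases h1.eq_or_lt with rfl | h1
    · exact hd
    · exfalso
      obtain ⟨k', hk'⟩ := hy.of_mem_starts hd
      obtain ⟨c, rfl⟩ := Nat.exists_eq_add_of_le h1.le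
      by_cases hc : c + 1 < S.len 0
      · apply hM.not_zero_zero k' (show 1 ≤ c by omega) hc
        rw [← hk' c (by omega), ← hk' (c + 1) hc, ← y0]
        refine ⟨?_, ?_⟩
        · congr 1; push_cast; omega
        · rw [y0, ← y1]; congr 1; push_cast; omega
      · rcases next_mem_starts hS hd (by omega) with h | ⟨-, h⟩
        · obtain ⟨k'', hk''⟩ := hy.of_mem_starts h
          have z1 := hk'' 1 (by omega)
          rw [(hM.letter k'').2.1] at z1
          have : y (p + (d + S.len 0 : ℕ) + (1 : ℕ)) = y (p + (d + c : ℕ) + (2 : ℕ)) := by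
            congr 1; push_cast; omega
          rw [z1, y2] at this
          exact absurd this (by decide)
        · have h3 := h y K p hy
          have : y (p + (d + S.len 0 : ℕ)) = y (p + (d + c : ℕ) + (1 : ℕ)) := by
            congr 1; push_cast; omega
          rw [h3, y1] at this
          exact hz this.symm
  · exfalso
    have := h2 y K p hy
    rw [show p + (i : ℤ) = p + i + (0 : ℕ) by simp, y0] at this
    exact hz this

/-- Words of stage `J` occur in words of later stages only at the expected positions. -/
lemma mem_starts_of_at (hS : S.IsLarge) (hM : S.HasMarkers) {y : ℤ → Letter} {p : ℤ} (J : ℕ) :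
    ∀ (e J' : ℕ) (_ : J + e = J') (K : Fin (S.card J')) (_ : S.At y J' K p) (i : ℕ)
      (k : Fin (S.card J)) (_ : S.At y J k (p + i)) (_ : i + S.len J ≤ S.len J'),
      i ∈ S.starts J e := by
  induction J with
  | zero =>
    rintro e _ rfl K hy i k hk hi
    exact mem_starts_zero hS hM hy hk hi
  | succ J ih =>
    intro e J' hJ' K hy i k hk hi
    have hc := large_card hS J
    -- A word of stage `J + 1` begins with the word 0 of stage `J`. By induction that word stands at
    -- an expected place, as some subword `m` of a word of stage `J + 1`; since each word of stage
    -- `J` occurs there once, `m = 0`.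
    have h0 : ¬ IsPermuted ((⟨0, by omega⟩ : Fin (S.card J)) : ℕ) := fun h => h.2 rfl
    have hk0 := hk.child ⟨0, by omega⟩
    rw [S.perm_apply _ h0] at hk0
    simp only [pos_zero, Nat.cast_zero, add_zero] at hk0
    have hlen := len_strictMono hS (show J < J + 1 by omega)
    obtain ⟨d, hd, m, hm, rfl⟩ := mem_starts_succ_left
      (ih (e + 1) J' (by omega) K hy i _ hk0 (by omega))
    subst hJ'
    obtain ⟨K₁, hK₁⟩ := hy.of_mem_starts hd
    have hm1 := hK₁.child ⟨m, hm⟩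
    push_cast at hk0
    rw [← add_assoc] at hk0
    have h1 := hm1.eq hk0
    rw [← S.perm_apply K₁ h0] at h1
    have h2 := congrArg Fin.val ((S.perm J K₁).injective h1)
    simp only at h2
    rw [h2, pos_zero, add_zero]
    exact hd

/-- Occurrences of a non-permuted word of stage `J` are at least `len (J + 1)` apart. -/
lemma len_le_of_at_of_at (hS : S.IsLarge) (hM : S.HasMarkers) {x : ℤ → Letter} (hx : x ∈ S.space)
    {J : ℕ} {k : Fin (S.card J)} (hk : ¬ IsPermuted k) {s₁ s₂ : ℤ} (h₁ : S.At x J k s₁)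
    (h₂ : S.At x J k s₂) (hs : s₁ < s₂) : s₁ + S.len (J + 1) ≤ s₂ := by
  obtain ⟨n, hn⟩ := Int.eq_ofNat_of_zero_le (show 0 ≤ s₂ - s₁ by omega)
  obtain ⟨e, K, p, y, hxy, hy, hp, hpn⟩ := exists_window hS hx s₁ (n + S.len J) (J + 1)
  -- Every occurrence is the subword of the fixed index `k` in a word of stage `J + 1`, so distinct
  -- occurrences belong to distinct such words.
  have key : ∀ s : ℤ, s₁ ≤ s → s ≤ s₂ → S.At x J k s →
      ∃ d ∈ S.starts (J + 1) e, s = p + d + pos (S.len J) k := by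
    intro s h1 h2 h3
    obtain ⟨i, hi⟩ := Int.eq_ofNat_of_zero_le (show 0 ≤ s - p by omega)
    have h4 : S.At y J k (p + i) := h3.congr fun a ha => by
      rw [hxy _ (by omega) (by push_cast; omega)]
      congr 1; omega
    obtain ⟨d, hd, m, hm, rfl⟩ := mem_starts_succ_left
      (mem_starts_of_at hS hM J (e + 1) (J + 1 + e) (by omega) K hy i k h4
        (by push_cast at hpn; omega))
    refine ⟨d, hd, ?_⟩
    obtain ⟨K₁, hK₁⟩ := hy.of_mem_starts hd
    have hm1 := hK₁.child ⟨m, hm⟩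
    push_cast at h4
    rw [← add_assoc] at h4
    have h5 := hm1.eq h4
    rw [← S.perm_apply K₁ hk] at h5
    have h6 := congrArg Fin.val ((S.perm J K₁).injective h5)
    simp only at h6
    rw [← h6]
    push_cast at hi
    omega
  obtain ⟨d₁, hd₁, e₁⟩ := key s₁ le_rfl hs.le h₁
  obtain ⟨d₂, hd₂, e₂⟩ := key s₂ hs.le le_rfl h₂
  have := add_len_le_of_lt_of_mem_starts hd₁ hd₂ (by omega)
  omega

/-! ### Typical points -/

/-- The number of successive words of stage `J` seen from a typical point without a permuted
word. -/
def runLength (S : Construction) (J : ℕ) : ℕ := Nat.sqrt (Nat.sqrt (S.card J))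

lemma card_lt_runLength_pow (J : ℕ) : S.card J < (S.runLength J + 1) ^ 4 := by
  have h1 := Nat.lt_succ_sqrt' (S.card J)
  have h2 := Nat.lt_succ_sqrt' (Nat.sqrt (S.card J))
  calc S.card J < (Nat.sqrt (S.card J) + 1) ^ 2 := h1
    _ ≤ ((S.runLength J + 1) ^ 2) ^ 2 := Nat.pow_le_pow_left h2 2
    _ = _ := by ring

lemma sixteen_pow_le_card (hS : S.IsLarge) (J : ℕ) : 16 ^ J ≤ S.card J := by
  induction J with
  | zero => have := large_card hS 0; omega
  | succ J ih =>
    have h1 := (two_pow_le_card hS J).2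
    have h2 := large_card hS J
    rw [pow_succ]
    nlinarith

lemma two_pow_le_runLength (hS : S.IsLarge) (J : ℕ) : 2 ^ J ≤ S.runLength J := by
  have h : 2 ^ J * 2 ^ J * (2 ^ J * 2 ^ J) = 16 ^ J := by
    rw [← mul_pow, ← mul_pow]; norm_num
  unfold runLength
  rw [Nat.le_sqrt, Nat.le_sqrt, h]
  exact sixteen_pow_le_card hS J

lemma ten_le_runLength (hS : S.IsLarge) (J : ℕ) : 10 ≤ S.runLength J := by
  have := large_card hS J
  unfold runLength
  rw [Nat.le_sqrt, Nat.le_sqrt]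
  omega

/-- The points from which `runLength J` successive words of stage `J` are seen, none of them
permuted and without spacers in between. -/
def goodSet (S : Construction) (J : ℕ) : Set S.space :=
  {x | ∃ (K : Fin (S.card (J + 1))) (k o : ℕ), o < S.len J ∧ k + (S.runLength J + 2) < S.card J ∧
    Nat.sqrt (k + (S.runLength J + 2) + 1) = Nat.sqrt (k + 1) ∧
      S.At x.1 (J + 1) K (-(pos (S.len J) (k + 1) + o : ℕ))}

lemma isLocal_goodSet (J : ℕ) : S.IsLocal (S.len (J + 1)) (S.goodSet J) := by
  rintro x y hxy ⟨K, k, o, ho, hk, hk', h⟩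
  refine ⟨K, k, o, ho, hk, hk', h.congr fun i hi => (hxy _ ?_).symm⟩
  have h1 := pos_add_le_concatLength (S.len J) (show k + 1 < S.card J by omega)
  change _ ≤ S.len (J + 1) at h1
  rw [abs_le]
  omega

/-- A run beginning at index `k` makes all `len J` positions of the subword `k + 1` good. -/
lemma le_visits_goodSet {J : ℕ} {x : S.space} {K : Fin (S.card (J + 1))} {s : ℤ}
    (h : S.At x.1 (J + 1) K s) :
    ((Finset.range (S.card J - (S.runLength J + 2))).filter fun k =>
      Nat.sqrt (k + (S.runLength J + 2) + 1) = Nat.sqrt (k + 1)).card * S.len J ≤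
      visits (S.goodSet J) x s (S.len (J + 1)) := by
  refine le_trans ?_ (sum_visits_le _ x s (S.len J) (S.card J))
  set G := (Finset.range (S.card J - (S.runLength J + 2))).filter fun k =>
      Nat.sqrt (k + (S.runLength J + 2) + 1) = Nat.sqrt (k + 1)
  rw [Fin.sum_univ_eq_sum_range (fun k => visits (S.goodSet J) x (s + pos (S.len J) k) (S.len J)),
    ← Finset.card_image_of_injective G Nat.succ_injective, ← smul_eq_mul]
  refine le_trans (Finset.card_nsmul_le_sum (G.image Nat.succ) _ _ fun k hk => ?_)
      (Finset.sum_le_sum_of_subset fun k hk => ?_)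
  · obtain ⟨m, hm, rfl⟩ := Finset.mem_image.1 hk
    rw [Finset.mem_filter, Finset.mem_range] at hm
    refine (visits_eq_of_forall_mem fun i hi => ?_).ge
    refine ⟨K, m, i, hi, by omega, hm.2, at_shiftBy.2 ?_⟩
    convert h using 1
    push_cast; ring
  · obtain ⟨m, hm, rfl⟩ := Finset.mem_image.1 hk
    rw [Finset.mem_filter, Finset.mem_range] at hm
    rw [Finset.mem_range, Nat.succ_eq_add_one]
    omega

/-- With T = `runLength J` and q = √N, at most (T + 2)(q + 2) indices fail to begin a run. Since q ^
2 ≤ N and T ^ 2 ≤ q, their proportion is O(1 / T), which is summable because T ≥ 2 ^ J. -/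
lemma measure_compl_goodSet_le (hS : S.IsLarge) {μ : Measure S.space} [IsProbabilityMeasure μ]
    (hμ : MeasurePreserving S.shift μ μ) (J : ℕ) :
    μ (S.goodSet J)ᶜ ≤ ENNReal.ofReal (8 * (1 / 2) ^ J) := by
  rw [← ofReal_measureReal]
  apply ENNReal.ofReal_le_ofReal
  rw [probReal_compl_eq_one_sub (isLocal_goodSet J).measurableSet]
  have h1 := le_measureReal_mul hS hμ (isLocal_goodSet J).measurableSet
    (fun x K s hx => le_visits_goodSet hx)
  have h2 := le_card_filter_sqrt_eq (S.card J) (S.runLength J + 2)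
  set g := ((Finset.range (S.card J - (S.runLength J + 2))).filter fun k =>
      Nat.sqrt (k + (S.runLength J + 2) + 1) = Nat.sqrt (k + 1)).card
  have hT := ten_le_runLength hS J
  have hTs : S.runLength J ^ 2 ≤ Nat.sqrt (S.card J) := Nat.sqrt_le' _
  have hsN := Nat.sqrt_le (S.card J)
  have hT2 : (2 : ℝ) ^ J ≤ S.runLength J := by exact_mod_cast two_pow_le_runLength hS J
  have hl := one_le_len_real hS J
  have hc := card_pos_real hS J
  have hL : (S.len (J + 1) : ℝ) + 1 ≤ S.card J * S.len J + Nat.sqrt (S.card J) := by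
    have h3 : S.len (J + 1) + 1 ≤ S.card J * S.len J + Nat.sqrt (S.card J) := by
      have : 1 ≤ Nat.sqrt (S.card J) := by nlinarith
      rw [len_succ]; omega
    exact_mod_cast h3
  have hL' : (S.card J : ℝ) * S.len J ≤ S.len (J + 1) + 1 := by
    have : ((S.card J * S.len J : ℕ) : ℝ) ≤ S.len (J + 1) := by
      exact_mod_cast card_mul_len_le S J
    push_cast at this; linarith
  set T := S.runLength J
  set q := Nat.sqrt (S.card J) with hq
  have h2' : (S.card J : ℝ) ≤ g + (T + 2) * (q + 2) := by
    have : S.card J ≤ g + (T + 2) * (q + 2) := by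
      have e : (T + 2) * (q + 2) = (T + 2) * (q + 1) + (T + 2) := by ring
      omega
    exact_mod_cast this
  have hTr : (10 : ℝ) ≤ T := by exact_mod_cast hT
  have hTq : (T : ℝ) ^ 2 ≤ q := by exact_mod_cast hTs
  have hqN : (q : ℝ) * q ≤ S.card J := by exact_mod_cast hsN
  push_cast at h1
  set m := μ.real (S.goodSet J)
  have hm1 : 0 ≤ 1 - m := sub_nonneg.2 measureReal_le_one
  have h4 : (1 - m) * (S.card J * S.len J) ≤ q + (T + 2) * (q + 2) * S.len J := by
    calc (1 - m) * (S.card J * S.len J) ≤ (1 - m) * (S.len (J + 1) + 1) := by gcongr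
      _ ≤ S.card J * S.len J + q - g * S.len J := by linarith
      _ ≤ _ := by nlinarith
  have h5 : (1 - m) * S.card J ≤ 4 * T * q := by
    have h6 : (q : ℝ) + ((T : ℝ) + 2) * (q + 2) * S.len J ≤ (4 * T * q) * S.len J := by
      have h7 : (q : ℝ) ≤ q * S.len J := by nlinarith
      have h8 : (q : ℝ) + (T + 2) * (q + 2) ≤ 4 * T * q := by nlinarith
      have h9 := mul_le_mul_of_nonneg_right h8 (show (0 : ℝ) ≤ S.len J by linarith)
      linarith
    have h9 : (1 - m) * S.card J * S.len J ≤ (4 * T * q) * S.len J := by linarith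
    exact le_of_mul_le_mul_right h9 (by linarith)
  have hq0 : (0 : ℝ) < q := by nlinarith
  have h10 : (1 - m) * q ≤ 4 * T := by
    have h11 : (1 - m) * (q * q) ≤ 4 * T * q := (mul_le_mul_of_nonneg_left hqN hm1).trans h5
    have h12 : (1 - m) * q * q ≤ 4 * T * q := by linarith
    exact le_of_mul_le_mul_right h12 hq0
  have h13 : (1 - m) * T ≤ 4 := by
    have h14 : (1 - m) * T ^ 2 ≤ 4 * T := (mul_le_mul_of_nonneg_left hTq hm1).trans h10
    have h15 : (1 - m) * T * T ≤ 4 * T := by linarith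
    exact le_of_mul_le_mul_right h15 (by linarith)
  have h16 : (1 - m) * 2 ^ J ≤ 4 := (mul_le_mul_of_nonneg_left hT2 hm1).trans h13
  rw [one_div, inv_pow, ← div_eq_mul_inv, le_div_iff₀ (by positivity)]
  linarith

/-- In a run without permuted words the positions are regular. -/
lemma pos_add_of_sqrt_eq {l k u j : ℕ} (h : Nat.sqrt (k + u + 1) = Nat.sqrt (k + 1)) (hj : 1 ≤ j)
    (hju : j ≤ u) : pos l (k + j) = pos l k + j * l ∧ ¬ IsPermuted (k + j) := by
  have h1 : ∀ i ≤ u, Nat.sqrt (k + i + 1) = Nat.sqrt (k + 1) := fun i hi =>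
    le_antisymm (h ▸ Nat.sqrt_le_sqrt (by omega)) (Nat.sqrt_le_sqrt (by omega))
  constructor
  · unfold pos
    rw [h1 j hju, Nat.add_mul]
    omega
  · rintro ⟨hs, -⟩
    have h2 := sqrt_succ_of_isSquare hs
    have h3 := h1 (j - 1) (by omega)
    rw [show k + (j - 1) + 1 = k + j by omega] at h3
    have h4 := h1 j hju
    omega

lemma at_of_mem_goodSet {J : ℕ} {x : S.space} {K : Fin (S.card (J + 1))} {k o : ℕ}
    (hk : k + (S.runLength J + 2) < S.card J)
    (hk' : Nat.sqrt (k + (S.runLength J + 2) + 1) = Nat.sqrt (k + 1))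
    (h : S.At x.1 (J + 1) K (-(pos (S.len J) (k + 1) + o : ℕ))) {j : ℕ}
    (hj : j ≤ S.runLength J + 1) :
    S.At x.1 J ⟨k + 1 + j, by omega⟩ (j * S.len J - o) := by
  have h1 := h.child ⟨k + 1 + j, by omega⟩
  obtain ⟨e1, e2⟩ := pos_add_of_sqrt_eq (l := S.len J) hk' (show 1 ≤ 1 + j by omega) (by omega)
  obtain ⟨e3, -⟩ := pos_add_of_sqrt_eq (l := S.len J) hk' (show 1 ≤ 1 by omega) (by omega)
  rw [← add_assoc] at e1 e2
  rw [S.perm_apply _ e2] at h1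
  convert h1 using 1
  simp only [e1, e3]
  push_cast; ring

/-- From a good point only non-permuted words without spacers are read, so the prefix depends only
on the index and the offset of the origin: N · l possibilities, however long the run. -/
lemma ncard_wordOf_goodSet_le (hS : S.IsLarge) (J : ℕ) :
    (S.wordOf (S.runLength J * S.len J) '' S.goodSet J).ncard ≤ S.len (J + 1) := by
  classical
  have hc := large_card hS J
  have hl := len_pos hS J
  have hgood : ∀ x : S.space, ∃ p : Fin (S.card J) × Fin (S.len J), x ∈ S.goodSet J →
      ∃ K, (p.1 : ℕ) + (S.runLength J + 2) < S.card J ∧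
        Nat.sqrt (p.1 + (S.runLength J + 2) + 1) = Nat.sqrt (p.1 + 1) ∧
        S.At x.1 (J + 1) K (-(pos (S.len J) (p.1 + 1) + p.2 : ℕ)) := by
    intro x
    by_cases hx : x ∈ S.goodSet J
    · obtain ⟨K, k, o, ho, hk, hk', h⟩ := hx
      exact ⟨(⟨k, by omega⟩, ⟨o, ho⟩), fun _ => ⟨K, hk, hk', h⟩⟩
    · exact ⟨(⟨0, by omega⟩, ⟨0, by omega⟩), fun h => absurd h hx⟩
  choose g hg using hgood
  have h := (ncard_image_le_of_factors (f := S.wordOf (S.runLength J * S.len J)) (g := g)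
    (G := S.goodSet J) ?_).2
  · refine h.trans ?_
    rw [Fintype.card_prod, Fintype.card_fin, Fintype.card_fin]
    exact card_mul_len_le S J
  · intro x hx y hy hxy
    obtain ⟨K, hk, hk', hK⟩ := hg x hx
    obtain ⟨K', -, -, hK'⟩ := hg y hy
    rw [← hxy] at hK'
    have ho := (g x).2.2
    set k : ℕ := ((g x).1 : ℕ)
    set o : ℕ := ((g x).2 : ℕ)
    funext i
    unfold wordOf
    have hi := i.2
    have hdiv := Nat.div_add_mod (o + i) (S.len J)
    have hmod := Nat.mod_lt (o + i) (show 0 < S.len J by omega)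
    have hj : (o + i) / S.len J ≤ S.runLength J + 1 := by
      have : (o + i) / S.len J < S.runLength J + 1 := by
        rw [Nat.div_lt_iff_lt_mul (by omega), Nat.add_mul]
        omega
      omega
    have e1 := at_of_mem_goodSet hk hk' hK hj _ hmod
    have e2 := at_of_mem_goodSet hk hk' hK' hj _ hmod
    rw [← e2] at e1
    have e3 : (((o + i) / S.len J : ℕ) : ℤ) * S.len J - o + ((o + i) % S.len J : ℕ) = (i : ℕ) := by
      have : ((S.len J * ((o + i) / S.len J) + (o + i) % S.len J : ℕ) : ℤ) = (o + i : ℕ) := by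
        rw [hdiv]
      push_cast at this ⊢
      linarith
    rwa [e3] at e1

lemma mem_cylinder_iff {n : ℕ} {x y : S.space} :
    y ∈ S.cylinder n x ↔ S.wordOf n y = S.wordOf n x := by
  constructor
  · intro h
    funext i
    exact h i i.2
  · intro h i hi
    exact congrFun h ⟨i, hi⟩

/-- The first 2 l letters of a good point contain a whole non-permuted word of stage `J`; a return
repeats this word, and `len_le_of_at_of_at` applies. -/
lemma len_le_of_return (hS : S.IsLarge) (hM : S.HasMarkers) {J n : ℕ} {x y : S.space}
    (hx : x ∈ S.goodSet J) (hn : 2 * S.len J ≤ n) (hy : y ∈ S.cylinder n x) {j : ℕ} (hj : 0 < j)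
    (hyj : S.shift^[j] y ∈ S.cylinder n x) : S.len (J + 1) ≤ j := by
  obtain ⟨K, k, o, ho, hk, hk', h⟩ := hx
  have hT := ten_le_runLength hS J
  -- The second word of the run starts at l - o ≥ 0 and ends by 2 l.
  have h1 := at_of_mem_goodSet hk hk' h (j := 1) (by omega)
  obtain ⟨-, hnp⟩ := pos_add_of_sqrt_eq (l := S.len J) hk' (show 1 ≤ 2 by omega) (by omega)
  obtain ⟨q, hq⟩ := Int.eq_ofNat_of_zero_le (show 0 ≤ ((1 : ℕ) : ℤ) * S.len J - o by omega)
  have a1 : S.At y.1 J ⟨k + 1 + 1, by omega⟩ q := h1.congr fun i hi => by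
    have := hy (q + i) (by omega)
    push_cast at this
    rw [this, hq]
  have a2 : S.At y.1 J ⟨k + 1 + 1, by omega⟩ (q + j) := h1.congr fun i hi => by
    have := hyj (q + i) (by omega)
    rw [iterate_shift_apply] at this
    push_cast at this
    rw [show (q : ℤ) + j + i = q + i + j by ring, this, hq]
  have := len_le_of_at_of_at hS hM y.2 (by simpa [add_assoc] using hnp) a1 a2 (by omega)
  omega

/-- A set whose points do not return up to the time `t` has measure at most `1 / (t + 1)`. -/
lemma measure_mul_le_one {μ : Measure S.space} [IsProbabilityMeasure μ]
    (hμ : MeasurePreserving S.shift μ μ) {B : Set S.space} (hB : MeasurableSet B) (t : ℕ)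
    (h : ∀ x ∈ B, ∀ j, 0 < j → j ≤ t → S.shift^[j] x ∉ B) : ((t + 1 : ℕ) : ℝ≥0∞) * μ B ≤ 1 := by
  have hdisj : (↑(Finset.range (t + 1)) : Set ℕ).PairwiseDisjoint
      (fun i => S.shift^[i] ⁻¹' B) := by
    have key : ∀ i j : ℕ, i < j → j ≤ t → Disjoint (S.shift^[i] ⁻¹' B) (S.shift^[j] ⁻¹' B) := by
      intro i j hij hjt
      rw [disjoint_left]
      intro x hx hx'
      refine h _ hx (j - i) (by omega) (by omega) ?_
      rw [← Function.iterate_add_apply, Nat.sub_add_cancel hij.le]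
      exact hx'
    intro i hi j hj hij
    simp only [Finset.coe_range, mem_Iio] at hi hj
    rcases lt_or_gt_of_ne hij with h1 | h1
    · exact key i j h1 (by omega)
    · exact (key j i h1 (by omega)).symm
  have h1 := measure_biUnion_finset (μ := μ) hdisj fun i _ => (hμ.iterate i).measurable hB
  rw [Finset.sum_congr rfl fun i _ => (hμ.iterate i).measure_preimage hB.nullMeasurableSet] at h1
  simp only [Finset.sum_const, Finset.card_range, nsmul_eq_mul] at h1
  rw [← h1]
  exact prob_le_one

end Construction

/-! ### Limits of quotients -/

lemma tendsto_ereal_div_zero {a : ℕ → EReal} {b d : ℕ → ℝ} (h0 : ∀ᶠ n in atTop, 0 ≤ a n)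
    (h1 : ∀ᶠ n in atTop, a n ≤ b n) (hd : ∀ n, 0 ≤ d n)
    (h : Tendsto (fun n => b n / d n) atTop (𝓝 0)) :
    Tendsto (fun n => a n / (d n : EReal)) atTop (𝓝 0) := by
  have h2 : Tendsto (fun n => ((b n / d n : ℝ) : EReal)) atTop (𝓝 0) := by
    rw [← EReal.coe_zero]
    exact EReal.tendsto_coe.2 h
  refine tendsto_of_tendsto_of_tendsto_of_le_of_le' tendsto_const_nhds h2 ?_ ?_
  · filter_upwards [h0] with n hn
    exact EReal.div_nonneg hn (by exact_mod_cast hd n)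
  · filter_upwards [h1] with n hn
    rw [EReal.coe_div]
    exact EReal.div_le_div_right_of_nonneg (by exact_mod_cast hd n) hn

lemma tendsto_ereal_div_top {a : ℕ → EReal} {b d : ℕ → ℝ} (h1 : ∀ᶠ n in atTop, (b n : EReal) ≤ a n)
    (hd : ∀ n, 0 ≤ d n) (h : Tendsto (fun n => b n / d n) atTop atTop) :
    Tendsto (fun n => a n / (d n : EReal)) atTop (𝓝 ⊤) := by
  have h2 : Tendsto (fun n => ((b n / d n : ℝ) : EReal)) atTop (𝓝 ⊤) :=
    EReal.tendsto_coe_nhds_top_iff.2 h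
  refine tendsto_nhds_top_mono h2 ?_
  filter_upwards [h1] with n hn
  rw [EReal.coe_div]
  exact EReal.div_le_div_right_of_nonneg (by exact_mod_cast hd n) hn

lemma limsup_eq_top_of_tendsto {a : ℕ → EReal} {n : ℕ → ℕ} (hn : Tendsto n atTop atTop)
    (h : Tendsto (fun j => a (n j)) atTop (𝓝 ⊤)) : limsup a atTop = ⊤ := by
  rw [eq_top_iff]
  refine le_of_forall_lt fun c hc => ?_
  obtain ⟨c', hc', hc''⟩ := exists_between hc
  refine hc'.trans_le (le_limsup_of_frequently_le ?_)
  exact hn.frequently ((h.eventually (lt_mem_nhds hc'')).frequently.mono fun j hj => hj.le)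

namespace Construction

variable {S : Construction}

/-! ### The scales of the construction -/

lemma eventually_mul_pow_le_runLength (hS : S.IsLarge) (C d : ℕ) :
    ∀ᶠ J in atTop, C * S.len J ^ d ≤ S.runLength J := by
  filter_upwards [eventually_mul_pow_le_card hS (C ^ 4) (d * 4)] with J hJ
  unfold runLength
  rw [Nat.le_sqrt, Nat.le_sqrt]
  refine le_trans (le_of_eq ?_) hJ
  rw [pow_mul]; ring

lemma tendsto_runLength (hS : S.IsLarge) : Tendsto (fun J => (S.runLength J : ℝ)) atTop atTop := by
  refine tendsto_atTop_mono (fun J => ?_) (tendsto_pow_atTop_atTop_of_one_lt (one_lt_two (α := ℝ)))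
  exact_mod_cast two_pow_le_runLength hS J

lemma logCard_le_log_runLength (hS : S.IsLarge) (J : ℕ) :
    S.logCard J ≤ 8 * Real.log (S.runLength J) := by
  have h1 : (10 : ℝ) ≤ S.runLength J := by exact_mod_cast ten_le_runLength hS J
  have h2 : (S.card J : ℝ) ≤ ((S.runLength J : ℝ) + 1) ^ 4 := by
    exact_mod_cast (card_lt_runLength_pow J).le
  have h3 : (S.card J : ℝ) ≤ (S.runLength J : ℝ) ^ 8 := by
    calc (S.card J : ℝ) ≤ ((S.runLength J : ℝ) + 1) ^ 4 := h2
      _ ≤ ((S.runLength J : ℝ) ^ 2) ^ 4 := pow_le_pow_left₀ (by linarith) (by nlinarith) 4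
      _ = _ := by ring
  have hc := card_pos_real hS J
  have h4 := Real.log_le_log (by linarith) h3
  rw [Real.log_pow] at h4
  exact_mod_cast h4

lemma tendsto_len_rpow (hS : S.IsLarge) {a : ℝ} (ha : a < 0) :
    Tendsto (fun J => (S.len J : ℝ) ^ a) atTop (𝓝 0) := by
  have := (tendsto_rpow_neg_atTop (neg_pos.2 ha)).comp (tendsto_len_real hS)
  simpa [Function.comp_def] using this

/-- At the right end of the admissible range, n is at least N ^ (1/4) up to a constant, and log N is
smaller than any power of it. -/
lemma exists_times_zero (hS : S.IsLarge) : ∃ n : ℕ → ℕ, StrictMono n ∧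
    (∀ᶠ J in atTop, 2 * S.len J ≤ n J ∧ n J ≤ S.runLength J * S.len J) ∧
    ∀ β : ℝ, 0 < β → Tendsto (fun J => S.logCard J / (n J : ℝ) ^ β) atTop (𝓝 0) := by
  refine ⟨fun J => S.runLength J * S.len J, ?_, .of_forall fun J => ?_, fun β hβ => ?_⟩
  · refine strictMono_nat_of_lt_succ fun J => ?_
    have h1 := len_strictMono hS (show J < J + 1 by omega)
    have h2 : S.runLength J ≤ S.runLength (J + 1) := by
      have := (two_pow_le_card hS J).2
      have := large_card hS J
      exact Nat.sqrt_le_sqrt (Nat.sqrt_le_sqrt (by nlinarith))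
    have h3 := ten_le_runLength hS J
    exact Nat.mul_lt_mul_of_le_of_lt h2 h1 (by omega)
  · have := ten_le_runLength hS J
    exact ⟨Nat.mul_le_mul_right _ (by omega), le_rfl⟩
  · have h1 := ((isLittleO_log_rpow_atTop hβ).tendsto_div_nhds_zero.comp
      (tendsto_runLength hS)).const_mul 8
    rw [mul_zero] at h1
    refine squeeze_zero (fun J => ?_) (fun J => ?_) h1
    · have := sixty_le_logCard hS J
      positivity
    · have h2 := logCard_le_log_runLength hS J
      have h3 : (10 : ℝ) ≤ S.runLength J := by exact_mod_cast ten_le_runLength hS J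
      have h4 := one_le_len_real hS J
      have h5 := sixty_le_logCard hS J
      simp only [Function.comp_apply]
      rw [← mul_div_assoc]
      push_cast
      gcongr
      nlinarith

/-- Taking n ≈ l ^ a with a = 1 / (2τ) makes n ^ τ ≈ √l, which is log N up to a factor l ^ o(1). The
condition τ ≤ 1/2 gives a ≥ 1, and `runLength` exceeds every power of l, so n lies in the admissible
range. -/
lemma exists_times_pos (hS : S.IsLarge) {τ : ℝ} (h0 : 0 < τ) (hτ : τ ≤ 1 / 2) :
    ∃ n : ℕ → ℕ, StrictMono n ∧
    (∀ᶠ J in atTop, 2 * S.len J ≤ n J ∧ n J ≤ S.runLength J * S.len J) ∧ ∀ β : ℝ, 0 < β →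
      (τ < β → Tendsto (fun J => S.logCard J / (n J : ℝ) ^ β) atTop (𝓝 0)) ∧
      (β < τ → Tendsto (fun J => S.logCard J / (n J : ℝ) ^ β) atTop atTop) := by
  set a : ℝ := 1 / (2 * τ) with ha
  have ha1 : 1 ≤ a := by rw [ha, le_div_iff₀ (by linarith)]; linarith
  have haτ : a * τ = 1 / 2 := by rw [ha]; field_simp
  have hr1 : ∀ J, (1 : ℝ) ≤ (S.len J : ℝ) ^ (a - 1) := fun J =>
    Real.one_le_rpow (by have := one_le_len_real hS J; linarith) (by linarith)
  have hsplit : ∀ J, (S.len J : ℝ) * (S.len J : ℝ) ^ (a - 1) = (S.len J : ℝ) ^ a := fun J => by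
    have := one_le_len_real hS J
    rw [Real.rpow_sub_one (by linarith)]
    field_simp
  set c : ℕ → ℕ := fun J => ⌈(S.len J : ℝ) ^ (a - 1)⌉₊ with hc
  have hc1 : ∀ J, (S.len J : ℝ) ^ (a - 1) ≤ c J := fun J => Nat.le_ceil _
  have hc2 : ∀ J, (c J : ℝ) ≤ 2 * (S.len J : ℝ) ^ (a - 1) := fun J => by
    have := (Nat.ceil_lt_add_one (by linarith [hr1 J] : 0 ≤ (S.len J : ℝ) ^ (a - 1))).le
    linarith [hr1 J]
  have hc3 : ∀ J, 1 ≤ c J := fun J => by exact_mod_cast (hr1 J).trans (hc1 J)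
  have hn1 : ∀ J, (S.len J : ℝ) ^ a ≤ ((2 * S.len J * c J : ℕ) : ℝ) := fun J => by
    have hl := one_le_len_real hS J
    rw [← hsplit]
    push_cast
    nlinarith [hc1 J, hr1 J]
  have hn2 : ∀ J, ((2 * S.len J * c J : ℕ) : ℝ) ≤ 4 * (S.len J : ℝ) ^ a := fun J => by
    have hl := one_le_len_real hS J
    rw [← hsplit]
    push_cast
    nlinarith [hc2 J]
  refine ⟨fun J => 2 * S.len J * c J, ?_, ?_, fun β hβ => ⟨fun h => ?_, fun h => ?_⟩⟩
  · refine strictMono_nat_of_lt_succ fun J => ?_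
    have h1 := len_strictMono hS (show J < J + 1 by omega)
    have h2 : c J ≤ c (J + 1) := Nat.ceil_le_ceil
      (Real.rpow_le_rpow (by positivity) (by exact_mod_cast h1.le) (by linarith))
    exact Nat.mul_lt_mul_of_lt_of_le (by omega) h2 (by have := hc3 J; omega)
  · filter_upwards [eventually_mul_pow_le_runLength hS 2 ⌈a⌉₊] with J hJ
    have hl := one_le_len_real hS J
    refine ⟨Nat.le_mul_of_pos_right _ (hc3 J), ?_⟩
    have h1 : c J ≤ S.len J ^ ⌈a⌉₊ := by
      refine Nat.ceil_le.2 ?_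
      push_cast
      rw [← Real.rpow_natCast]
      exact Real.rpow_le_rpow_of_exponent_le (by linarith) (by linarith [Nat.le_ceil a])
    calc 2 * S.len J * c J = 2 * c J * S.len J := by ring
      _ ≤ _ := Nat.mul_le_mul_right _ ((Nat.mul_le_mul_left 2 h1).trans hJ)
  · refine squeeze_zero (fun J => ?_) (fun J => ?_)
      (tendsto_len_rpow hS (show 1 / 2 - a * β < 0 by nlinarith))
    · have := sixty_le_logCard hS J
      positivity
    · have hl := one_le_len_real hS J
      rw [Real.rpow_sub (by linarith), ← Real.sqrt_eq_rpow, Real.rpow_mul (by linarith)]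
      have h1 := logCard_le_sqrt_len hS J
      have h2 : ((S.len J : ℝ) ^ a) ^ β ≤ ((2 * S.len J * c J : ℕ) : ℝ) ^ β :=
        Real.rpow_le_rpow (by positivity) (hn1 J) hβ.le
      have h3 : 0 < ((S.len J : ℝ) ^ a) ^ β :=
        Real.rpow_pos_of_pos (Real.rpow_pos_of_pos (by linarith) _) _
      exact div_le_div₀ (Real.sqrt_nonneg _) h1 h3 h2
  · have hβ' : a * β < 1 / 2 := by nlinarith
    set δ : ℝ := (a * β + 1 / 2) / 2 with hδ
    have h1 : Tendsto (fun J => (4 ^ β)⁻¹ * (S.len J : ℝ) ^ (δ - a * β)) atTop atTop :=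
      ((tendsto_rpow_atTop (by linarith)).comp (tendsto_len_real hS)).const_mul_atTop
        (by positivity)
    refine tendsto_atTop_mono' _ ?_ h1
    filter_upwards [eventually_len_rpow_le_logCard hS (show δ < 1 / 2 by linarith)] with J hJ
    have hl := one_le_len_real hS J
    have h2 : ((2 * S.len J * c J : ℕ) : ℝ) ^ β ≤ 4 ^ β * (S.len J : ℝ) ^ (a * β) := by
      rw [Real.rpow_mul (by linarith), ← Real.mul_rpow (by norm_num) (by positivity)]
      exact Real.rpow_le_rpow (by positivity) (hn2 J) hβ.le
    have h3 : (0 : ℝ) < ((2 * S.len J * c J : ℕ) : ℝ) ^ β :=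
      Real.rpow_pos_of_pos ((Real.rpow_pos_of_pos (by linarith) a).trans_le (hn1 J)) _
    rw [Real.rpow_sub (by linarith), le_div_iff₀ h3]
    have h4 : (0 : ℝ) < (S.len J : ℝ) ^ (a * β) := Real.rpow_pos_of_pos (by linarith) _
    calc (4 ^ β)⁻¹ * ((S.len J : ℝ) ^ δ / (S.len J : ℝ) ^ (a * β)) *
          ((2 * S.len J * c J : ℕ) : ℝ) ^ β
        ≤ (4 ^ β)⁻¹ * ((S.len J : ℝ) ^ δ / (S.len J : ℝ) ^ (a * β)) *
          (4 ^ β * (S.len J : ℝ) ^ (a * β)) := by gcongr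
      _ = (S.len J : ℝ) ^ δ := by field_simp
      _ ≤ _ := hJ

/-! ### Regularity of rates -/

/-- The properties common to the inverse measures of the cylinders and to the first return times
that determine their rates of growth. -/
structure IsRecurrenceGauge (S : Construction) (μ : Measure S.space)
    (Φ : ℕ → S.space → ℝ≥0∞) : Prop where
  one_le : ∀ n x, 1 ≤ Φ n x
  mono : ∀ x, Monotone fun n => Φ n x
  mul_measure_le : ∀ (n t : ℕ) (w : Fin n → Letter),
    (t : ℝ≥0∞) * μ {x | S.wordOf n x = w ∧ (t : ℝ≥0∞) < Φ n x} ≤ 1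
  card_le : ∀ (J n : ℕ), ∀ x ∈ S.goodSet J, 2 * S.len J ≤ n → (S.card J : ℝ≥0∞) ≤ Φ n x

namespace IsRecurrenceGauge

variable {μ : Measure S.space} {Φ : ℕ → S.space → ℝ≥0∞}

/-- A Markov-type bound: summing `mul_measure_le` over the at most `M` prefixes of `G` gives a
measure at most M / t = 1 / q. -/
lemma measure_le (hΦ : S.IsRecurrenceGauge μ Φ) (n : ℕ) (G : Set S.space) {M t q : ℕ}
    (hM : (S.wordOf n '' G).ncard ≤ M) (hM0 : 0 < M) (ht : t = q * M) (hq : 0 < q) :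
    μ {x | x ∈ G ∧ (t : ℝ≥0∞) < Φ n x} ≤ ENNReal.ofReal (1 / q) := by
  have hfin : (S.wordOf n '' G).Finite := toFinite _
  have h1 : {x | x ∈ G ∧ (t : ℝ≥0∞) < Φ n x} ⊆
      ⋃ w ∈ hfin.toFinset, {x | S.wordOf n x = w ∧ (t : ℝ≥0∞) < Φ n x} := fun x hx =>
    mem_iUnion₂.2 ⟨_, hfin.mem_toFinset.2 ⟨x, hx.1, rfl⟩, rfl, hx.2⟩
  have h2 : (t : ℝ≥0∞) * μ {x | x ∈ G ∧ (t : ℝ≥0∞) < Φ n x} ≤ M := by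
    calc (t : ℝ≥0∞) * μ {x | x ∈ G ∧ (t : ℝ≥0∞) < Φ n x}
        ≤ t * ∑ w ∈ hfin.toFinset, μ {x | S.wordOf n x = w ∧ (t : ℝ≥0∞) < Φ n x} := by
          gcongr
          exact (measure_mono h1).trans (measure_biUnion_finset_le _ _)
      _ ≤ ∑ w ∈ hfin.toFinset, 1 := by
          rw [Finset.mul_sum]
          exact Finset.sum_le_sum fun w _ => hΦ.mul_measure_le n t w
      _ ≤ M := by
          rw [Finset.sum_const, nsmul_eq_mul, mul_one, ← ncard_eq_toFinset_card _ hfin]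
          exact_mod_cast hM
  subst ht
  have hM' : (M : ℝ≥0∞) ≠ 0 := by exact_mod_cast hM0.ne'
  have hq' : (q : ℝ≥0∞) ≠ 0 := by exact_mod_cast hq.ne'
  rw [one_div, ENNReal.ofReal_inv_of_pos (by exact_mod_cast hq), ENNReal.ofReal_natCast,
    ← one_div, ENNReal.le_div_iff_mul_le (.inl hq') (.inl (ENNReal.natCast_ne_top q))]
  have h3 : (M : ℝ≥0∞) * (μ {x | x ∈ G ∧ ((q * M : ℕ) : ℝ≥0∞) < Φ n x} * q) ≤ M * 1 := by
    rw [mul_one]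
    refine le_trans (le_of_eq ?_) h2
    push_cast; ring
  exact (ENNReal.mul_le_mul_iff_right hM' (ENNReal.natCast_ne_top M)).1 h3

lemma log_nonneg (hΦ : S.IsRecurrenceGauge μ Φ) (n : ℕ) (x : S.space) :
    0 ≤ ENNReal.log (Φ n x) := ENNReal.zero_le_log_iff.2 (hΦ.one_le n x)

lemma log_natCast {m : ℕ} (hm : 0 < m) : ENNReal.log (m : ℝ≥0∞) = (Real.log m : ℝ) := by
  rw [← ENNReal.ofReal_natCast, ENNReal.log_ofReal_of_pos (by exact_mod_cast hm)]

/-- Borel–Cantelli with q = (n + 1) ^ 2 and all words of length `n`: the complexity contributes 30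
√n, and log q is eventually below √n. -/
lemma ae_eventually_log_le (hΦ : S.IsRecurrenceGauge μ Φ) (hS : S.IsLarge) :
    ∀ᵐ x ∂μ, ∀ᶠ n : ℕ in atTop, ENNReal.log (Φ n x) ≤ ((31 * √n : ℝ) : EReal) := by
  have hsum : Summable fun n : ℕ => 1 / (((n + 1) ^ 2 : ℕ) : ℝ) := by
    have := (summable_nat_add_iff 1).2 (Real.summable_one_div_nat_pow.2 one_lt_two)
    simpa using this
  have hlog : ∀ᶠ n : ℕ in atTop, 2 * Real.log (n + 1) ≤ √n := by
    have h1 := (isLittleO_log_rpow_atTop (show (0 : ℝ) < 1 / 2 by norm_num)).def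
      (show (0 : ℝ) < 1 / 4 by norm_num)
    filter_upwards [tendsto_natCast_atTop_atTop.eventually h1, eventually_ge_atTop 2] with n hn hn2
    have hn2' : (2 : ℝ) ≤ n := by exact_mod_cast hn2
    rw [← Real.sqrt_eq_rpow, Real.norm_of_nonneg (Real.sqrt_nonneg _),
      Real.norm_of_nonneg (Real.log_nonneg (by linarith))] at hn
    have h2 : Real.log (n + 1) ≤ Real.log ((n : ℝ) ^ 2) :=
      Real.log_le_log (by linarith) (by nlinarith)
    rw [Real.log_pow] at h2
    push_cast at h2
    linarith
  have h := ae_eventually_notMem (μ := μ)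
    (s := fun n : ℕ => {x | x ∈ univ ∧ (((n + 1) ^ 2 * S.complexity n : ℕ) : ℝ≥0∞) < Φ n x})
    (ne_top_of_le_ne_top hsum.tsum_ofReal_ne_top (ENNReal.tsum_le_tsum fun n =>
      hΦ.measure_le n univ (M := S.complexity n) (by rw [image_univ]; rfl) (complexity_pos hS n) rfl
        (by positivity)))
  filter_upwards [h] with x hx
  filter_upwards [hx, hlog, eventually_ge_atTop (S.len 0)] with n h1 h2 h3
  have hp := complexity_pos hS n
  have hp' : (S.complexity n : ℝ) ≠ 0 := by exact_mod_cast hp.ne'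
  have h4 : Φ n x ≤ (((n + 1) ^ 2 * S.complexity n : ℕ) : ℝ≥0∞) :=
    not_lt.1 fun h => h1 ⟨mem_univ x, h⟩
  refine (ENNReal.log_le_log h4).trans ?_
  rw [log_natCast (by positivity), EReal.coe_le_coe_iff]
  push_cast
  rw [Real.log_mul (by positivity) hp', Real.log_pow]
  have := log_complexity_le hS h3
  push_cast
  linarith

/-- Borel–Cantelli for the good sets, and for `measure_le` with q = 2 ^ J at the right end of the
range; monotonicity carries the upper bound to smaller `n`. The factor 3 comes from 2 ^ (J + 1), N
and l, whose logarithms are each eventually at most log N. -/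
lemma ae_eventually_log_mem (hΦ : S.IsRecurrenceGauge μ Φ) (hS : S.IsLarge)
    [IsProbabilityMeasure μ] (hμ : MeasurePreserving S.shift μ μ) :
    ∀ᵐ x ∂μ, ∀ᶠ J : ℕ in atTop, ∀ n, 2 * S.len J ≤ n → n ≤ S.runLength J * S.len J →
      (S.logCard J : EReal) ≤ ENNReal.log (Φ n x) ∧
        ENNReal.log (Φ n x) ≤ ((3 * S.logCard J : ℝ) : EReal) := by
  have hgood := ae_eventually_notMem (μ := μ) (s := fun J => (S.goodSet J)ᶜ)
    (ne_top_of_le_ne_top (summable_geometric_two.mul_left 8).tsum_ofReal_ne_top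
      (ENNReal.tsum_le_tsum fun J => measure_compl_goodSet_le hS hμ J))
  have hsum : Summable fun J : ℕ => 1 / ((2 ^ J : ℕ) : ℝ) := by
    simpa using summable_geometric_two
  have h := ae_eventually_notMem (μ := μ)
    (s := fun J : ℕ => {x | x ∈ S.goodSet J ∧
      ((2 ^ J * S.len (J + 1) : ℕ) : ℝ≥0∞) < Φ (S.runLength J * S.len J) x})
    (ne_top_of_le_ne_top hsum.tsum_ofReal_ne_top (ENNReal.tsum_le_tsum fun J =>
      hΦ.measure_le _ (S.goodSet J) (ncard_wordOf_goodSet_le hS J)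
        (by have := len_pos hS (J + 1); omega) rfl (by positivity)))
  filter_upwards [hgood, h] with x hx1 hx2
  filter_upwards [hx1, hx2, eventually_mul_log_len_le_logCard hS 1] with J h1 h2 h3 n hn1 hn2
  have hG : x ∈ S.goodSet J := not_not.1 h1
  have hl := one_le_len_real hS J
  have hc := card_pos_real hS J
  constructor
  · have h4 := ENNReal.log_le_log (hΦ.card_le J n x hG hn1)
    rwa [log_natCast (by have := large_card hS J; omega)] at h4
  · have h4 : Φ n x ≤ ((2 ^ J * S.len (J + 1) : ℕ) : ℝ≥0∞) :=
      (hΦ.mono x hn2).trans (not_lt.1 fun h => h2 ⟨hG, h⟩)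
    refine (ENNReal.log_le_log h4).trans ?_
    have h5 : 2 ^ J * S.len (J + 1) ≤ 2 ^ (J + 1) * (S.card J * S.len J) := by
      rw [pow_succ, mul_assoc]
      exact Nat.mul_le_mul_left _ (len_succ_le hS J)
    have h6 : ((2 ^ J * S.len (J + 1) : ℕ) : ℝ) ≤ 2 ^ (J + 1) * (S.card J * S.len J) := by
      exact_mod_cast h5
    have h7 : 0 < 2 ^ J * S.len (J + 1) := by have := len_pos hS (J + 1); positivity
    rw [log_natCast h7, EReal.coe_le_coe_iff]
    refine (Real.log_le_log (by exact_mod_cast h7) h6).trans ?_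
    rw [Real.log_mul (by positivity) (by positivity), Real.log_mul (by linarith) (by linarith),
      Real.log_pow]
    have h8 := two_pow_le_logCard hS J
    have h9 : ((J : ℝ) + 1) ≤ 2 ^ J := by exact_mod_cast Nat.lt_two_pow_self
    have h10 : Real.log 2 ≤ 1 := by have := Real.log_two_lt_d9; linarith
    have h11 : ((J : ℝ) + 1) * Real.log 2 ≤ (J : ℝ) + 1 :=
      mul_le_of_le_one_right (by positivity) h10
    change _ + (S.logCard J + _) ≤ _
    push_cast
    linarith

lemma hasRegularRates (hΦ : S.IsRecurrenceGauge μ Φ) (hS : S.IsLarge)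
    [IsProbabilityMeasure μ] (hμ : MeasurePreserving S.shift μ μ) :
    HasRegularRates μ fun x β n => ENNReal.log (Φ n x) / (((n : ℝ) ^ β : ℝ) : EReal) := by
  have hlim : ∀ {x : S.space} {n : ℕ → ℕ}, (∀ᶠ J : ℕ in atTop, ∀ n, 2 * S.len J ≤ n →
      n ≤ S.runLength J * S.len J → (S.logCard J : EReal) ≤ ENNReal.log (Φ n x) ∧
        ENNReal.log (Φ n x) ≤ ((3 * S.logCard J : ℝ) : EReal)) →
      (∀ᶠ J in atTop, 2 * S.len J ≤ n J ∧ n J ≤ S.runLength J * S.len J) → ∀ β : ℝ,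
      (Tendsto (fun J => S.logCard J / (n J : ℝ) ^ β) atTop (𝓝 0) →
        Tendsto (fun J => ENNReal.log (Φ (n J) x) / (((n J : ℝ) ^ β : ℝ) : EReal)) atTop (𝓝 0)) ∧
      (Tendsto (fun J => S.logCard J / (n J : ℝ) ^ β) atTop atTop →
        Tendsto (fun J => ENNReal.log (Φ (n J) x) / (((n J : ℝ) ^ β : ℝ) : EReal)) atTop
          (𝓝 ⊤)) := by
    intro x n hx hn β
    refine ⟨fun h => ?_, fun h => ?_⟩
    · refine tendsto_ereal_div_zero (b := fun J => 3 * S.logCard J)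
        (.of_forall fun J => hΦ.log_nonneg _ _) ?_ (fun J => by positivity) ?_
      · filter_upwards [hx, hn] with J h1 h2
        exact (h1 _ h2.1 h2.2).2
      · have := h.const_mul 3
        rw [mul_zero] at this
        exact this.congr fun J => by ring
    · refine tendsto_ereal_div_top (b := S.logCard) ?_ (fun J => by positivity) h
      filter_upwards [hx, hn] with J h1 h2
      exact (h1 _ h2.1 h2.2).1
  have hae := hΦ.ae_eventually_log_mem hS hμ
  -- The set of full measure is that of `ae_eventually_log_mem`, the same for all τ, and the times
  -- are chosen independently of the point. For the limsup, τ = 1/2 gives ∞ below 1/2, and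
  -- `ae_eventually_log_le` gives 0 above.
  refine ⟨?_, _, hae, fun τ hτ => ?_⟩
  · obtain ⟨n, hn, hn1, hn2⟩ := exists_times_pos hS (τ := 1 / 2) (by norm_num) le_rfl
    filter_upwards [hae, hΦ.ae_eventually_log_le hS] with x hx hx' β hβ
    refine ⟨fun h => (tendsto_ereal_div_zero (.of_forall fun J => hΦ.log_nonneg _ _) hx'
      (fun n => by positivity) ?_).limsup_eq, fun h => limsup_eq_top_of_tendsto hn.tendsto_atTop
        ((hlim hx hn1 β).2 ((hn2 β hβ).2 h))⟩
    have h1 := ((tendsto_rpow_neg_atTop (sub_pos.2 h)).comp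
      tendsto_natCast_atTop_atTop).const_mul 31
    rw [mul_zero] at h1
    refine h1.congr' ?_
    filter_upwards [eventually_gt_atTop 0] with n hn
    have hn' : (0 : ℝ) < n := by exact_mod_cast hn
    rw [Function.comp_apply, neg_sub, Real.rpow_sub hn', ← Real.sqrt_eq_rpow, mul_div_assoc]
  · rcases hτ.1.eq_or_lt with rfl | h0
    · obtain ⟨n, hn, hn1, hn2⟩ := exists_times_zero hS
      exact ⟨n, hn, fun x hx β hβ => ⟨fun _ => (hlim hx hn1 β).1 (hn2 β hβ),
        fun h => absurd h hβ.not_gt⟩⟩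
    · obtain ⟨n, hn, hn1, hn2⟩ := exists_times_pos hS h0 hτ.2
      exact ⟨n, hn, fun x hx β hβ => ⟨fun h => (hlim hx hn1 β).1 ((hn2 β hβ).1 h),
        fun h => (hlim hx hn1 β).2 ((hn2 β hβ).2 h)⟩⟩

end IsRecurrenceGauge

lemma measurableSet_cylinder (n : ℕ) (x : S.space) : MeasurableSet (S.cylinder n x) := by
  refine (show S.IsLocal n (S.cylinder n x) from fun y z hyz hy i hi => ?_).measurableSet
  rw [← hy i hi]
  exact (hyz i (by rw [abs_le]; omega)).symm

lemma card_le_len_succ (hS : S.IsLarge) (J : ℕ) : S.card J ≤ S.len (J + 1) :=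
  (Nat.le_mul_of_pos_right _ (by have := len_pos hS J; omega)).trans (card_mul_len_le S J)

/-- The points of a cylinder around a good point do not return to it before `len (J + 1)`, so that
many of its preimages are disjoint and its measure is at most the inverse. -/
lemma isRecurrenceGauge_inv_measure (hS : S.IsLarge) (hM : S.HasMarkers) {μ : Measure S.space}
    [IsProbabilityMeasure μ] (hμ : MeasurePreserving S.shift μ μ) :
    S.IsRecurrenceGauge μ fun n x => (μ (S.cylinder n x))⁻¹ where
  one_le n x := ENNReal.one_le_inv.2 prob_le_one
  mono x m n hmn := ENNReal.inv_le_inv.2 (measure_mono fun y hy i hi => hy i (hi.trans_le hmn))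
  mul_measure_le n t w := by
    rcases eq_empty_or_nonempty {x | S.wordOf n x = w ∧ (t : ℝ≥0∞) < (μ (S.cylinder n x))⁻¹}
      with h | ⟨x, hx, hxt⟩
    · rw [h]; simp
    · rw [← one_div] at hxt
      refine le_trans ?_ (ENNReal.mul_le_of_le_div hxt.le)
      gcongr
      intro y hy
      exact mem_cylinder_iff.2 (hy.1.trans hx.symm)
  card_le J n x hx hn := by
    have hl := len_pos hS (J + 1)
    have h := measure_mul_le_one hμ (measurableSet_cylinder n x) (S.len (J + 1) - 1)
      fun y hy j hj hjt hyj => by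
        have := len_le_of_return hS hM hx hn hy hj hyj
        omega
    rw [Nat.sub_add_cancel (by omega)] at h
    refine le_trans (Nat.cast_le.2 (card_le_len_succ hS J)) ?_
    exact ENNReal.le_inv_iff_mul_le.2 h

lemma natCast_le_returnTime {n m : ℕ} {x : S.space}
    (h : ∀ j, 0 < j → S.shift^[j] x ∈ S.cylinder n x → m ≤ j) :
    (m : ℕ∞) ≤ S.returnTime n x := by
  refine le_iInf₂ fun j hj => Nat.cast_le.2 (h j hj.1 fun i hi => ?_)
  rw [iterate_shift_apply, ← hj.2 i hi, add_comm]

lemma returnTime_le {n j : ℕ} {x : S.space} (hj : 0 < j) (h : S.shift^[j] x ∈ S.cylinder n x) :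
    S.returnTime n x ≤ j := by
  refine iInf₂_le j ⟨hj, fun i hi => ?_⟩
  rw [← h i hi, iterate_shift_apply, add_comm]

lemma isRecurrenceGauge_returnTime (hS : S.IsLarge) (hM : S.HasMarkers) {μ : Measure S.space}
    [IsProbabilityMeasure μ] (hμ : MeasurePreserving S.shift μ μ) :
    S.IsRecurrenceGauge μ fun n x => ((S.returnTime n x : ℕ∞) : ℝ≥0∞) where
  one_le n x := by
    have h : ((1 : ℕ) : ℕ∞) ≤ S.returnTime n x := natCast_le_returnTime fun j hj _ => hj
    exact_mod_cast ENat.toENNReal_le.2 h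
  mono x m n hmn := by
    refine ENat.toENNReal_le.2 (le_iInf₂ fun j hj => iInf₂_le j ⟨hj.1, fun i hi => ?_⟩)
    exact hj.2 i (hi.trans_le hmn)
  mul_measure_le n t w := by
    -- The points with prefix `w` that do not return up to time `t`: a return to `A` would be a
    -- return to the cylinder, so `measure_mul_le_one` applies.
    set A : Set S.space := {x | S.wordOf n x = w ∧ ∀ j, 0 < j → j ≤ t →
      S.shift^[j] x ∉ S.cylinder n x} with hA
    have hAm : MeasurableSet A := by
      refine (show S.IsLocal (n + t) A from fun x y hxy hx => ?_).measurableSet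
      have hxy' : ∀ i : ℕ, i < n + t → x.1 i = y.1 i := fun i hi =>
        hxy i (by rw [abs_le]; omega)
      refine ⟨?_, fun j hj hjt hy => hx.2 j hj hjt fun i hi => ?_⟩
      · rw [← hx.1]
        funext i
        exact (hxy' i (by omega)).symm
      · have h1 := hy i hi
        rw [iterate_shift_apply] at h1 ⊢
        rw [hxy' i (by omega), ← h1]
        exact_mod_cast hxy' (i + j) (by omega)
    have h := measure_mul_le_one hμ hAm t fun x hx j hj hjt hxj =>
      hx.2 j hj hjt (mem_cylinder_iff.2 (hxj.1.trans hx.1.symm))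
    refine le_trans (mul_le_mul' (Nat.cast_le.2 t.le_succ) (measure_mono fun x hx => ?_)) h
    refine ⟨hx.1, fun j hj hjt hxj => hx.2.not_ge ?_⟩
    have := ENat.toENNReal_le.2 ((returnTime_le hj hxj).trans (Nat.cast_le.2 hjt))
    exact_mod_cast this
  card_le J n x hx hn := by
    have h : ((S.card J : ℕ) : ℕ∞) ≤ S.returnTime n x := natCast_le_returnTime fun j hj hxj =>
      (card_le_len_succ hS J).trans (len_le_of_return hS hM hx hn (fun _ _ => rfl) hj hxj)
    exact_mod_cast ENat.toENNReal_le.2 h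

lemma hasRegularRates_atomRate (hS : S.IsLarge) (hM : S.HasMarkers) {μ : Measure S.space}
    [IsProbabilityMeasure μ] (hμ : MeasurePreserving S.shift μ μ) :
    HasRegularRates μ (S.atomRate μ) := by
  have h := (isRecurrenceGauge_inv_measure hS hM hμ).hasRegularRates hS hμ
  simp only [ENNReal.log_inv] at h
  exact h

lemma hasRegularRates_returnRate (hS : S.IsLarge) (hM : S.HasMarkers) {μ : Measure S.space}
    [IsProbabilityMeasure μ] (hμ : MeasurePreserving S.shift μ μ) :
    HasRegularRates μ S.returnRate :=
  (isRecurrenceGauge_returnTime hS hM hμ).hasRegularRates hS hμ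

end Construction

end SpacerSubshift

theorem mainTheorem4 :
    ∃ L : ℕ, ∀ S : SpacerSubshift.Construction, L ≤ S.side ^ 2 →
      SpacerSubshift.IsStrictlyErgodic S.shift ∧
      SpacerSubshift.HasEntropyDim S.shift (1 / 2) ∧
      SpacerSubshift.IsTopWeakMixing S.shift ∧
      ∀ μ : MeasureTheory.Measure S.space, MeasureTheory.IsProbabilityMeasure μ →
        MeasureTheory.MeasurePreserving S.shift μ μ →
          SpacerSubshift.IsMetricWeakMixing S.shift μ ∧
          SpacerSubshift.IsMetricRigid S.shift μ ∧
          (S.HasMarkers →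
            SpacerSubshift.HasRegularRates μ (S.atomRate μ) ∧
            SpacerSubshift.HasRegularRates μ S.returnRate) := by
  -- 10000 is the square of the bound 100 in `IsLarge`.
  refine ⟨10000, fun S hL => ?_⟩
  have hS : S.IsLarge := by
    unfold SpacerSubshift.Construction.IsLarge
    nlinarith
  refine ⟨SpacerSubshift.Construction.isStrictlyErgodic hS,
    SpacerSubshift.Construction.hasEntropyDim hS,
    SpacerSubshift.Construction.isTopWeakMixing hS, fun μ _ hμ =>
    ⟨SpacerSubshift.Construction.isMetricWeakMixing hS hμ,
      SpacerSubshift.Construction.isMetricRigid hS hμ, fun hM =>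
      ⟨SpacerSubshift.Construction.hasRegularRates_atomRate hS hM hμ,
        SpacerSubshift.Construction.hasRegularRates_returnRate hS hM hμ⟩⟩⟩
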